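/- Let $\mu>0$. For $j=1,2$ fix a Keplerian ellipse about a centre with gravitational parameter $\mu$, given by its semi-major axis $a_j>0$, eccentricity $0\le e_j<1$, inclination, right ascension of the ascending node and argument of periapsis. Let $n_j=\sqrt{\mu/a_j^3}$, and let $r_j(M)$, $v_j(M)\in\mathbb R^3$ be the position and velocity on it at mean anomaly $M$. Fix a transfer type $d\in\{\text{short},\text{long}\}$. A zero-revolution Lambert arc of type $d$ from $r_1$ to $r_2$ with time of flight $t>0$ is a solution of $\ddot r=-\mu r/\|r\|^3$ on $[0,t]$ with $r(0)=r_1$, $r(t)=r_2$ whose swept angle about the centre lies in $(0,\pi)$ (short) or $(\pi,2\pi)$ (long); $v_1^\Gamma(r_1,r_2,t)$ and $v_2^\Gamma(r_1,r_2,t)$ denote its initial and final velocities. Put $$J(M_1,M_2,t)=\|v_1^\Gamma-v_1(M_1)\|+\|v_2(M_2)-v_2^\Gamma\|,$$ with the arc taken from $r_1(M_1)$ to $r_2(M_2)$. For given reference anomalies $M_1^0,M_2^0$ let $J(T,t)$ be the same cost at $M_1=n_1T+M_1^0$, $M_2=n_2(T+t)+M_2^0$. Write $\delta/\delta t$ for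 the derivative in $t$ at fixed $M_1,M_2$ (so at fixed end points). Then for all $\eta>0$ and $\varepsilon>0$ there is $t_0>0$ such that for all $M_1^0,M_2^0,T$ and all $t\ge t_0$ for which the angle between $r_1(M_1)$ and $r_2(M_2)$ has sine at least $\eta$: 1. the terminal velocities of a Lambert arc of type $d$ from $r_1(M_1)$ to $r_2(M_2)$ with time of flight $t$ exist and are unique, $v_1^\Gamma$ and $v_2^\Gamma$ are differentiable in $t$ at fixed end points, and $J$ is differentiable at $(M_1,M_2,t)$; 2. $\left\|\frac{\delta v_1^\Gamma}{\delta t}\right\|<\varepsilon$, $\left\|\frac{\delta v_2^\Gamma}{\delta t}\right\|<\varepsilon$ and $\left|\frac{\delta J}{\delta t}\right|<\varepsilon$; 3. $\frac{\partial J}{\partial T}=n_1\frac{\partial J}{\partial M_1}+n_2\frac{\partial J}{\partial M_2}$ and $\frac{\partial J}{\partial t}=n_2\frac{\partial J}{\partial M_2}+\frac{\delta J}{\delta t}$, where $\partial J/\partial T$, $\partial J/\partial t$ are the partial derivatives of $J(T,t)$; 4. the temporal constraints approach the angular ones up to a fixed invertible linear map: $\left|\frac1{n_1}\left(\frac{\partial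 J}{\partial T}-\frac{\partial J}{\partial t}\right)-\frac{\partial J}{\partial M_1}\right|<\varepsilon$ and $\left|\frac1{n_2}\frac{\partial J}{\partial t}-\frac{\partial J}{\partial M_2}\right|<\varepsilon$; 5. in particular, if $\frac{\partial J}{\partial T}=\frac{\partial J}{\partial t}=0$, then $\left|\frac{\partial J}{\partial M_1}\right|,\left|\frac{\partial J}{\partial M_2}\right|<\varepsilon$; and if $\frac{\partial J}{\partial M_1}=\frac{\partial J}{\partial M_2}=0$, then $\left|\frac{\partial J}{\partial T}\right|,\left|\frac{\partial J}{\partial t}\right|<\varepsilon$. -/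

import Mathlib

namespace TwoImpulse

noncomputable section

/-- Inertial three-space with the Euclidean norm. -/
abbrev E3 : Type := EuclideanSpace ℝ (Fin 3)

/-- The five fixed classical elements of a Keplerian ellipse: semi-major axis, eccentricity,
inclination, right ascension of the ascending node, argument of periapsis. -/
structure OrbitalElements where
  a : ℝ
  e : ℝ
  inc : ℝ
  raan : ℝ
  aop : ℝ
  a_pos : 0 < a
  e_nonneg : 0 ≤ e
  e_lt_one : e < 1

/-- Mean motion `n = √(μ / a³)`. -/
def meanMotion (μ : ℝ) (o : OrbitalElements) : ℝ := Real.sqrt (μ / o.a ^ 3)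

/-- The eccentric anomaly at mean anomaly `M`: the solution `E` of Kepler's equation
`E - e sin E = M` (it exists and is unique, as `0 ≤ e < 1`). -/
def eccentricAnomaly (o : OrbitalElements) (M : ℝ) : ℝ :=
  Classical.epsilon fun E : ℝ => E - o.e * Real.sin E = M

/-- The direction cosine matrix (Euler 3-1-3 sequence) from the perifocal to the inertial frame. -/
def perifocalToInertial (o : OrbitalElements) : Matrix (Fin 3) (Fin 3) ℝ :=
  let cΩ := Real.cos o.raan
  let sΩ := Real.sin o.raan
  let cω := Real.cos o.aop
  let sω := Real.sin o.aop
  let ci := Real.cos o.inc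
  let si := Real.sin o.inc
  !![cΩ * cω - sΩ * sω * ci, -cΩ * sω - sΩ * cω * ci, sΩ * si;
     sΩ * cω + cΩ * sω * ci, -sΩ * sω + cΩ * cω * ci, -cΩ * si;
     sω * si, cω * si, ci]

/-- Position on the ellipse at mean anomaly `M`. -/
def orbitPos (o : OrbitalElements) (M : ℝ) : E3 :=
  let E := eccentricAnomaly o M
  WithLp.toLp 2 ((perifocalToInertial o).mulVec
    ![o.a * (Real.cos E - o.e), o.a * (Real.sqrt (1 - o.e ^ 2) * Real.sin E), 0])

/-- Velocity on the ellipse at mean anomaly `M`. -/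
def orbitVel (μ : ℝ) (o : OrbitalElements) (M : ℝ) : E3 :=
  let E := eccentricAnomaly o M
  (Real.sqrt (μ * o.a) / ‖orbitPos o M‖) •
    WithLp.toLp 2 ((perifocalToInertial o).mulVec
      ![-Real.sin E, Real.sqrt (1 - o.e ^ 2) * Real.cos E, 0])

/-- `r, v` solve the Kepler problem `r' = v`, `v' = -μ r / ‖r‖³` on `[0, t]`, without collision. -/
def IsKeplerArc (μ t : ℝ) (r v : ℝ → E3) : Prop :=
  ∀ τ ∈ Set.Icc 0 t, r τ ≠ 0 ∧
    HasDerivWithinAt r (v τ) (Set.Icc 0 t) τ ∧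
    HasDerivWithinAt v (-(μ / ‖r τ‖ ^ 3) • r τ) (Set.Icc 0 t) τ

/-- `θ` is the angle swept by `r` about the origin during `[0, t]`: in some orthonormal frame
`p, q` of a plane that contains the arc, `r` has a continuous polar angle `f`, and
`θ = f t - f 0`. (Reversing the orientation of the frame changes the sign of `θ`; for a Kepler arc
that is not rectilinear exactly one of the two signs is positive, and that value is the change in
true anomaly. It is not reduced modulo `2π`.) -/
def SweepsAngle (t : ℝ) (r : ℝ → E3) (θ : ℝ) : Prop :=
  ∃ (p q : E3) (f : ℝ → ℝ), ‖p‖ = 1 ∧ ‖q‖ = 1 ∧ inner ℝ p q = 0 ∧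
    ContinuousOn f (Set.Icc 0 t) ∧
    (∀ τ ∈ Set.Icc 0 t, r τ = ‖r τ‖ • (Real.cos (f τ) • p + Real.sin (f τ) • q)) ∧
    θ = f t - f 0

/-- The switch between short and long transfers. -/
inductive TransferType : Type
  | short
  | long

/-- Admissible transfer angles of zero-revolution arcs of the given type. -/
def TransferType.angles : TransferType → Set ℝ
  | .short => Set.Ioo 0 Real.pi
  | .long => Set.Ioo Real.pi (2 * Real.pi)

/-- `w = (w₁, w₂)` are the initial and final velocities of a zero-revolution Lambert arc of type
`d` from `r₁` to `r₂` with time of flight `t`. -/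
def IsLambertVelocities (μ : ℝ) (d : TransferType) (r₁ r₂ : E3) (t : ℝ) (w : E3 × E3) : Prop :=
  0 < t ∧ ∃ r v : ℝ → E3, IsKeplerArc μ t r v ∧ r 0 = r₁ ∧ r t = r₂ ∧
    (∃ θ ∈ d.angles, SweepsAngle t r θ) ∧ w = (v 0, v t)

/-- The terminal velocities of the zero-revolution Lambert arc. -/
def lambertVelocities (μ : ℝ) (d : TransferType) (r₁ r₂ : E3) (t : ℝ) : E3 × E3 :=
  Classical.epsilon fun w => IsLambertVelocities μ d r₁ r₂ t w

/-- Departure velocity on the Lambert arc. -/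
def lambertV₁ (μ : ℝ) (d : TransferType) (r₁ r₂ : E3) (t : ℝ) : E3 :=
  (lambertVelocities μ d r₁ r₂ t).1

/-- Arrival velocity on the Lambert arc. -/
def lambertV₂ (μ : ℝ) (d : TransferType) (r₁ r₂ : E3) (t : ℝ) : E3 :=
  (lambertVelocities μ d r₁ r₂ t).2

/-- The cost `J(M₁, M₂, t) = ‖Δv₁‖ + ‖Δv₂‖`. -/
def cost (μ : ℝ) (o₁ o₂ : OrbitalElements) (d : TransferType) (M₁ M₂ t : ℝ) : ℝ :=
  ‖lambertV₁ μ d (orbitPos o₁ M₁) (orbitPos o₂ M₂) t - orbitVel μ o₁ M₁‖ +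
    ‖orbitVel μ o₂ M₂ - lambertV₂ μ d (orbitPos o₁ M₁) (orbitPos o₂ M₂) t‖

/-- Mean anomaly at time `s` with value `M₀` at the reference time. -/
def meanAnomaly (μ : ℝ) (o : OrbitalElements) (M₀ s : ℝ) : ℝ := meanMotion μ o * s + M₀

/-- The cost as a function `J(T, t)` of departure time and time of flight. -/
def temporalCost (μ : ℝ) (o₁ o₂ : OrbitalElements) (d : TransferType) (M₁₀ M₂₀ T t : ℝ) : ℝ :=
  cost μ o₁ o₂ d (meanAnomaly μ o₁ M₁₀ T) (meanAnomaly μ o₂ M₂₀ (T + t)) t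

/-- `(∂J/∂M₁, ∂J/∂M₂)` for `J = J(M₁, M₂, t)`. -/
def angularConstraint (μ : ℝ) (o₁ o₂ : OrbitalElements) (d : TransferType) (M₁ M₂ t : ℝ) : ℝ × ℝ :=
  (deriv (fun x => cost μ o₁ o₂ d x M₂ t) M₁, deriv (fun x => cost μ o₁ o₂ d M₁ x t) M₂)

/-- `(∂J/∂T, ∂J/∂t)` for `J = J(T, t)`. -/
def temporalConstraint (μ : ℝ) (o₁ o₂ : OrbitalElements) (d : TransferType)
    (M₁₀ M₂₀ T t : ℝ) : ℝ × ℝ :=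
  (deriv (fun s => temporalCost μ o₁ o₂ d M₁₀ M₂₀ s t) T,
    deriv (fun s => temporalCost μ o₁ o₂ d M₁₀ M₂₀ T s) t)

/-- The explicit sensitivity `δJ/δt`, at fixed `M₁, M₂`. -/
def explicitRate (μ : ℝ) (o₁ o₂ : OrbitalElements) (d : TransferType) (M₁ M₂ t : ℝ) : ℝ :=
  deriv (fun s => cost μ o₁ o₂ d M₁ M₂ s) t

end

end TwoImpulse

/-! A zero-revolution arc between end points at bounded distance can last long only by climbing far
out, along an ellipse close to a parabola. Its terminal velocities approach those of the limiting
parabolic arc and so hardly depend on the time of flight.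

If the energy is nonnegative, `‖r‖²` is strongly convex in time, which bounds the time of flight
(`sq_time_le_of_energy_nonneg`). If the energy is `-2ω² < 0`, the Levi-Civita square root `w` of the
planar motion is a harmonic oscillation of frequency `ω` in the fictitious time `s`, where `ds/dt =
1/‖r‖`. Turning by less than a revolution confines the phase `φ = ω s` at arrival to `(0, π)`. The
phase gives the end velocities and the time of flight explicitly (`exists_anomaly_of_motion`), and
every phase comes from an arc (`exists_motion_of_anomaly`). For long times, Lambert's problem is
thus one scalar equation, `flightTime μ σ ρ φ = t`.

The time of flight blows up only as `φ → π`, and there its derivative is at least a constant times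
`sin⁻⁴ φ`. Hence a large `t` has exactly one phase, with small sine (`exists_unique_phase`). The
velocities have bounded derivative in `φ`, so their derivative in `t` is `O(sin⁴ φ)`; the energy of
the arc is `O(sin² φ)`. The constants depend only on bounds for the distances and on a lower bound
for `σ - 2|ρ|`, which the sine of the angle between the end points supplies, so everything is
uniform.

The implicit function theorem makes the phase differentiable in the end points and the time
(`exists_phase_function`). The cost is a sum of two norms, differentiable because no impulse
vanishes: the energy of the arc is near zero, that of each ellipse is `-μ/(2a)`. The chain rule then
gives the temporal constraints as a triangular image of the angular ones plus the small `δJ/δt`. -/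

namespace TwoImpulse

open Set Filter Topology

/-! ### Kepler motions: energy, and the bound on the time of flight at nonnegative energy -/

section KeplerMotion

variable {V : Type*} [NormedAddCommGroup V] [InnerProductSpace ℝ V]

/-- `r, v` solve the Kepler problem on `[0, t]` in the inner product space `V`. -/
def IsKeplerMotion (μ t : ℝ) (r v : ℝ → V) : Prop :=
  ∀ τ ∈ Icc 0 t, r τ ≠ 0 ∧
    HasDerivWithinAt r (v τ) (Icc 0 t) τ ∧
    HasDerivWithinAt v (-(μ / ‖r τ‖ ^ 3) • r τ) (Icc 0 t) τ

theorem eq_left_of_hasDerivWithinAt_zero {F : Type*} [NormedAddCommGroup F] [NormedSpace ℝ F]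
    {t : ℝ} {g : ℝ → F} (h : ∀ τ ∈ Icc 0 t, HasDerivWithinAt g 0 (Icc 0 t) τ) :
    ∀ τ ∈ Icc 0 t, g τ = g 0 :=
  constant_of_derivWithin_zero (fun x hx => (h x hx).differentiableWithinAt) fun x hx =>
    (h x (Ico_subset_Icc_self hx)).derivWithin
      (uniqueDiffOn_Icc (hx.1.trans_lt hx.2) x (Ico_subset_Icc_self hx))

theorem hasDerivWithinAt_norm_of_ne_zero {r : ℝ → V} {r' : V} {s : Set ℝ} {τ : ℝ}
    (hr : HasDerivWithinAt r r' s τ) (h0 : r τ ≠ 0) :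
    HasDerivWithinAt (fun x => ‖r x‖) (inner ℝ (r τ) r' / ‖r τ‖) s τ := by
  have hn : ‖r τ‖ ≠ 0 := norm_ne_zero_iff.mpr h0
  have h := hr.norm_sq.sqrt (pow_ne_zero 2 hn)
  simp only [Real.sqrt_sq (norm_nonneg _)] at h
  convert h using 1
  field_simp

/-- The orbital energy. -/
noncomputable def energy (μ : ℝ) (r v : V) : ℝ := ‖v‖ ^ 2 / 2 - μ / ‖r‖

/-- The Lagrange-Jacobi identity. It serves twice: for the convexity of `‖r‖²` at nonnegative
energy, and for the closed form of the fictitious time at negative energy. -/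
theorem hasDerivWithinAt_inner_pos_vel {μ t : ℝ} {r v : ℝ → V} (h : IsKeplerMotion μ t r v)
    {τ : ℝ} (hτ : τ ∈ Icc 0 t) :
    HasDerivWithinAt (fun x => inner ℝ (r x) (v x)) (‖v τ‖ ^ 2 - μ / ‖r τ‖) (Icc 0 t) τ := by
  obtain ⟨h0, hr, hv⟩ := h τ hτ
  have hn : ‖r τ‖ ≠ 0 := norm_ne_zero_iff.mpr h0
  refine (hr.inner ℝ hv).congr_deriv ?_
  rw [inner_smul_right, real_inner_self_eq_norm_sq, real_inner_self_eq_norm_sq]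
  field_simp
  ring

theorem energy_eq {μ t : ℝ} {r v : ℝ → V} (h : IsKeplerMotion μ t r v) :
    ∀ τ ∈ Icc 0 t, energy μ (r τ) (v τ) = energy μ (r 0) (v 0) := by
  apply eq_left_of_hasDerivWithinAt_zero (g := fun τ => energy μ (r τ) (v τ))
  intro τ hτ
  obtain ⟨h0, hr, hv⟩ := h τ hτ
  have hn : ‖r τ‖ ≠ 0 := norm_ne_zero_iff.mpr h0
  have h1 := (hv.norm_sq.div_const 2).sub
    ((hasDerivWithinAt_norm_of_ne_zero hr h0).fun_inv hn |>.const_mul μ)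
  simp only [← div_eq_mul_inv] at h1
  refine h1.congr_deriv ?_
  rw [inner_smul_right, real_inner_comm]
  field_simp
  ring

/-- On a motion with nonnegative energy, the distance to the centre is bounded by its values at
the end points, and the time of flight is bounded in terms of them. -/
theorem sq_time_le_of_energy_nonneg {μ t R : ℝ} (hμ : 0 < μ) (ht : 0 ≤ t) {r v : ℝ → V}
    (h : IsKeplerMotion μ t r v) (hE : 0 ≤ energy μ (r 0) (v 0))
    (h0 : ‖r 0‖ ≤ R) (h1 : ‖r t‖ ≤ R) : t ^ 2 ≤ 4 * R ^ 3 / μ := by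
  have m0 : (0 : ℝ) ∈ Icc 0 t := ⟨le_rfl, ht⟩
  have m1 : t ∈ Icc 0 t := ⟨ht, le_rfl⟩
  have hR : 0 < R := (norm_pos_iff.mpr (h 0 m0).1).trans_le h0
  have hcont : ContinuousOn (fun τ => ‖r τ‖ ^ 2) (Icc 0 t) := fun τ hτ =>
    (h τ hτ).2.1.norm_sq.continuousWithinAt
  have hd1 : ∀ τ ∈ interior (Icc 0 t), HasDerivWithinAt (fun τ => ‖r τ‖ ^ 2)
      (2 * inner ℝ (r τ) (v τ)) (interior (Icc 0 t)) τ := fun τ hτ =>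
    (h τ (interior_subset hτ)).2.1.norm_sq.mono interior_subset
  have hd2 : ∀ τ ∈ interior (Icc 0 t), HasDerivWithinAt (fun τ => 2 * inner ℝ (r τ) (v τ))
      (2 * (‖v τ‖ ^ 2 - μ / ‖r τ‖)) (interior (Icc 0 t)) τ := fun τ hτ =>
    ((hasDerivWithinAt_inner_pos_vel h (interior_subset hτ)).const_mul 2).mono interior_subset
  -- Nonnegative energy means `‖v‖² ≥ 2μ/‖r‖`, so the second derivative of `‖r‖²` is at least
  -- `2μ/‖r‖`.
  have hlow : ∀ τ ∈ Icc 0 t, μ / ‖r τ‖ ≤ ‖v τ‖ ^ 2 - μ / ‖r τ‖ := by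
    intro τ hτ
    have := energy_eq h τ hτ
    rw [← this, energy] at hE
    linarith
  have hconv : ConvexOn ℝ (Icc 0 t) (fun τ => ‖r τ‖ ^ 2) := by
    refine convexOn_of_hasDerivWithinAt2_nonneg (convex_Icc 0 t) hcont hd1 hd2 fun τ hτ => ?_
    have := hlow τ (interior_subset hτ)
    have : 0 ≤ μ / ‖r τ‖ := by positivity
    linarith
  have hle : ∀ τ ∈ Icc 0 t, ‖r τ‖ ≤ R := by
    intro τ hτ
    have := hconv.le_max_of_mem_Icc m0 m1 hτ
    have h2 : max (‖r 0‖ ^ 2) (‖r t‖ ^ 2) ≤ R ^ 2 := max_le (by gcongr) (by gcongr)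
    exact (sq_le_sq₀ (norm_nonneg _) hR.le).mp (this.trans h2)
  -- With `‖r‖ ≤ R` the second derivative is at least `2μ/R`, so convexity survives subtracting this
  -- parabola. Comparing the midpoint with the end points then bounds `t²`.
  have hconv2 : ConvexOn ℝ (Icc 0 t) (fun τ => ‖r τ‖ ^ 2 - μ / R * τ ^ 2) := by
    refine convexOn_of_hasDerivWithinAt2_nonneg (convex_Icc 0 t)
      (f' := fun τ => 2 * inner ℝ (r τ) (v τ) - μ / R * (2 * τ))
      (f'' := fun τ => 2 * (‖v τ‖ ^ 2 - μ / ‖r τ‖) - μ / R * 2)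
      (hcont.sub (by fun_prop)) (fun τ hτ => ?_) (fun τ hτ => ?_) fun τ hτ => ?_
    · refine (hd1 τ hτ).sub (HasDerivAt.hasDerivWithinAt ?_)
      simpa using (hasDerivAt_pow 2 τ).const_mul (μ / R)
    · refine (hd2 τ hτ).sub (HasDerivAt.hasDerivWithinAt ?_)
      simpa using ((hasDerivAt_id τ).const_mul 2).const_mul (μ / R)
    · have h3 := hlow τ (interior_subset hτ)
      have h4 : μ / R ≤ μ / ‖r τ‖ :=
        div_le_div_of_nonneg_left hμ.le (norm_pos_iff.mpr (h τ (interior_subset hτ)).1)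
          (hle τ (interior_subset hτ))
      linarith
  have hmid := hconv2.2 m0 m1 (show (0 : ℝ) ≤ 1 / 2 by norm_num)
    (show (0 : ℝ) ≤ 1 / 2 by norm_num) (by norm_num)
  simp only [smul_eq_mul, mul_zero, zero_add] at hmid
  have h5 : ‖r 0‖ ^ 2 ≤ R ^ 2 := by gcongr
  have h6 : ‖r t‖ ^ 2 ≤ R ^ 2 := by gcongr
  have h7 : 0 ≤ ‖r (1 / 2 * t)‖ ^ 2 := by positivity
  have h8 : μ / R * t ^ 2 ≤ 4 * R ^ 2 := by nlinarith
  rw [le_div_iff₀ hμ]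
  have : μ / R * t ^ 2 * R ≤ 4 * R ^ 2 * R := by gcongr
  have e : μ / R * t ^ 2 * R = t ^ 2 * μ := by field_simp
  nlinarith

end KeplerMotion

/-- A function on the line whose derivative is bounded below by a positive constant is bijective,
with differentiable inverse. -/
theorem exists_inverse_of_deriv_ge {g g' : ℝ → ℝ} {c : ℝ} (hc : 0 < c)
    (hg : ∀ x, HasDerivAt g (g' x) x) (hg' : ∀ x, c ≤ g' x) :
    StrictMono g ∧ ∃ k : ℝ → ℝ, (∀ y, g (k y) = y) ∧ (∀ x, k (g x) = x) ∧
      ∀ y, HasDerivAt k (g' (k y))⁻¹ y := by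
  have hmono : StrictMono g := strictMono_of_hasDerivAt_pos hg fun x => hc.trans_le (hg' x)
  have hcont : Continuous g := continuous_iff_continuousAt.mpr fun x => (hg x).continuousAt
  have hlin : Monotone fun x => g x - c * x :=
    monotone_of_hasDerivAt_nonneg
      (fun x => (hg x).sub ((hasDerivAt_id x).const_mul c))
      fun x => by simpa using hg' x
  have htop : Tendsto g atTop atTop := by
    refine tendsto_atTop_mono' atTop (f₁ := fun x => c * x + g 0) ?_
      (tendsto_atTop_add_const_right _ _ (tendsto_id.const_mul_atTop hc))
    filter_upwards [eventually_ge_atTop 0] with x hx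
    have := hlin hx
    simp only [mul_zero, sub_zero] at this
    linarith
  have hbot : Tendsto g atBot atBot := by
    refine tendsto_atBot_mono' atBot (f₁ := fun x => c * x + g 0) ?_
      (tendsto_atBot_add_const_right _ _ (tendsto_id.const_mul_atBot hc))
    filter_upwards [eventually_le_atBot 0] with x hx
    have := hlin hx
    simp only [mul_zero, sub_zero] at this
    linarith
  have hsurj : Function.Surjective g := hcont.surjective htop hbot
  let e : ℝ ≃o ℝ := hmono.orderIsoOfSurjective g hsurj
  have he : ∀ y, g (e.symm y) = y := fun y => e.apply_symm_apply y
  refine ⟨hmono, e.symm, he, fun x => e.symm_apply_apply x, fun y => ?_⟩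
  exact HasDerivAt.of_local_left_inverse e.symm.continuous.continuousAt (hg _)
    (hc.trans_le (hg' _)).ne' (Eventually.of_forall he)

/-! ### The fixed ellipses: Kepler's equation, vis-viva, differentiability -/

section Orbit

theorem hasDerivAt_keplerEquation (o : OrbitalElements) (E : ℝ) :
    HasDerivAt (fun E => E - o.e * Real.sin E) (1 - o.e * Real.cos E) E :=
  (hasDerivAt_id E).sub ((Real.hasDerivAt_sin E).const_mul o.e)

theorem one_sub_e_le (o : OrbitalElements) (E : ℝ) : 1 - o.e ≤ 1 - o.e * Real.cos E := by
  nlinarith [Real.cos_le_one E, o.e_nonneg]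

/-- The left side of Kepler's equation has derivative at least `1 - e > 0`, so the value picked by
the choice operator is that of its differentiable inverse. -/
theorem differentiable_eccentricAnomaly (o : OrbitalElements) :
    Differentiable ℝ (eccentricAnomaly o) := by
  obtain ⟨hm, k, hk, hk', hd⟩ := exists_inverse_of_deriv_ge (sub_pos.mpr o.e_lt_one)
    (hasDerivAt_keplerEquation o) (one_sub_e_le o)
  have : eccentricAnomaly o = k := by
    funext M
    have h : eccentricAnomaly o M - o.e * Real.sin (eccentricAnomaly o M) = M :=
      Classical.epsilon_spec (p := fun E : ℝ => E - o.e * Real.sin E = M) ⟨k M, hk M⟩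
    have h2 := hk' (eccentricAnomaly o M)
    simp only [h] at h2
    exact h2.symm
  rw [this]
  exact fun y => (hd y).differentiableAt

/-- The perifocal frame is orthonormal, so that coordinates in it compute norms. -/
theorem norm_perifocal_sq (o : OrbitalElements) (x y : ℝ) :
    ‖(WithLp.toLp 2 ((perifocalToInertial o).mulVec ![x, y, 0]) : E3)‖ ^ 2 = x ^ 2 + y ^ 2 := by
  rw [EuclideanSpace.norm_sq_eq]
  simp only [perifocalToInertial, Fin.sum_univ_three, Matrix.mulVec, dotProduct,
    Matrix.of_apply, Matrix.cons_val', Matrix.cons_val_zero, Matrix.cons_val_one,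
    Matrix.cons_val, Real.norm_eq_abs, sq_abs, mul_zero, add_zero]
  have h1 := Real.sin_sq_add_cos_sq o.raan
  have h2 := Real.sin_sq_add_cos_sq o.aop
  have h3 := Real.sin_sq_add_cos_sq o.inc
  generalize Real.sin o.raan = a at *
  generalize Real.cos o.raan = b at *
  generalize Real.sin o.aop = c at *
  generalize Real.cos o.aop = d at *
  generalize Real.sin o.inc = e at *
  generalize Real.cos o.inc = f at *
  linear_combination (((d * x - c * y) ^ 2) + f ^ 2 * (c * x + d * y) ^ 2) * h1 +
    (x ^ 2 + y ^ 2) * h2 + (c * x + d * y) ^ 2 * h3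

theorem norm_orbitPos (o : OrbitalElements) (M : ℝ) :
    ‖orbitPos o M‖ = o.a * (1 - o.e * Real.cos (eccentricAnomaly o M)) := by
  have ha := o.a_pos
  have he := o.e_nonneg
  have he1 := o.e_lt_one
  have hp : 0 ≤ o.a * (1 - o.e * Real.cos (eccentricAnomaly o M)) :=
    mul_nonneg ha.le ((sub_pos.mpr he1).le.trans (one_sub_e_le o _))
  rw [← sq_eq_sq₀ (norm_nonneg _) hp, orbitPos, norm_perifocal_sq]
  have hs : Real.sqrt (1 - o.e ^ 2) ^ 2 = 1 - o.e ^ 2 := Real.sq_sqrt (by nlinarith)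
  linear_combination o.a ^ 2 * Real.sin (eccentricAnomaly o M) ^ 2 * hs +
    o.a ^ 2 * (1 - o.e ^ 2) * Real.sin_sq_add_cos_sq (eccentricAnomaly o M)

theorem periapsis_le_norm_orbitPos (o : OrbitalElements) (M : ℝ) :
    o.a * (1 - o.e) ≤ ‖orbitPos o M‖ := by
  rw [norm_orbitPos]
  exact mul_le_mul_of_nonneg_left (one_sub_e_le o _) o.a_pos.le

theorem norm_orbitPos_le (o : OrbitalElements) (M : ℝ) : ‖orbitPos o M‖ ≤ 2 * o.a := by
  rw [norm_orbitPos]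
  nlinarith [Real.neg_one_le_cos (eccentricAnomaly o M), o.e_nonneg, o.e_lt_one, o.a_pos,
    mul_nonneg o.a_pos.le o.e_nonneg]

theorem periapsis_pos (o : OrbitalElements) : 0 < o.a * (1 - o.e) :=
  mul_pos o.a_pos (sub_pos.mpr o.e_lt_one)

theorem norm_orbitPos_pos (o : OrbitalElements) (M : ℝ) : 0 < ‖orbitPos o M‖ :=
  (periapsis_pos o).trans_le (periapsis_le_norm_orbitPos o M)

theorem orbitPos_ne_zero (o : OrbitalElements) (M : ℝ) : orbitPos o M ≠ 0 :=
  norm_pos_iff.mp (norm_orbitPos_pos o M)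

/-- The vis-viva equation on the ellipse. -/
theorem norm_orbitVel_sq {μ : ℝ} (hμ : 0 < μ) (o : OrbitalElements) (M : ℝ) :
    ‖orbitVel μ o M‖ ^ 2 = 2 * μ / ‖orbitPos o M‖ - μ / o.a := by
  have ha := o.a_pos
  have hp := norm_orbitPos_pos o M
  have hs : Real.sqrt (1 - o.e ^ 2) ^ 2 = 1 - o.e ^ 2 :=
    Real.sq_sqrt (by nlinarith [o.e_nonneg, o.e_lt_one])
  have hn := norm_orbitPos o M
  rw [orbitVel, norm_smul, mul_pow, norm_perifocal_sq, Real.norm_eq_abs, sq_abs, div_pow,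
    Real.sq_sqrt (by positivity)]
  have hk : (-Real.sin (eccentricAnomaly o M)) ^ 2 +
      (Real.sqrt (1 - o.e ^ 2) * Real.cos (eccentricAnomaly o M)) ^ 2 =
      1 - o.e ^ 2 * Real.cos (eccentricAnomaly o M) ^ 2 := by
    linear_combination Real.cos (eccentricAnomaly o M) ^ 2 * hs +
      Real.sin_sq_add_cos_sq (eccentricAnomaly o M)
  rw [hk]
  field_simp
  rw [hn]
  ring

theorem differentiable_toLp_mulVec (A : Matrix (Fin 3) (Fin 3) ℝ) {x y : ℝ → ℝ}
    (hx : Differentiable ℝ x) (hy : Differentiable ℝ y) :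
    Differentiable ℝ fun M => (WithLp.toLp 2 (A.mulVec ![x M, y M, 0]) : E3) := by
  rw [differentiable_euclidean]
  intro i
  simp only [Matrix.mulVec, dotProduct, Fin.sum_univ_three, Matrix.cons_val_zero,
    Matrix.cons_val_one, Matrix.cons_val]
  fun_prop

theorem differentiable_orbitPos (o : OrbitalElements) : Differentiable ℝ (orbitPos o) := by
  have hE := differentiable_eccentricAnomaly o
  exact differentiable_toLp_mulVec _ (by fun_prop) (by fun_prop)

theorem differentiable_orbitVel (μ : ℝ) (o : OrbitalElements) :
    Differentiable ℝ (orbitVel μ o) := by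
  have hE := differentiable_eccentricAnomaly o
  have hn : Differentiable ℝ fun M => ‖orbitPos o M‖ := fun M =>
    (differentiable_orbitPos o M).norm ℝ (orbitPos_ne_zero o M)
  have h1 : Differentiable ℝ fun M => Real.sqrt (μ * o.a) / ‖orbitPos o M‖ :=
    (differentiable_const _).fun_div hn fun M => (norm_orbitPos_pos o M).ne'
  exact h1.fun_smul (differentiable_toLp_mulVec _ (by fun_prop) (by fun_prop))

theorem meanMotion_pos {μ : ℝ} (hμ : 0 < μ) (o : OrbitalElements) : 0 < meanMotion μ o :=
  Real.sqrt_pos.mpr (div_pos hμ (pow_pos o.a_pos 3))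

end Orbit

/-! ### Continuous logarithms and the formula for the time of flight -/

/-- A continuous logarithm of a differentiable curve is differentiable. -/
theorem hasDerivWithinAt_log_lift {s : Set ℝ} {l z : ℝ → ℂ} {z' : ℂ} {τ : ℝ} (hτ : τ ∈ s)
    (hl : ContinuousWithinAt l s τ) (hz : HasDerivWithinAt z z' s τ)
    (he : ∀ x ∈ s, Complex.exp (l x) = z x) : HasDerivWithinAt l (z' / z τ) s τ := by
  have hz0 : z τ ≠ 0 := by rw [← he τ hτ]; exact Complex.exp_ne_zero _
  -- Near `τ` the lift `l` coincides with this branch, since by continuity the imaginary part of `l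
  -- x - l τ` stays in `(-π, π)`.
  have h1 : HasDerivWithinAt (fun x => l τ + Complex.log (z x / z τ)) (z' / z τ) s τ := by
    have := ((hz.div_const (z τ)).clog_real (by simp [hz0])).const_add (l τ)
    simpa [hz0] using this
  refine h1.congr_of_eventuallyEq ?_ (by simp [hz0])
  have h2 : ∀ᶠ x in 𝓝[s] τ, ‖l x - l τ‖ < Real.pi := by
    have : Tendsto (fun x => ‖l x - l τ‖) (𝓝[s] τ) (𝓝 0) := by
      simpa using Tendsto.norm (Tendsto.sub_const hl (l τ))
    exact this.eventually_lt_const Real.pi_pos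
  filter_upwards [h2, self_mem_nhdsWithin] with x hx hxs
  have h3 := (Complex.abs_im_le_norm _).trans_lt hx
  rw [abs_lt] at h3
  rw [← he x hxs, ← he τ hτ, ← Complex.exp_sub, Complex.log_exp h3.1 h3.2.le]
  ring

/-- The Levi-Civita parameter `y = σ - 2 ρ cos φ`. -/
noncomputable def chordParam (σ ρ φ : ℝ) : ℝ := σ - 2 * ρ * Real.cos φ

/-- The time of flight as a function of half the change `φ` in eccentric anomaly, where `σ` is the
sum of the two distances and `ρ` their geometric mean times the cosine of half the transfer
angle. -/
noncomputable def flightTime (μ σ ρ φ : ℝ) : ℝ :=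
  Real.sqrt (chordParam σ ρ φ / (2 * μ)) *
    (chordParam σ ρ φ * ((φ - Real.sin φ * Real.cos φ) / Real.sin φ ^ 3) + 2 * ρ)

/-- In terms of `ω`, the time of flight is given by Kepler's equation. -/
theorem flightTime_eq {μ σ ρ φ ω : ℝ} (hμ : 0 < μ) (hφ : φ ∈ Ioo 0 Real.pi) (hω : 0 < ω)
    (h : 2 * ω ^ 2 * chordParam σ ρ φ = μ * Real.sin φ ^ 2) :
    flightTime μ σ ρ φ =
      (μ * (φ / ω) - 2 * ω / Real.sin φ * (σ * Real.cos φ - 2 * ρ)) / (4 * ω ^ 2) := by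
  have hs : 0 < Real.sin φ := Real.sin_pos_of_mem_Ioo hφ
  have hy : chordParam σ ρ φ / (2 * μ) = (Real.sin φ / (2 * ω)) ^ 2 := by
    field_simp
    linear_combination h
  rw [flightTime, hy, Real.sqrt_sq (by positivity)]
  have hy' : chordParam σ ρ φ = μ * Real.sin φ ^ 2 / (2 * ω ^ 2) := by
    field_simp
    linear_combination h
  have hσ : σ = μ * Real.sin φ ^ 2 / (2 * ω ^ 2) + 2 * ρ * Real.cos φ := by
    rw [← hy', chordParam]; ring
  rw [hy', hσ]
  field_simp
  linear_combination (16 * ρ * ω ^ 2) * Real.sin_sq_add_cos_sq φ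

/-! ### Planar motions: polar angle and Levi-Civita regularization -/

section Planar

variable {μ t : ℝ} {z ζ : ℝ → ℂ} {f : ℝ → ℝ}

theorem star_mul_self_eq (w : ℂ) : star w * w = ((‖w‖ ^ 2 : ℝ) : ℂ) := by
  rw [Complex.star_def, ← Complex.normSq_eq_conj_mul_self, Complex.normSq_eq_norm_sq]

theorem real_inner_eq_re (z w : ℂ) : inner ℝ z w = (star z * w).re := by
  rw [Complex.inner, Complex.star_def, mul_comm]

/-- The angular momentum of a planar motion is constant. -/
theorem im_star_mul_eq (h : IsKeplerMotion μ t z ζ) :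
    ∀ τ ∈ Icc 0 t, (star (z τ) * ζ τ).im = (star (z 0) * ζ 0).im := by
  apply eq_left_of_hasDerivWithinAt_zero (g := fun τ => (star (z τ) * ζ τ).im)
  intro τ hτ
  obtain ⟨-, hz, hζ⟩ := h τ hτ
  have := Complex.imCLM.hasFDerivAt.comp_hasDerivWithinAt τ (hz.star.mul hζ)
  refine this.congr_deriv ?_
  -- The derivative of `star z * ζ` is real: its second term is, because the force is central.
  have e : star (ζ τ) * ζ τ + star (z τ) * (-(μ / ‖z τ‖ ^ 3) • z τ) =
      ((‖ζ τ‖ ^ 2 + -(μ / ‖z τ‖ ^ 3) * ‖z τ‖ ^ 2 : ℝ) : ℂ) := by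
    rw [Complex.real_smul, Complex.ofReal_add, Complex.ofReal_mul (-(μ / ‖z τ‖ ^ 3)),
      ← star_mul_self_eq, ← star_mul_self_eq]
    ring
  rw [e, Complex.imCLM_apply, Complex.ofReal_im]

/-- The polar angle of a planar motion has derivative `h / ‖z‖²`. -/
theorem hasDerivWithinAt_polarAngle (h : IsKeplerMotion μ t z ζ)
    (hl : ∀ τ ∈ Icc 0 t, HasDerivWithinAt (fun τ => (Real.log ‖z τ‖ : ℂ) + f τ * Complex.I)
      (ζ τ / z τ) (Icc 0 t) τ) :
    ∀ τ ∈ Icc 0 t, HasDerivWithinAt f ((star (z 0) * ζ 0).im / ‖z τ‖ ^ 2) (Icc 0 t) τ := by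
  intro τ hτ
  have h0 := (h τ hτ).1
  have := Complex.imCLM.hasFDerivAt.comp_hasDerivWithinAt τ (hl τ hτ)
  have e : (Complex.imCLM ∘ fun τ => (Real.log ‖z τ‖ : ℂ) + f τ * Complex.I) = f := by
    funext x; simp
  rw [e] at this
  refine this.congr_deriv ?_
  rw [← im_star_mul_eq h τ hτ, Complex.imCLM_apply]
  have e2 : ζ τ / z τ = (((‖z τ‖ ^ 2)⁻¹ : ℝ) : ℂ) * (star (z τ) * ζ τ) := by
    have : star (z τ) ≠ 0 := star_ne_zero.mpr h0
    rw [Complex.ofReal_inv, ← star_mul_self_eq]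
    field_simp
  rw [e2, Complex.im_ofReal_mul]
  ring

/-- The polar angle of a planar motion that turns forward is strictly increasing. -/
theorem strictMonoOn_polarAngle (ht : 0 < t) (h : IsKeplerMotion μ t z ζ)
    (hf : ∀ τ ∈ Icc 0 t, HasDerivWithinAt f ((star (z 0) * ζ 0).im / ‖z τ‖ ^ 2) (Icc 0 t) τ)
    (hθ : f 0 < f t) : StrictMonoOn f (Icc 0 t) := by
  have hc : ContinuousOn f (Icc 0 t) := fun τ hτ => (hf τ hτ).continuousWithinAt
  -- By the mean value theorem `h / ‖z‖²` is positive somewhere, so the constant `h` is positive.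
  have hpos : 0 < (star (z 0) * ζ 0).im := by
    obtain ⟨c, hc1, hc2⟩ := exists_hasDerivAt_eq_slope f
      (fun τ => (star (z 0) * ζ 0).im / ‖z τ‖ ^ 2) ht hc
      fun τ hτ => (hf τ (Ioo_subset_Icc_self hτ)).hasDerivAt (Icc_mem_nhds hτ.1 hτ.2)
    have h1 : 0 < (f t - f 0) / (t - 0) := div_pos (sub_pos.mpr hθ) (by simpa using ht)
    rw [← hc2] at h1
    by_contra hle
    exact absurd h1 (not_lt.mpr (div_nonpos_of_nonpos_of_nonneg (not_lt.mp hle) (by positivity)))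
  refine strictMonoOn_of_hasDerivWithinAt_pos (convex_Icc 0 t) hc
    (fun τ hτ => (hf τ (interior_subset hτ)).mono interior_subset) fun τ hτ => ?_
  have := norm_pos_iff.mpr (h τ (interior_subset hτ)).1
  positivity

/-- Levi-Civita regularization: the square root `w` of a planar Kepler motion with negative energy
is a harmonic oscillation in the fictitious time `s`, with frequency `ω`. -/
theorem leviCivita_oscillation {w : ℝ → ℂ} {s : ℝ → ℝ} {ω : ℝ} (hω : ω ≠ 0)
    (h : IsKeplerMotion μ t z ζ) (hE : energy μ (z 0) (ζ 0) = -2 * ω ^ 2)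
    (hw : ∀ τ ∈ Icc 0 t, HasDerivWithinAt w (w τ * (ζ τ / z τ / 2)) (Icc 0 t) τ)
    (hwz : ∀ τ ∈ Icc 0 t, w τ ^ 2 = z τ)
    (hs : ∀ τ ∈ Icc 0 t, HasDerivWithinAt s (‖z τ‖⁻¹) (Icc 0 t) τ) (hs0 : s 0 = 0) :
    ∀ τ ∈ Icc 0 t,
      w τ * Real.cos (ω * s τ) - star (w τ) * ζ τ / 2 / ω * Real.sin (ω * s τ) = w 0 ∧
      w τ * ω * Real.sin (ω * s τ) + star (w τ) * ζ τ / 2 * Real.cos (ω * s τ) =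
        star (w 0) * ζ 0 / 2 := by
  have hω' : (ω : ℂ) ≠ 0 := by exact_mod_cast hω
  -- With `u = star w * ζ / 2` and `d/ds = ‖z‖ d/dτ` these are the oscillator equations `dw/ds = u`,
  -- `du/ds = -ω² w`. The second one is where the value of the energy enters.
  have hderiv : ∀ τ ∈ Icc 0 t,
      HasDerivWithinAt w (star (w τ) * ζ τ / 2 / ‖z τ‖) (Icc 0 t) τ ∧
      HasDerivWithinAt (fun τ => star (w τ) * ζ τ / 2) (-(ω ^ 2) * w τ / ‖z τ‖) (Icc 0 t) τ := by
    intro τ hτ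
    obtain ⟨h0, hz, hζ⟩ := h τ hτ
    have hw2 := hwz τ hτ
    have hw0 : w τ ≠ 0 := by
      rintro h1
      rw [h1] at hw2
      exact h0 (by rw [← hw2]; ring)
    have hW0 : star (w τ) ≠ 0 := star_ne_zero.mpr hw0
    have hn : (‖z τ‖ : ℂ) = star (w τ) * w τ := by
      rw [star_mul_self_eq, ← hw2, norm_pow]
    have hen := energy_eq h τ hτ
    rw [hE, energy] at hen
    have hen' : (star (ζ τ) * ζ τ) / 2 - μ / (star (w τ) * w τ) = -2 * (ω : ℂ) ^ 2 := by
      rw [star_mul_self_eq, ← hn]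
      exact_mod_cast hen
    refine ⟨(hw τ hτ).congr_deriv ?_, ?_⟩
    · rw [hn, ← hw2]
      field_simp
    · refine (((hw τ hτ).star.mul hζ).div_const 2).congr_deriv ?_
      rw [Complex.real_smul, Complex.ofReal_neg, Complex.ofReal_div, Complex.ofReal_pow, hn, ← hw2]
      simp only [star_mul', star_div₀, star_pow]
      have h2 : star (2 : ℂ) = 2 := by simp
      rw [h2]
      field_simp at hen' ⊢
      linear_combination hen'
  have htrig : ∀ τ ∈ Icc 0 t,
      HasDerivWithinAt (fun τ => ((Real.cos (ω * s τ) : ℝ) : ℂ))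
        ((-Real.sin (ω * s τ) * (ω * ‖z τ‖⁻¹) : ℝ) : ℂ) (Icc 0 t) τ ∧
      HasDerivWithinAt (fun τ => ((Real.sin (ω * s τ) : ℝ) : ℂ))
        ((Real.cos (ω * s τ) * (ω * ‖z τ‖⁻¹) : ℝ) : ℂ) (Icc 0 t) τ := fun τ hτ =>
    ⟨((hs τ hτ).const_mul ω).cos.ofReal_comp, ((hs τ hτ).const_mul ω).sin.ofReal_comp⟩
  have hn0 : ∀ τ ∈ Icc 0 t, (‖z τ‖ : ℂ) ≠ 0 := fun τ hτ => by
    exact_mod_cast norm_ne_zero_iff.mpr (h τ hτ).1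
  -- Running the oscillation backward through the phase `ω s` recovers the initial data, so this
  -- combination and the next one are constant.
  have h1 : ∀ τ ∈ Icc 0 t, HasDerivWithinAt (fun τ => w τ * Real.cos (ω * s τ) -
      star (w τ) * ζ τ / 2 / ω * Real.sin (ω * s τ)) 0 (Icc 0 t) τ := by
    intro τ hτ
    have hn := hn0 τ hτ
    refine (((hderiv τ hτ).1.mul (htrig τ hτ).1).sub
      (((hderiv τ hτ).2.div_const (ω : ℂ)).mul (htrig τ hτ).2)).congr_deriv ?_
    push_cast
    field_simp
    ring
  have h2 : ∀ τ ∈ Icc 0 t, HasDerivWithinAt (fun τ => w τ * ω * Real.sin (ω * s τ) +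
      star (w τ) * ζ τ / 2 * Real.cos (ω * s τ)) 0 (Icc 0 t) τ := by
    intro τ hτ
    have hn := hn0 τ hτ
    refine ((((hderiv τ hτ).1.mul_const (ω : ℂ)).mul (htrig τ hτ).2).add
      ((hderiv τ hτ).2.mul (htrig τ hτ).1)).congr_deriv ?_
    push_cast
    field_simp
    ring
  intro τ hτ
  have e1 := eq_left_of_hasDerivWithinAt_zero h1 τ hτ
  have e2 := eq_left_of_hasDerivWithinAt_zero h2 τ hτ
  simp only [hs0, mul_zero, Real.cos_zero, Real.sin_zero, Complex.ofReal_one, Complex.ofReal_zero,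
    mul_one, sub_zero, zero_add] at e1 e2
  exact ⟨e1, e2⟩

end Planar

/-! ### Boundary values of the oscillation -/

section Boundary

/-- The boundary data of a harmonic oscillation `w` with endpoint values `w₁, w₂`, phase `φ` and
velocities `u₁, u₂`. -/
theorem oscillation_velocities {w₁ w₂ u₁ u₂ : ℂ} {ω φ : ℝ} (hω : ω ≠ 0) (hφ : Real.sin φ ≠ 0)
    (h1 : w₂ * Real.cos φ - u₂ / ω * Real.sin φ = w₁)
    (h2 : w₂ * ω * Real.sin φ + u₂ * Real.cos φ = u₁) :
    u₁ = (ω / Real.sin φ : ℝ) * (w₂ - Real.cos φ * w₁) ∧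
      u₂ = (ω / Real.sin φ : ℝ) * (Real.cos φ * w₂ - w₁) := by
  have hω' : (ω : ℂ) ≠ 0 := by exact_mod_cast hω
  have hs : (Real.sin φ : ℂ) ≠ 0 := by exact_mod_cast hφ
  have hcs : (Real.sin φ : ℂ) ^ 2 + (Real.cos φ : ℂ) ^ 2 = 1 := by
    exact_mod_cast Real.sin_sq_add_cos_sq φ
  have e2 : u₂ = (ω / Real.sin φ : ℝ) * (Real.cos φ * w₂ - w₁) := by
    rw [← h1, Complex.ofReal_div]
    field_simp
    ring
  refine ⟨?_, e2⟩
  rw [← h2, e2, Complex.ofReal_div]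
  field_simp
  linear_combination w₂ * hcs

/-- For `s = sin φ` the last hypothesis is the energy relation of an arc; the conclusion eliminates
`ω` from the factor `2ω / sin φ` in the end velocities. -/
theorem sqrt_two_mul_div_eq {μ y ω s : ℝ} (hμ : 0 < μ) (hω : 0 < ω) (hs : 0 < s)
    (h : 2 * ω ^ 2 * y = μ * s ^ 2) : 0 < y ∧ Real.sqrt (2 * μ / y) = 2 * ω / s := by
  have hy : 0 < y := by
    by_contra hle
    have : 0 < μ * s ^ 2 := by positivity
    nlinarith [mul_nonneg (sq_nonneg ω) (neg_nonneg.mpr (not_lt.mp hle))]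
  refine ⟨hy, ?_⟩
  have : 2 * μ / y = (2 * ω / s) ^ 2 := by
    field_simp
    linear_combination -h
  rw [this, Real.sqrt_sq (by positivity)]

end Boundary

/-! ### From a planar arc to its phase -/

section Planar

variable {μ t : ℝ} {z ζ : ℝ → ℂ} {f : ℝ → ℝ}

/-- A planar Kepler motion with negative energy that turns by less than a revolution has the
time of flight and the end velocities given by half its change `φ` in eccentric anomaly. -/
theorem exists_anomaly_of_motion (hμ : 0 < μ) (ht : 0 < t) (h : IsKeplerMotion μ t z ζ)
    (hE : energy μ (z 0) (ζ 0) < 0) (hf : ContinuousOn f (Icc 0 t))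
    (hz : ∀ τ ∈ Icc 0 t, z τ = ‖z τ‖ * Complex.exp (f τ * Complex.I))
    (hθ : 0 < f t - f 0) (hθ' : f t - f 0 < 2 * Real.pi) {ρ : ℝ} (hρ0 : ρ ≠ 0)
    (hρ : ρ = Real.sqrt ‖z 0‖ * Real.sqrt ‖z t‖ * Real.cos ((f t - f 0) / 2)) :
    ∃ φ ∈ Ioo 0 Real.pi, t = flightTime μ (‖z 0‖ + ‖z t‖) ρ φ ∧
      ζ 0 = (Real.sqrt (2 * μ / chordParam (‖z 0‖ + ‖z t‖) ρ φ) / ‖z 0‖) •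
        ((1 / (2 * ρ)) • (‖z t‖ • z 0 + ‖z 0‖ • z t) - Real.cos φ • z 0) ∧
      ζ t = (Real.sqrt (2 * μ / chordParam (‖z 0‖ + ‖z t‖) ρ φ) / ‖z t‖) •
        (Real.cos φ • z t - (1 / (2 * ρ)) • (‖z t‖ • z 0 + ‖z 0‖ • z t)) := by
  have m0 : (0 : ℝ) ∈ Icc 0 t := ⟨le_rfl, ht.le⟩
  have m1 : t ∈ Icc 0 t := ⟨ht.le, le_rfl⟩
  have hnpos : ∀ τ ∈ Icc 0 t, 0 < ‖z τ‖ := fun τ hτ => norm_pos_iff.mpr (h τ hτ).1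
  -- the frequency
  obtain ⟨ω, hω, hEω⟩ : ∃ ω : ℝ, 0 < ω ∧ energy μ (z 0) (ζ 0) = -2 * ω ^ 2 := by
    refine ⟨Real.sqrt (-energy μ (z 0) (ζ 0) / 2), Real.sqrt_pos.mpr (by linarith), ?_⟩
    rw [Real.sq_sqrt (by linarith)]
    ring
  -- the continuous logarithm and square root
  set l : ℝ → ℂ := fun τ => (Real.log ‖z τ‖ : ℂ) + f τ * Complex.I with hl
  have hlexp : ∀ τ ∈ Icc 0 t, Complex.exp (l τ) = z τ := fun τ hτ => by
    rw [hl]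
    simp only
    rw [Complex.exp_add, ← Complex.ofReal_exp, Real.exp_log (hnpos τ hτ), ← hz τ hτ]
  have hlcont : ContinuousOn l (Icc 0 t) := by
    have hzc : ContinuousOn (fun τ => ‖z τ‖) (Icc 0 t) := fun τ hτ =>
      (h τ hτ).2.1.continuousWithinAt.norm
    have h1 : ContinuousOn (fun τ => Real.log ‖z τ‖) (Icc 0 t) :=
      hzc.log fun τ hτ => (hnpos τ hτ).ne'
    exact (Complex.continuous_ofReal.comp_continuousOn h1).add
      ((Complex.continuous_ofReal.comp_continuousOn hf).mul continuousOn_const)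
  have hld : ∀ τ ∈ Icc 0 t, HasDerivWithinAt l (ζ τ / z τ) (Icc 0 t) τ := fun τ hτ =>
    hasDerivWithinAt_log_lift hτ (hlcont τ hτ) (h τ hτ).2.1 hlexp
  have hfmono := strictMonoOn_polarAngle ht h (hasDerivWithinAt_polarAngle h hld)
    (sub_pos.mp hθ)
  set w : ℝ → ℂ := fun τ => Complex.exp (l τ / 2) with hw
  have hwz : ∀ τ ∈ Icc 0 t, w τ ^ 2 = z τ := fun τ hτ => by
    rw [hw]
    simp only
    rw [← Complex.exp_nat_mul, ← hlexp τ hτ]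
    congr 1
    push_cast
    ring
  have hwd : ∀ τ ∈ Icc 0 t, HasDerivWithinAt w (w τ * (ζ τ / z τ / 2)) (Icc 0 t) τ :=
    fun τ hτ => ((hld τ hτ).div_const 2).cexp
  have hwpolar : ∀ τ ∈ Icc 0 t,
      w τ = Real.sqrt ‖z τ‖ * Complex.exp ((f τ / 2 : ℝ) * Complex.I) := fun τ hτ => by
    have : Real.exp (Real.log ‖z τ‖ / 2) = Real.sqrt ‖z τ‖ := by
      rw [← Real.log_sqrt (hnpos τ hτ).le, Real.exp_log (Real.sqrt_pos.mpr (hnpos τ hτ))]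
    rw [← this, hw, hl, Complex.ofReal_exp, ← Complex.exp_add]
    beta_reduce
    congr 1
    push_cast
    ring
  have hwn : ∀ τ ∈ Icc 0 t, star (w τ) * w τ = (‖z τ‖ : ℂ) := fun τ hτ => by
    rw [star_mul_self_eq, ← norm_pow, hwz τ hτ]
  -- The square root turns by half the angle, and less than a full turn of `z` is less than a half
  -- turn of `w`.
  have hwinner : ∀ τ ∈ Icc 0 t, star (w 0) * w τ =
      ((Real.sqrt ‖z 0‖ * Real.sqrt ‖z τ‖ : ℝ) : ℂ) *
        Complex.exp (((f τ - f 0) / 2 : ℝ) * Complex.I) := fun τ hτ => by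
    rw [hwpolar 0 m0, hwpolar τ hτ, star_mul', Complex.star_def,
      Complex.conj_ofReal, ← Complex.exp_conj, map_mul, Complex.conj_ofReal, Complex.conj_I]
    have : Complex.exp (((f τ - f 0) / 2 : ℝ) * Complex.I) =
        Complex.exp ((f 0 / 2 : ℝ) * -Complex.I) * Complex.exp ((f τ / 2 : ℝ) * Complex.I) := by
      rw [← Complex.exp_add]
      congr 1
      push_cast
      ring
    rw [this]
    push_cast
    ring
  -- the fictitious time
  set s : ℝ → ℝ := fun τ =>
    (inner ℝ (z τ) (ζ τ) - inner ℝ (z 0) (ζ 0) + 4 * ω ^ 2 * τ) / μ with hs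
  have hs0 : s 0 = 0 := by simp [hs]
  -- At energy `-2ω²` the Lagrange-Jacobi identity reads `⟨z, ζ⟩' = μ/‖z‖ - 4ω²`, which integrates
  -- `1/‖z‖` in closed form.
  have hsd : ∀ τ ∈ Icc 0 t, HasDerivWithinAt s (‖z τ‖⁻¹) (Icc 0 t) τ := fun τ hτ => by
    refine ((((hasDerivWithinAt_inner_pos_vel h hτ).sub_const _).add
      ((hasDerivWithinAt_id τ _).const_mul (4 * ω ^ 2))).div_const μ).congr_deriv ?_
    have hen := energy_eq h τ hτ
    rw [hEω, energy] at hen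
    have : ‖z τ‖ ≠ 0 := (hnpos τ hτ).ne'
    field_simp at hen ⊢
    linear_combination hen
  have hosc := leviCivita_oscillation hω.ne' h hEω hwd hwz hsd hs0
  -- the phase stays below a half turn
  have hsin : ∀ τ ∈ Ioc 0 t, Real.sin (ω * s τ) ≠ 0 := by
    intro τ hτ h0
    have hτ' : τ ∈ Icc 0 t := ⟨hτ.1.le, hτ.2⟩
    -- A zero of the sine makes `w τ` a real multiple of `w 0`, although `w` has turned by an angle
    -- strictly between `0` and `π`.
    have h1 := (hosc τ hτ').1
    rw [h0, Complex.ofReal_zero, mul_zero, sub_zero] at h1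
    have h2 := hwinner τ hτ'
    have h3 : (star (w 0) * w τ).im = 0 := by
      rw [← h1, star_mul', Complex.star_def, Complex.conj_ofReal,
        mul_right_comm, ← Complex.star_def, hwn τ hτ', ← Complex.ofReal_mul, Complex.ofReal_im]
    rw [h2, Complex.im_ofReal_mul, Complex.exp_ofReal_mul_I_im] at h3
    have h4 : 0 < Real.sin ((f τ - f 0) / 2) := by
      have a1 := hfmono m0 hτ' hτ.1
      have a2 := hfmono.monotoneOn hτ' m1 hτ.2
      exact Real.sin_pos_of_pos_of_lt_pi (by linarith) (by linarith)
    have h5 := Real.sqrt_pos.mpr (hnpos 0 m0)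
    have h6 := Real.sqrt_pos.mpr (hnpos τ hτ')
    have : 0 < Real.sqrt ‖z 0‖ * Real.sqrt ‖z τ‖ * Real.sin ((f τ - f 0) / 2) := by positivity
    exact this.ne' h3
  have hscont : ContinuousOn s (Icc 0 t) := fun τ hτ => (hsd τ hτ).continuousWithinAt
  have hsmono : StrictMonoOn s (Icc 0 t) :=
    strictMonoOn_of_hasDerivWithinAt_pos (convex_Icc 0 t) hscont
      (fun τ hτ => (hsd τ (interior_subset hτ)).mono interior_subset)
      fun τ hτ => inv_pos.mpr (hnpos τ (interior_subset hτ))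
  have hspos : 0 < s t := hs0 ▸ hsmono m0 m1 ht
  have hφ : ω * s t ∈ Ioo 0 Real.pi := by
    refine ⟨by positivity, ?_⟩
    -- Otherwise the phase passes through `π`, where its sine vanishes.
    by_contra hle
    have hmem : Real.pi ∈ Icc (ω * s 0) (ω * s t) := by
      rw [hs0, mul_zero]
      exact ⟨Real.pi_pos.le, not_lt.mp hle⟩
    obtain ⟨τ, hτ, hτπ⟩ := intermediate_value_Icc ht.le (continuousOn_const.mul hscont) hmem
    have hτ0 : τ ≠ 0 := by
      rintro rfl
      change ω * s 0 = Real.pi at hτπ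
      rw [hs0, mul_zero] at hτπ
      exact Real.pi_pos.ne hτπ
    refine hsin τ ⟨lt_of_le_of_ne hτ.1 hτ0.symm, hτ.2⟩ ?_
    rw [show ω * s τ = Real.pi from hτπ, Real.sin_pi]
  -- the boundary values
  set φ := ω * s t with hφdef
  have hsφ : 0 < Real.sin φ := Real.sin_pos_of_mem_Ioo hφ
  obtain ⟨hu1, hu2⟩ := oscillation_velocities hω.ne' hsφ.ne' (hosc t m1).1 (hosc t m1).2
  have hcs := Real.sin_sq_add_cos_sq φ
  have hre : (star (w 0) * w t).re = ρ := by
    rw [hwinner t m1, Complex.re_ofReal_mul, Complex.exp_ofReal_mul_I_re, hρ]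
  have hre' : (star (w t) * w 0).re = ρ := by
    rw [← hre, ← Complex.conj_re (star (w 0) * w t)]
    congr 1
    simp [mul_comm]
  have hsum : star (w 0) * w t + star (w t) * w 0 = ((2 * ρ : ℝ) : ℂ) := by
    have : star (w t) * w 0 = (starRingEnd ℂ) (star (w 0) * w t) := by simp [mul_comm]
    rw [this, Complex.add_conj, hre]
  have hn0 : (‖z 0‖ : ℂ) ≠ 0 := by exact_mod_cast (hnpos 0 m0).ne'
  have hnt : (‖z t‖ : ℂ) ≠ 0 := by exact_mod_cast (hnpos t m1).ne'
  have hρc : ((2 * ρ : ℝ) : ℂ) ≠ 0 := by exact_mod_cast mul_ne_zero two_ne_zero hρ0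
  -- The product of the two square roots points along the bisector. This removes `w` from the
  -- velocity formulas; the sign of `ρ` fixes the choice of root.
  have hB : ((1 / (2 * ρ)) • (‖z t‖ • z 0 + ‖z 0‖ • z t) : ℂ) = w 0 * w t := by
    rw [Complex.real_smul, Complex.real_smul, Complex.real_smul, Complex.ofReal_div,
      ← hwn t m1, ← hwn 0 m0, ← hwz 0 m0, ← hwz t m1]
    rw [Complex.ofReal_one, one_div, inv_mul_eq_iff_eq_mul₀ hρc, ← hsum]
    ring
  -- the energy relation
  have hy : 2 * ω ^ 2 * chordParam (‖z 0‖ + ‖z t‖) ρ φ = μ * Real.sin φ ^ 2 := by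
    -- The squared initial velocity of the oscillation is computed twice, from the Kepler energy and
    -- from the end values of `w`.
    have h1 : ‖star (w 0) * ζ 0 / 2‖ ^ 2 = ‖z 0‖ * ‖ζ 0‖ ^ 2 / 4 := by
      rw [norm_div, norm_mul, norm_star, div_pow, mul_pow, ← norm_pow, hwz 0 m0]
      norm_num
    have h2 : ‖w t - Real.cos φ * w 0‖ ^ 2 =
        ‖z t‖ - 2 * Real.cos φ * ρ + Real.cos φ ^ 2 * ‖z 0‖ := by
      have e : ((‖w t - Real.cos φ * w 0‖ ^ 2 : ℝ) : ℂ) =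
          ((‖z t‖ - 2 * Real.cos φ * ρ + Real.cos φ ^ 2 * ‖z 0‖ : ℝ) : ℂ) := by
        rw [← star_mul_self_eq, star_sub, star_mul',
          show star (Real.cos φ : ℂ) = Real.cos φ from Complex.conj_ofReal _]
        push_cast
        push_cast at hsum
        rw [← hwn t m1, ← hwn 0 m0]
        linear_combination (-Complex.cos φ) * hsum
      exact_mod_cast e
    rw [hu1, norm_mul, mul_pow, h2, Complex.norm_real, Real.norm_eq_abs, sq_abs] at h1
    rw [energy] at hEω
    have := hnpos 0 m0
    rw [chordParam]
    field_simp at h1 hEω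
    have h3 : 4 * ω ^ 2 * (‖z t‖ - 2 * Real.cos φ * ρ + Real.cos φ ^ 2 * ‖z 0‖) =
      2 * (μ - 2 * ω ^ 2 * ‖z 0‖) * Real.sin φ ^ 2 := by
      linear_combination h1 + Real.sin φ ^ 2 * hEω
    linear_combination h3 / 2 - 2 * ω ^ 2 * ‖z 0‖ * hcs
  obtain ⟨hypos, hsqrt⟩ := sqrt_two_mul_div_eq hμ hω hsφ hy
  refine ⟨φ, hφ, ?_, ?_, ?_⟩
  -- Solved for `t`, the definition of `s t` is Kepler's equation. It only needs `⟨z, ζ⟩` at both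
  -- ends, which the boundary formulas provide.
  · rw [flightTime_eq hμ hφ hω hy]
    have i1 : inner ℝ (z t) (ζ t) = 2 * ω / Real.sin φ * (Real.cos φ * ‖z t‖ - ρ) := by
      have e : star (z t) * ζ t = ((2 * (ω / Real.sin φ) : ℝ) : ℂ) *
          ((Real.cos φ * ‖z t‖ : ℝ) - star (w t) * w 0) := by
        have hst : star (z t) = star (w t) ^ 2 := by rw [← hwz t m1, star_pow]
        rw [hst]
        push_cast
        push_cast at hu2
        rw [← hwn t m1]
        linear_combination 2 * star (w t) * hu2
      rw [real_inner_eq_re, e, Complex.re_ofReal_mul, Complex.sub_re, Complex.ofReal_re, hre']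
      ring
    have i0 : inner ℝ (z 0) (ζ 0) = 2 * ω / Real.sin φ * (ρ - Real.cos φ * ‖z 0‖) := by
      have e : star (z 0) * ζ 0 = ((2 * (ω / Real.sin φ) : ℝ) : ℂ) *
          (star (w 0) * w t - (Real.cos φ * ‖z 0‖ : ℝ)) := by
        have hst : star (z 0) = star (w 0) ^ 2 := by rw [← hwz 0 m0, star_pow]
        rw [hst]
        push_cast
        push_cast at hu1
        rw [← hwn 0 m0]
        linear_combination 2 * star (w 0) * hu1
      rw [real_inner_eq_re, e, Complex.re_ofReal_mul, Complex.sub_re, Complex.ofReal_re, hre]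
      ring
    have hst : μ * s t = inner ℝ (z t) (ζ t) - inner ℝ (z 0) (ζ 0) + 4 * ω ^ 2 * t := by
      rw [hs]
      field_simp
    rw [i1, i0] at hst
    have : φ / ω = s t := by rw [hφdef]; field_simp
    rw [this, hst]
    field_simp
    ring
  · rw [hB, hsqrt, Complex.real_smul, Complex.real_smul]
    push_cast at hu1 ⊢
    have hsc : Complex.sin φ ≠ 0 := by exact_mod_cast hsφ.ne'
    have : (‖z 0‖ : ℂ) * ζ 0 = w 0 * (star (w 0) * ζ 0 / 2) * 2 := by
      rw [← hwn 0 m0]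
      ring
    rw [hu1] at this
    field_simp at this ⊢
    linear_combination this - 2 * ω * Complex.cos φ * hwz 0 m0
  · rw [hB, hsqrt, Complex.real_smul, Complex.real_smul]
    push_cast at hu2 ⊢
    have hsc : Complex.sin φ ≠ 0 := by exact_mod_cast hsφ.ne'
    have : (‖z t‖ : ℂ) * ζ t = w t * (star (w t) * ζ t / 2) * 2 := by
      rw [← hwn t m1]
      ring
    rw [hu2] at this
    field_simp at this ⊢
    linear_combination this + 2 * ω * Complex.cos φ * hwz t m1

end Planar

/-! ### From a phase to a planar arc -/

section Oscillation

variable {μ ω : ℝ} {w₀ u₀ : ℂ}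

/-- Harmonic oscillation with initial value `w₀` and initial velocity `u₀`. -/
noncomputable def oscPos (ω : ℝ) (w₀ u₀ : ℂ) (s : ℝ) : ℂ :=
  w₀ * Real.cos (ω * s) + u₀ / ω * Real.sin (ω * s)

/-- The velocity of a harmonic oscillation. -/
noncomputable def oscVel (ω : ℝ) (w₀ u₀ : ℂ) (s : ℝ) : ℂ :=
  u₀ * Real.cos (ω * s) - ω * w₀ * Real.sin (ω * s)

theorem hasDerivAt_ofReal_cos (ω s : ℝ) :
    HasDerivAt (fun s => ((Real.cos (ω * s) : ℝ) : ℂ)) ((-Real.sin (ω * s) * ω : ℝ) : ℂ) s := by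
  simpa using (((hasDerivAt_id s).const_mul ω).cos).ofReal_comp

theorem hasDerivAt_ofReal_sin (ω s : ℝ) :
    HasDerivAt (fun s => ((Real.sin (ω * s) : ℝ) : ℂ)) ((Real.cos (ω * s) * ω : ℝ) : ℂ) s := by
  simpa using (((hasDerivAt_id s).const_mul ω).sin).ofReal_comp

theorem hasDerivAt_oscPos (hω : ω ≠ 0) (s : ℝ) :
    HasDerivAt (oscPos ω w₀ u₀) (oscVel ω w₀ u₀ s) s := by
  have hω' : (ω : ℂ) ≠ 0 := by exact_mod_cast hω
  refine (((hasDerivAt_ofReal_cos ω s).const_mul w₀).add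
    ((hasDerivAt_ofReal_sin ω s).const_mul (u₀ / ω))).congr_deriv ?_
  rw [oscVel]
  push_cast
  field_simp
  ring

theorem hasDerivAt_oscVel (hω : ω ≠ 0) (s : ℝ) :
    HasDerivAt (oscVel ω w₀ u₀) (-(ω ^ 2 : ℂ) * oscPos ω w₀ u₀ s) s := by
  have hω' : (ω : ℂ) ≠ 0 := by exact_mod_cast hω
  refine (((hasDerivAt_ofReal_cos ω s).const_mul u₀).sub
    ((hasDerivAt_ofReal_sin ω s).const_mul (ω * w₀))).congr_deriv ?_
  rw [oscPos]
  push_cast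
  field_simp
  ring

theorem star_ofReal (x : ℝ) : star (x : ℂ) = x := Complex.conj_ofReal x

/-- For `z = w²` and `ζ = 2u / star w`, the value `μ` of this conserved quantity says that the
Kepler energy is `-2ω²`. -/
theorem oscillation_energy (hω : ω ≠ 0)
    (h0 : 2 * (star u₀ * u₀ + ω ^ 2 * (star w₀ * w₀)) = μ) (s : ℝ) :
    2 * (star (oscVel ω w₀ u₀ s) * oscVel ω w₀ u₀ s +
      ω ^ 2 * (star (oscPos ω w₀ u₀ s) * oscPos ω w₀ u₀ s)) = μ := by
  have hω' : (ω : ℂ) ≠ 0 := by exact_mod_cast hω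
  have hcs : (Real.sin (ω * s) : ℂ) ^ 2 + (Real.cos (ω * s) : ℂ) ^ 2 = 1 := by
    exact_mod_cast Real.sin_sq_add_cos_sq (ω * s)
  rw [← h0, oscVel, oscPos]
  simp only [star_add, star_sub, star_mul', star_div₀, star_ofReal]
  field_simp
  linear_combination (star u₀ * u₀ + ω ^ 2 * (star w₀ * w₀)) * hcs

/-- Nonzero angular momentum keeps `w` away from the origin, so that the Kepler motion has no
collision. -/
theorem oscillation_momentum (hω : ω ≠ 0) (s : ℝ) :
    (star (oscPos ω w₀ u₀ s) * oscVel ω w₀ u₀ s).im = (star w₀ * u₀).im := by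
  have hω' : (ω : ℂ) ≠ 0 := by exact_mod_cast hω
  have hcs := Real.sin_sq_add_cos_sq (ω * s)
  have e : star (oscPos ω w₀ u₀ s) * oscVel ω w₀ u₀ s =
      ((Real.cos (ω * s) ^ 2 : ℝ) : ℂ) * (star w₀ * u₀)
        - ((Real.sin (ω * s) ^ 2 : ℝ) : ℂ) * (star u₀ * w₀)
        + ((Real.sin (ω * s) * Real.cos (ω * s) : ℝ) : ℂ) *
          ((ω⁻¹ : ℝ) * (star u₀ * u₀) - (ω : ℝ) * (star w₀ * w₀)) := by
    rw [oscVel, oscPos]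
    simp only [star_add, star_mul', star_div₀, star_ofReal]
    push_cast
    field_simp
    ring
  have h1 : (star u₀ * w₀).im = -(star w₀ * u₀).im := by
    simp only [Complex.star_def, Complex.mul_im, Complex.conj_re, Complex.conj_im]
    ring
  rw [e, star_mul_self_eq, star_mul_self_eq, ← Complex.ofReal_mul, ← Complex.ofReal_mul,
    ← Complex.ofReal_sub, ← Complex.ofReal_mul, Complex.add_im, Complex.sub_im,
    Complex.im_ofReal_mul, Complex.im_ofReal_mul, Complex.ofReal_im, h1]
  linear_combination (star w₀ * u₀).im * hcs

/-- Inverse Levi-Civita regularization: the square of a nondegenerate harmonic oscillation, run in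
physical time, is a Kepler motion. -/
theorem exists_motion_of_oscillation (hμ : 0 < μ) (hω : 0 < ω)
    (h0 : 2 * (star u₀ * u₀ + ω ^ 2 * (star w₀ * w₀)) = μ) (hK : (star w₀ * u₀).im ≠ 0) :
    ∃ g k : ℝ → ℝ, StrictMono g ∧ Continuous k ∧ (∀ s, k (g s) = s) ∧
      (∀ s, g s = (μ * s - 2 * (star (oscPos ω w₀ u₀ s) * oscVel ω w₀ u₀ s).re +
        2 * (star w₀ * u₀).re) / (4 * ω ^ 2)) ∧
      ∀ t, IsKeplerMotion μ t (fun τ => oscPos ω w₀ u₀ (k τ) ^ 2)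
        (fun τ => 2 * oscVel ω w₀ u₀ (k τ) / star (oscPos ω w₀ u₀ (k τ))) := by
  set w := oscPos ω w₀ u₀ with hw
  set u := oscVel ω w₀ u₀ with hu
  have hwd : ∀ s, HasDerivAt w (u s) s := fun s => hasDerivAt_oscPos hω.ne' s
  have hud : ∀ s, HasDerivAt u (-(ω ^ 2 : ℂ) * w s) s := fun s => hasDerivAt_oscVel hω.ne' s
  have hen : ∀ s, 2 * (star (u s) * u s + ω ^ 2 * (star (w s) * w s)) = μ :=
    oscillation_energy hω.ne' h0
  have hen' : ∀ s, 2 * (‖u s‖ ^ 2 + ω ^ 2 * ‖w s‖ ^ 2) = μ := fun s => by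
    have := hen s
    rw [star_mul_self_eq, star_mul_self_eq] at this
    exact_mod_cast this
  set K := (star w₀ * u₀).im with hKdef
  have hK2 : 0 < K ^ 2 := by positivity
  -- Momentum gives `K² ≤ ‖w‖² ‖u‖²` and energy gives `‖u‖² ≤ μ/2`. This lower bound on `dt/ds =
  -- ‖w‖²` makes physical time invertible.
  have hlow : ∀ s, 2 * K ^ 2 / μ ≤ ‖w s‖ ^ 2 := by
    intro s
    have h1 : |K| ≤ ‖w s‖ * ‖u s‖ := by
      rw [hKdef, ← oscillation_momentum hω.ne' s]
      refine (Complex.abs_im_le_norm _).trans ?_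
      rw [norm_mul, norm_star]
    have h2 : K ^ 2 ≤ ‖w s‖ ^ 2 * ‖u s‖ ^ 2 := by
      rw [← sq_abs, ← mul_pow]
      gcongr
    have h3 : ‖u s‖ ^ 2 ≤ μ / 2 := by
      have := hen' s
      nlinarith [mul_nonneg (sq_nonneg ω) (sq_nonneg ‖w s‖)]
    rw [div_le_iff₀ hμ]
    nlinarith [mul_le_mul_of_nonneg_left h3 (sq_nonneg ‖w s‖)]
  have hw0 : ∀ s, w s ≠ 0 := fun s h => by
    have h1 := hlow s
    rw [h, norm_zero] at h1
    have : 0 < 2 * K ^ 2 / μ := by positivity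
    linarith
  -- Physical time in closed form: `g` vanishes at `0` and has derivative `‖w‖²`.
  set g : ℝ → ℝ := fun s =>
    (μ * s - 2 * (star (w s) * u s).re + 2 * (star w₀ * u₀).re) / (4 * ω ^ 2) with hg
  have hgd : ∀ s, HasDerivAt g (‖w s‖ ^ 2) s := by
    intro s
    have h1 := Complex.reCLM.hasFDerivAt.comp_hasDerivAt s ((hwd s).star.mul (hud s))
    have h2 : HasDerivAt (fun s => (star (w s) * u s).re)
        (star (u s) * u s + star (w s) * (-(ω ^ 2 : ℂ) * w s)).re s := h1
    have e : (star (u s) * u s + star (w s) * (-(ω ^ 2 : ℂ) * w s)).re =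
        ‖u s‖ ^ 2 - ω ^ 2 * ‖w s‖ ^ 2 := by
      have : star (u s) * u s + star (w s) * (-(ω ^ 2 : ℂ) * w s) =
          ((‖u s‖ ^ 2 - ω ^ 2 * ‖w s‖ ^ 2 : ℝ) : ℂ) := by
        rw [Complex.ofReal_sub, Complex.ofReal_mul, ← star_mul_self_eq, ← star_mul_self_eq]
        push_cast
        ring
      rw [this, Complex.ofReal_re]
    rw [e] at h2
    refine (((((hasDerivAt_id s).const_mul μ).sub (h2.const_mul 2)).add_const
      (2 * (star w₀ * u₀).re)).div_const (4 * ω ^ 2)).congr_deriv ?_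
    have := hen' s
    field_simp
    linear_combination -this
  obtain ⟨hmono, k, hgk, hkg, hkd⟩ := exists_inverse_of_deriv_ge
    (show 0 < 2 * K ^ 2 / μ by positivity) hgd hlow
  refine ⟨g, k, hmono, continuous_iff_continuousAt.mpr fun y => (hkd y).continuousAt, hkg,
    fun s => rfl, fun t τ _ => ?_⟩
  have hwk : HasDerivAt (fun τ => w (k τ)) ((‖w (k τ)‖ ^ 2)⁻¹ • u (k τ)) τ :=
    (hwd (k τ)).scomp τ (hkd τ)
  have huk : HasDerivAt (fun τ => u (k τ)) ((‖w (k τ)‖ ^ 2)⁻¹ • (-(ω ^ 2 : ℂ) * w (k τ))) τ :=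
    (hud (k τ)).scomp τ (hkd τ)
  have hwn := hw0 (k τ)
  have hWn : star (w (k τ)) ≠ 0 := star_ne_zero.mpr hwn
  have hnw : ((‖w (k τ)‖ ^ 2 : ℝ) : ℂ) = star (w (k τ)) * w (k τ) := (star_mul_self_eq _).symm
  refine ⟨pow_ne_zero 2 hwn, HasDerivAt.hasDerivWithinAt ?_, HasDerivAt.hasDerivWithinAt ?_⟩
  · refine (hwk.pow 2).congr_deriv ?_
    rw [Complex.real_smul, Complex.ofReal_inv, hnw]
    push_cast
    field_simp
  · refine ((huk.const_mul 2).div hwk.star hWn).congr_deriv ?_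
    rw [Complex.real_smul, Complex.real_smul, Complex.real_smul, Complex.ofReal_inv,
      norm_pow, Complex.ofReal_neg, Complex.ofReal_div,
      Complex.ofReal_pow (‖w (k τ)‖ ^ 2) 3, hnw]
    simp only [star_mul', star_inv₀, star_star]
    have := hen (k τ)
    field_simp
    linear_combination -this

end Oscillation

theorem two_sqrt_mul_sqrt_le {a b : ℝ} (ha : 0 ≤ a) (hb : 0 ≤ b) :
    2 * (Real.sqrt a * Real.sqrt b) ≤ a + b := by
  nlinarith [sq_nonneg (Real.sqrt a - Real.sqrt b), Real.sq_sqrt ha, Real.sq_sqrt hb]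

theorem chordParam_pos {σ ρ φ : ℝ} (hσ : 2 * |ρ| ≤ σ) (hσ0 : 0 < σ) (hφ : φ ∈ Ioo 0 Real.pi) :
    0 < chordParam σ ρ φ := by
  have hc : |Real.cos φ| < 1 := by
    rw [← sq_lt_one_iff_abs_lt_one]
    have := Real.sin_sq_add_cos_sq φ
    have := pow_pos (Real.sin_pos_of_mem_Ioo hφ) 2
    linarith
  rw [chordParam]
  have h1 : ρ * Real.cos φ ≤ |ρ| * |Real.cos φ| := by rw [← abs_mul]; exact le_abs_self _
  nlinarith [abs_nonneg ρ, abs_nonneg (Real.cos φ)]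

/-- Every phase `φ` is realized by a planar Kepler motion that turns by `θ`. -/
theorem exists_motion_of_anomaly {μ R₁ R₂ θ φ ρ : ℝ} (hμ : 0 < μ) (hR₁ : 0 < R₁) (hR₂ : 0 < R₂)
    (hθ : θ ∈ Ioo 0 (2 * Real.pi)) (hφ : φ ∈ Ioo 0 Real.pi)
    (hρ : ρ = Real.sqrt R₁ * Real.sqrt R₂ * Real.cos (θ / 2)) :
    ∃ (z ζ : ℝ → ℂ) (f : ℝ → ℝ), 0 < flightTime μ (R₁ + R₂) ρ φ ∧
      IsKeplerMotion μ (flightTime μ (R₁ + R₂) ρ φ) z ζ ∧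
      z 0 = R₁ ∧ z (flightTime μ (R₁ + R₂) ρ φ) = R₂ * Complex.exp (θ * Complex.I) ∧
      ContinuousOn f (Icc 0 (flightTime μ (R₁ + R₂) ρ φ)) ∧
      (∀ τ ∈ Icc 0 (flightTime μ (R₁ + R₂) ρ φ), z τ = ‖z τ‖ * Complex.exp (f τ * Complex.I)) ∧
      f (flightTime μ (R₁ + R₂) ρ φ) - f 0 = θ := by
  set t := flightTime μ (R₁ + R₂) ρ φ with ht
  have hsφ : 0 < Real.sin φ := Real.sin_pos_of_mem_Ioo hφ
  have hcs := Real.sin_sq_add_cos_sq φ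
  have hsqrt₁ := Real.sqrt_pos.mpr hR₁
  have hsqrt₂ := Real.sqrt_pos.mpr hR₂
  have hρle : 2 * |ρ| ≤ R₁ + R₂ := by
    refine le_trans ?_ (two_sqrt_mul_sqrt_le hR₁.le hR₂.le)
    rw [hρ, abs_mul, abs_of_pos (mul_pos hsqrt₁ hsqrt₂)]
    nlinarith [Real.abs_cos_le_one (θ / 2), mul_pos hsqrt₁ hsqrt₂]
  have hy := chordParam_pos hρle (add_pos hR₁ hR₂) hφ
  set y := chordParam (R₁ + R₂) ρ φ with hydef
  -- The frequency is forced by the energy relation `2ω² y = μ sin² φ`.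
  set ω := Real.sin φ * Real.sqrt (μ / (2 * y)) with hωdef
  have hω : 0 < ω := mul_pos hsφ (Real.sqrt_pos.mpr (by positivity))
  have hωy : 2 * ω ^ 2 * y = μ * Real.sin φ ^ 2 := by
    rw [hωdef, mul_pow, Real.sq_sqrt (by positivity)]
    field_simp
  -- Square roots of the end points. The half angle `θ / 2` in `w₂`, instead of the principal root,
  -- covers `θ > π` as well.
  set w₁ : ℂ := ((Real.sqrt R₁ : ℝ) : ℂ) with hw₁
  set w₂ : ℂ := ((Real.sqrt R₂ : ℝ) : ℂ) * Complex.exp ((θ / 2 : ℝ) * Complex.I) with hw₂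
  have hn₁ : star w₁ * w₁ = (R₁ : ℂ) := by
    rw [hw₁, star_ofReal, ← Complex.ofReal_mul, Real.mul_self_sqrt hR₁.le]
  have hn₂ : star w₂ * w₂ = (R₂ : ℂ) := by
    rw [star_mul_self_eq, hw₂, norm_mul, Complex.norm_exp_ofReal_mul_I, Complex.norm_real,
      Real.norm_eq_abs, mul_one, sq_abs, Real.sq_sqrt hR₂.le]
  have h12 : star w₁ * w₂ = ((Real.sqrt R₁ * Real.sqrt R₂ : ℝ) : ℂ) *
      Complex.exp ((θ / 2 : ℝ) * Complex.I) := by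
    rw [hw₁, star_ofReal, hw₂]
    push_cast
    ring
  have hre : (star w₁ * w₂).re = ρ := by
    rw [h12, Complex.re_ofReal_mul, Complex.exp_ofReal_mul_I_re, hρ]
  have hsθ : 0 < Real.sin (θ / 2) :=
    Real.sin_pos_of_pos_of_lt_pi (by linarith [hθ.1]) (by linarith [hθ.2])
  have him : 0 < (star w₁ * w₂).im := by
    rw [h12, Complex.im_ofReal_mul, Complex.exp_ofReal_mul_I_im]
    positivity
  have h21 : star w₂ * w₁ = (starRingEnd ℂ) (star w₁ * w₂) := by simp [mul_comm]
  have hsum : star w₁ * w₂ + star w₂ * w₁ = ((2 * ρ : ℝ) : ℂ) := by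
    rw [h21, Complex.add_conj, hre]
  have hre' : (star w₂ * w₁).re = ρ := by rw [h21, Complex.conj_re, hre]
  -- The initial velocity that takes the oscillation from `w₁` to `w₂` at phase `φ`.
  set u₁ : ℂ := ((ω / Real.sin φ : ℝ) : ℂ) * (w₂ - Real.cos φ * w₁) with hu₁
  have hωc : (ω : ℂ) ≠ 0 := by exact_mod_cast hω.ne'
  have hsc : (Real.sin φ : ℂ) ≠ 0 := by exact_mod_cast hsφ.ne'
  have hwu : star w₁ * u₁ = (ω / Real.sin φ : ℝ) * (star w₁ * w₂ - (Real.cos φ * R₁ : ℝ)) := by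
    rw [hu₁, Complex.ofReal_mul, ← hn₁]
    ring
  have h0 : 2 * (star u₁ * u₁ + ω ^ 2 * (star w₁ * w₁)) = μ := by
    have e1 : (Real.sin φ : ℂ) ^ 2 + (Real.cos φ : ℂ) ^ 2 = 1 := by exact_mod_cast hcs
    have e2 : (2 : ℂ) * ω ^ 2 * (R₁ + R₂ - 2 * ρ * Real.cos φ) = μ * Real.sin φ ^ 2 := by
      rw [hydef, chordParam] at hωy
      exact_mod_cast hωy
    rw [hu₁]
    simp only [star_mul', star_sub, star_ofReal]
    rw [Complex.ofReal_div]
    push_cast at hsum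
    field_simp
    linear_combination e2 + 2 * ω ^ 2 * hn₂ - 2 * ω ^ 2 * Real.cos φ * hsum +
      2 * ω ^ 2 * hn₁ + 2 * ω ^ 2 * (star w₁ * w₁) * e1
  have hK : (star w₁ * u₁).im ≠ 0 := by
    rw [hwu, Complex.im_ofReal_mul, Complex.sub_im, Complex.ofReal_im, sub_zero]
    positivity
  obtain ⟨g, k, hmono, hkc, hkg, hg, hkep⟩ := exists_motion_of_oscillation hμ hω h0 hK
  have hpos0 : oscPos ω w₁ u₁ 0 = w₁ := by simp [oscPos]
  have hvel0 : oscVel ω w₁ u₁ 0 = u₁ := by simp [oscVel]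
  have hphase : ω * (φ / ω) = φ := by field_simp
  have hpos : ∀ s, oscPos ω w₁ u₁ s = ((Real.sin (φ - ω * s) / Real.sin φ : ℝ) : ℂ) * w₁ +
      ((Real.sin (ω * s) / Real.sin φ : ℝ) : ℂ) * w₂ := by
    intro s
    rw [oscPos, hu₁, Real.sin_sub]
    push_cast
    push_cast at hsc
    field_simp
    ring
  have hposS : oscPos ω w₁ u₁ (φ / ω) = w₂ := by
    rw [hpos, hphase, sub_self, Real.sin_zero, zero_div, div_self hsφ.ne']
    simp
  have hvelS : oscVel ω w₁ u₁ (φ / ω) = (ω / Real.sin φ : ℝ) * (Real.cos φ * w₂ - w₁) := by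
    have e1 : (Real.sin φ : ℂ) ^ 2 + (Real.cos φ : ℂ) ^ 2 = 1 := by exact_mod_cast hcs
    rw [oscVel, hphase, hu₁, Complex.ofReal_div]
    field_simp
    linear_combination -w₁ * e1
  have hg0 : g 0 = 0 := by
    rw [hg, hpos0, hvel0]
    simp
  have hgS : g (φ / ω) = t := by
    rw [hg, hposS, hvelS, ht, flightTime_eq hμ hφ hω hωy]
    have e2 : star w₂ * ((ω / Real.sin φ : ℝ) * (Real.cos φ * w₂ - w₁)) =
        (ω / Real.sin φ : ℝ) * ((Real.cos φ * R₂ : ℝ) - star w₂ * w₁) := by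
      rw [Complex.ofReal_mul, ← hn₂]
      ring
    rw [e2, hwu, Complex.re_ofReal_mul, Complex.re_ofReal_mul, Complex.sub_re, Complex.sub_re,
      Complex.ofReal_re, Complex.ofReal_re, hre, hre']
    field_simp
    ring
  have hSpos : 0 < φ / ω := div_pos hφ.1 hω
  have htpos : 0 < t := by
    have := hmono hSpos
    rwa [hg0, hgS] at this
  have hk0 : k 0 = 0 := by simpa only [hg0] using hkg 0
  have hkt : k t = φ / ω := by rw [← hgS, hkg]
  have hkmem : ∀ τ ∈ Icc 0 t, k τ ∈ Icc 0 (φ / ω) := by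
    intro τ hτ
    obtain ⟨s, hs, hsτ⟩ : τ ∈ g '' Icc 0 (φ / ω) := by
      have hgc : ContinuousOn g (Icc 0 (φ / ω)) := by
        have : g = fun s => (μ * s - 2 * (star (oscPos ω w₁ u₁ s) * oscVel ω w₁ u₁ s).re +
            2 * (star w₁ * u₁).re) / (4 * ω ^ 2) := funext hg
        rw [this]
        have c1 : Continuous (oscPos ω w₁ u₁) := continuous_iff_continuousAt.mpr fun s =>
          (hasDerivAt_oscPos hω.ne' s).continuousAt
        have c2 : Continuous (oscVel ω w₁ u₁) := continuous_iff_continuousAt.mpr fun s =>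
          (hasDerivAt_oscVel hω.ne' s).continuousAt
        fun_prop
      apply intermediate_value_Icc hSpos.le hgc
      rwa [hg0, hgS]
    rw [← hsτ, hkg]
    exact hs
  -- The oscillation starts on the positive real axis and then stays in the upper half plane, so
  -- `arg` is continuous along it and `2 * arg` is a polar angle of its square.
  have hslit : ∀ τ ∈ Icc 0 t, oscPos ω w₁ u₁ (k τ) ∈ Complex.slitPlane := by
    intro τ hτ
    obtain ⟨h1, h2⟩ := hkmem τ hτ
    rcases h1.eq_or_lt with h1 | h1
    · rw [← h1, hpos0, hw₁]
      exact Complex.ofReal_mem_slitPlane.mpr hsqrt₁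
    · right
      have h3 : ω * k τ ≤ φ := by
        rw [le_div_iff₀ hω] at h2
        linarith
      have h4 : 0 < Real.sin (ω * k τ) :=
        Real.sin_pos_of_pos_of_lt_pi (by positivity) (h3.trans_lt hφ.2)
      rw [hpos, Complex.add_im, Complex.im_ofReal_mul, Complex.im_ofReal_mul, hw₁,
        Complex.ofReal_im, hw₂, Complex.im_ofReal_mul, Complex.exp_ofReal_mul_I_im]
      have : 0 < Real.sin (ω * k τ) / Real.sin φ * (Real.sqrt R₂ * Real.sin (θ / 2)) := by
        positivity
      linarith
  refine ⟨fun τ => oscPos ω w₁ u₁ (k τ) ^ 2,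
    fun τ => 2 * oscVel ω w₁ u₁ (k τ) / star (oscPos ω w₁ u₁ (k τ)),
    fun τ => 2 * Complex.arg (oscPos ω w₁ u₁ (k τ)), htpos, hkep t, ?_, ?_, ?_, ?_, ?_⟩
  · simp only [hk0, hpos0]
    rw [hw₁, ← Complex.ofReal_pow, Real.sq_sqrt hR₁.le]
  · simp only [hkt, hposS]
    rw [hw₂, mul_pow, ← Complex.ofReal_pow, Real.sq_sqrt hR₂.le, ← Complex.exp_nat_mul]
    congr 2
    push_cast
    ring
  · intro τ hτ
    have c1 : ContinuousAt (oscPos ω w₁ u₁) (k τ) := (hasDerivAt_oscPos hω.ne' _).continuousAt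
    have c2 : ContinuousAt (fun τ => oscPos ω w₁ u₁ (k τ)) τ :=
      ContinuousAt.comp (f := k) c1 hkc.continuousAt
    exact (continuousAt_const.mul
      (ContinuousAt.comp (f := fun τ => oscPos ω w₁ u₁ (k τ))
        (Complex.continuousAt_arg (hslit τ hτ)) c2)).continuousWithinAt
  · intro τ _
    simp only
    conv_lhs => rw [← Complex.norm_mul_exp_arg_mul_I (oscPos ω w₁ u₁ (k τ))]
    rw [mul_pow, ← Complex.exp_nat_mul, norm_pow]
    push_cast
    rw [mul_assoc]
  · simp only [hk0, hkt, hpos0, hposS]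
    rw [hw₁, Complex.arg_ofReal_of_nonneg hsqrt₁.le, hw₂, Complex.arg_real_mul _ hsqrt₂,
      Complex.arg_exp_mul_I, (toIocMod_eq_self Real.two_pi_pos).mpr]
    · ring
    · constructor <;> linarith [hθ.1, hθ.2, Real.pi_pos]

/-! ### Transfer types and planes in space -/

/-- The sign of `cos (θ / 2)` for a transfer angle `θ` of the given type. -/
def TransferType.sign : TransferType → ℝ
  | .short => 1
  | .long => -1

theorem TransferType.angles_subset (d : TransferType) : d.angles ⊆ Ioo 0 (2 * Real.pi) := by
  rcases d with _ | _ <;> intro θ hθ <;> have := Real.pi_pos <;>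
    exact ⟨by linarith [hθ.1], by linarith [hθ.2]⟩

theorem TransferType.sign_mul_abs_cos (d : TransferType) {θ : ℝ} (hθ : θ ∈ d.angles) :
    d.sign * |Real.cos (θ / 2)| = Real.cos (θ / 2) ∧ Real.cos (θ / 2) ≠ 0 := by
  have := Real.pi_pos
  rcases d with _ | _
  · have h : 0 < Real.cos (θ / 2) :=
      Real.cos_pos_of_mem_Ioo ⟨by linarith [hθ.1], by linarith [hθ.2]⟩
    exact ⟨by rw [abs_of_pos h, TransferType.sign, one_mul], h.ne'⟩
  · have h : Real.cos (θ / 2) < 0 :=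
      Real.cos_neg_of_pi_div_two_lt_of_lt (by linarith [hθ.1]) (by linarith [hθ.2])
    exact ⟨by rw [abs_of_neg h, TransferType.sign]; ring, h.ne⟩

section Frame

variable {V : Type*} [NormedAddCommGroup V] [InnerProductSpace ℝ V]

/-- `√(‖r₁‖ ‖r₂‖) cos (θ / 2)`, where `θ` is the transfer angle of the given type. -/
noncomputable def meanCos (d : TransferType) (r₁ r₂ : V) : ℝ :=
  d.sign * Real.sqrt ((‖r₁‖ * ‖r₂‖ + inner ℝ r₁ r₂) / 2)

/-- The half-angle formula; the transfer type supplies the sign that the square root loses. -/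
theorem meanCos_eq {d : TransferType} {r₁ r₂ : V} {θ : ℝ} (hθ : θ ∈ d.angles)
    (h : inner ℝ r₁ r₂ = ‖r₁‖ * ‖r₂‖ * Real.cos θ) :
    meanCos d r₁ r₂ = Real.sqrt ‖r₁‖ * Real.sqrt ‖r₂‖ * Real.cos (θ / 2) := by
  have e : (‖r₁‖ * ‖r₂‖ + inner ℝ r₁ r₂) / 2 = ‖r₁‖ * ‖r₂‖ * Real.cos (θ / 2) ^ 2 := by
    have : Real.cos θ = 2 * Real.cos (θ / 2) ^ 2 - 1 := by
      rw [← Real.cos_two_mul]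
      congr 1
      ring
    rw [h, this]
    ring
  rw [meanCos, e, Real.sqrt_mul (by positivity), Real.sqrt_mul (norm_nonneg _), Real.sqrt_sq_eq_abs]
  linear_combination Real.sqrt ‖r₁‖ * Real.sqrt ‖r₂‖ * (d.sign_mul_abs_cos hθ).1

/-- The bisector of `r₁, r₂`, with length `√(‖r₁‖ ‖r₂‖)`. -/
noncomputable def bisector (d : TransferType) (r₁ r₂ : V) : V :=
  (1 / (2 * meanCos d r₁ r₂)) • (‖r₂‖ • r₁ + ‖r₁‖ • r₂)

/-- Departure velocity of the arc with phase `φ`. -/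
noncomputable def arcV₁ (μ : ℝ) (d : TransferType) (r₁ r₂ : V) (φ : ℝ) : V :=
  (Real.sqrt (2 * μ / chordParam (‖r₁‖ + ‖r₂‖) (meanCos d r₁ r₂) φ) / ‖r₁‖) •
    (bisector d r₁ r₂ - Real.cos φ • r₁)

/-- Arrival velocity of the arc with phase `φ`. -/
noncomputable def arcV₂ (μ : ℝ) (d : TransferType) (r₁ r₂ : V) (φ : ℝ) : V :=
  (Real.sqrt (2 * μ / chordParam (‖r₁‖ + ‖r₂‖) (meanCos d r₁ r₂) φ) / ‖r₂‖) •
    (Real.cos φ • r₂ - bisector d r₁ r₂)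

/-- The plane spanned by `p, q`, with complex coordinate. -/
noncomputable def frameMap (p q : V) : ℂ →L[ℝ] V :=
  Complex.reCLM.smulRight p + Complex.imCLM.smulRight q

theorem frameMap_apply (p q : V) (z : ℂ) : frameMap p q z = z.re • p + z.im • q := by
  simp [frameMap]

/-- The complex coordinate of the projection to the plane spanned by `p, q`. -/
noncomputable def frameCoord (p q : V) : V →L[ℝ] ℂ :=
  (innerSL ℝ p).smulRight (1 : ℂ) + (innerSL ℝ q).smulRight Complex.I

theorem frameCoord_frameMap {p q : V} (hp : ‖p‖ = 1) (hq : ‖q‖ = 1) (hpq : inner ℝ p q = 0)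
    (z : ℂ) : frameCoord p q (frameMap p q z) = z := by
  have hqp : inner ℝ q p = 0 := by rw [real_inner_comm, hpq]
  rw [frameMap_apply]
  simp [frameCoord, inner_add_right, inner_smul_right, hp, hq, hpq, hqp]

theorem inner_frameMap {p q : V} (hp : ‖p‖ = 1) (hq : ‖q‖ = 1) (hpq : inner ℝ p q = 0)
    (z w : ℂ) : inner ℝ (frameMap p q z) (frameMap p q w) = inner ℝ z w := by
  have hqp : inner ℝ q p = 0 := by rw [real_inner_comm, hpq]
  rw [frameMap_apply, frameMap_apply, real_inner_eq_re]
  simp [inner_add_right, inner_add_left, inner_smul_right, inner_smul_left, hp, hq, hpq, hqp]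
  ring

theorem norm_frameMap {p q : V} (hp : ‖p‖ = 1) (hq : ‖q‖ = 1) (hpq : inner ℝ p q = 0)
    (z : ℂ) : ‖frameMap p q z‖ = ‖z‖ := by
  rw [← sq_eq_sq₀ (norm_nonneg _) (norm_nonneg _), ← real_inner_self_eq_norm_sq,
    inner_frameMap hp hq hpq, real_inner_self_eq_norm_sq]

theorem frameMap_polar (p q : V) (R a : ℝ) :
    frameMap p q (R * Complex.exp (a * Complex.I)) =
      R • (Real.cos a • p + Real.sin a • q) := by
  rw [frameMap_apply, Complex.re_ofReal_mul, Complex.im_ofReal_mul, Complex.exp_ofReal_mul_I_re,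
    Complex.exp_ofReal_mul_I_im, smul_add, smul_smul, smul_smul]

end Frame

/-! ### Lambert arcs in terms of their phase -/

/-- A Lambert arc whose time of flight exceeds those of all arcs with nonnegative energy is given
by its phase. -/
theorem IsLambertVelocities.exists_anomaly {μ t R : ℝ} {d : TransferType} {r₁ r₂ : E3}
    {w : E3 × E3} (hμ : 0 < μ) (h : IsLambertVelocities μ d r₁ r₂ t w) (h₁ : ‖r₁‖ ≤ R)
    (h₂ : ‖r₂‖ ≤ R) (ht : 4 * R ^ 3 / μ < t ^ 2) :
    ∃ φ ∈ Ioo 0 Real.pi, t = flightTime μ (‖r₁‖ + ‖r₂‖) (meanCos d r₁ r₂) φ ∧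
      w = (arcV₁ μ d r₁ r₂ φ, arcV₂ μ d r₁ r₂ φ) := by
  obtain ⟨ht0, r, v, harc, rfl, rfl, ⟨θ, hθ, p, q, f, hp, hq, hpq, hf, hpol, rfl⟩, rfl⟩ := h
  have m0 : (0 : ℝ) ∈ Icc 0 t := ⟨le_rfl, ht0.le⟩
  have m1 : t ∈ Icc 0 t := ⟨ht0.le, le_rfl⟩
  set z : ℝ → ℂ := fun τ => frameCoord p q (r τ) with hz
  set ζ : ℝ → ℂ := fun τ => frameCoord p q (v τ) with hζ
  have hzpol : ∀ τ ∈ Icc 0 t, z τ = ‖r τ‖ * Complex.exp (f τ * Complex.I) := fun τ hτ => by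
    rw [hz]
    beta_reduce
    conv_lhs => rw [hpol τ hτ, ← frameMap_polar, frameCoord_frameMap hp hq hpq]
  have hrz : ∀ τ ∈ Icc 0 t, r τ = frameMap p q (z τ) := fun τ hτ => by
    rw [hzpol τ hτ, frameMap_polar, ← hpol τ hτ]
  have hnorm : ∀ τ ∈ Icc 0 t, ‖z τ‖ = ‖r τ‖ := fun τ hτ => by
    rw [hrz τ hτ, norm_frameMap hp hq hpq]
  have hzd : ∀ τ ∈ Icc 0 t, HasDerivWithinAt z (ζ τ) (Icc 0 t) τ := fun τ hτ =>
    (frameCoord p q).hasFDerivAt.comp_hasDerivWithinAt τ (harc τ hτ).2.1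
  -- The position stays in the plane of the frame, so by uniqueness of derivatives the velocity does
  -- too.
  have hvζ : ∀ τ ∈ Icc 0 t, v τ = frameMap p q (ζ τ) := fun τ hτ => by
    have h1 : HasDerivWithinAt r (frameMap p q (ζ τ)) (Icc 0 t) τ :=
      ((frameMap p q).hasFDerivAt.comp_hasDerivWithinAt τ (hzd τ hτ)).congr
        (fun x hx => hrz x hx) (hrz τ hτ)
    exact (uniqueDiffOn_Icc ht0 τ hτ).eq_deriv _ (harc τ hτ).2.1 h1
  have hkep : IsKeplerMotion μ t z ζ := fun τ hτ => by
    refine ⟨?_, hzd τ hτ, ?_⟩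
    · rw [← norm_ne_zero_iff, hnorm τ hτ]
      exact norm_ne_zero_iff.mpr (harc τ hτ).1
    · refine ((frameCoord p q).hasFDerivAt.comp_hasDerivWithinAt τ (harc τ hτ).2.2).congr_deriv ?_
      rw [map_smul, hnorm τ hτ]
  have hE : energy μ (z 0) (ζ 0) < 0 := by
    by_contra hE
    have := sq_time_le_of_energy_nonneg hμ ht0.le hkep (not_lt.mp hE) (R := R)
      (by rwa [hnorm 0 m0]) (by rwa [hnorm t m1])
    linarith
  have hinner : inner ℝ (r 0) (r t) = ‖r 0‖ * ‖r t‖ * Real.cos (f t - f 0) := by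
    rw [hrz 0 m0, hrz t m1, inner_frameMap hp hq hpq, norm_frameMap hp hq hpq,
      norm_frameMap hp hq hpq, hnorm 0 m0, hnorm t m1, hzpol 0 m0, hzpol t m1, real_inner_eq_re,
      Real.cos_sub]
    simp only [Complex.star_def, map_mul, Complex.conj_ofReal, Complex.mul_re, Complex.mul_im,
      Complex.conj_re, Complex.conj_im, Complex.exp_ofReal_mul_I_re, Complex.exp_ofReal_mul_I_im,
      Complex.ofReal_re, Complex.ofReal_im]
    ring
  have hρ := meanCos_eq hθ hinner
  have hρ0 : meanCos d (r 0) (r t) ≠ 0 := by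
    rw [hρ]
    exact mul_ne_zero (mul_ne_zero
      (Real.sqrt_pos.mpr (norm_pos_iff.mpr (harc 0 m0).1)).ne'
      (Real.sqrt_pos.mpr (norm_pos_iff.mpr (harc t m1).1)).ne') (d.sign_mul_abs_cos hθ).2
  obtain ⟨φ, hφ, e1, e2, e3⟩ := exists_anomaly_of_motion hμ ht0 hkep hE hf
    (fun τ hτ => by rw [hnorm τ hτ]; exact hzpol τ hτ) (d.angles_subset hθ).1
    (d.angles_subset hθ).2 hρ0 (by rw [hnorm 0 m0, hnorm t m1]; exact hρ)
  rw [hnorm 0 m0, hnorm t m1] at e1 e2 e3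
  refine ⟨φ, hφ, e1, ?_⟩
  rw [Prod.mk.injEq, hvζ 0 m0, hvζ t m1, e2, e3]
  simp only [map_smul, map_sub, map_add, ← hrz 0 m0, ← hrz t m1]
  exact ⟨rfl, rfl⟩

/-- Every phase belongs to a Lambert arc. -/
theorem exists_isLambertVelocities {μ φ : ℝ} (hμ : 0 < μ) (d : TransferType) {r₁ r₂ : E3}
    (hs : 0 < Real.sin (InnerProductGeometry.angle r₁ r₂)) (h₁ : r₁ ≠ 0) (h₂ : r₂ ≠ 0)
    (hφ : φ ∈ Ioo 0 Real.pi) :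
    ∃ w, IsLambertVelocities μ d r₁ r₂
      (flightTime μ (‖r₁‖ + ‖r₂‖) (meanCos d r₁ r₂) φ) w := by
  have n₁ := norm_pos_iff.mpr h₁
  have n₂ := norm_pos_iff.mpr h₂
  obtain ⟨θ, hθ, hcos, hsin⟩ : ∃ θ ∈ d.angles,
      Real.cos θ = Real.cos (InnerProductGeometry.angle r₁ r₂) ∧ Real.sin θ ≠ 0 := by
    have a0 : 0 < InnerProductGeometry.angle r₁ r₂ := by
      refine lt_of_le_of_ne (InnerProductGeometry.angle_nonneg _ _) fun h => ?_
      rw [← h, Real.sin_zero] at hs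
      exact lt_irrefl _ hs
    have a1 : InnerProductGeometry.angle r₁ r₂ < Real.pi := by
      refine lt_of_le_of_ne (InnerProductGeometry.angle_le_pi _ _) fun h => ?_
      rw [h, Real.sin_pi] at hs
      exact lt_irrefl _ hs
    rcases d with _ | _
    · exact ⟨_, ⟨a0, a1⟩, rfl, hs.ne'⟩
    · refine ⟨2 * Real.pi - InnerProductGeometry.angle r₁ r₂, ⟨by linarith, by linarith⟩,
        Real.cos_two_pi_sub _, ?_⟩
      rw [Real.sin_two_pi_sub]
      exact neg_ne_zero.mpr hs.ne'
  have hinner : inner ℝ r₁ r₂ = ‖r₁‖ * ‖r₂‖ * Real.cos θ := by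
    rw [hcos, mul_comm, InnerProductGeometry.cos_angle_mul_norm_mul_norm]
  set p : E3 := ‖r₁‖⁻¹ • r₁ with hpdef
  -- For long transfers `sin θ < 0` reverses `q`, so that in this frame `r₂` has polar angle `θ` in
  -- both cases.
  set q : E3 := (Real.sin θ)⁻¹ • (‖r₂‖⁻¹ • r₂ - Real.cos θ • p) with hqdef
  have hp : ‖p‖ = 1 := by
    rw [hpdef, norm_smul, norm_inv, norm_norm, inv_mul_cancel₀ n₁.ne']
  have hpr : inner ℝ p (‖r₂‖⁻¹ • r₂) = Real.cos θ := by
    rw [hpdef, inner_smul_left, inner_smul_right, hinner]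
    simp only [conj_trivial]
    field_simp
  have hr1 : ‖‖r₂‖⁻¹ • r₂‖ = 1 := by
    rw [norm_smul, norm_inv, norm_norm, inv_mul_cancel₀ n₂.ne']
  have hpq : inner ℝ p q = 0 := by
    rw [hqdef, inner_smul_right, inner_sub_right, hpr, inner_smul_right,
      real_inner_self_eq_norm_sq, hp]
    ring
  have hq : ‖q‖ = 1 := by
    have : ‖q‖ ^ 2 = 1 := by
      rw [hqdef, norm_smul, mul_pow, norm_sub_sq_real, hr1, inner_smul_right, norm_smul, hp,
        real_inner_comm, hpr, norm_inv, Real.norm_eq_abs, Real.norm_eq_abs, mul_one, sq_abs,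
        inv_pow, sq_abs]
      field_simp
      linear_combination -Real.sin_sq_add_cos_sq θ
    exact (pow_eq_one_iff_of_nonneg (norm_nonneg _) two_ne_zero).mp this
  have hr₁ : r₁ = frameMap p q ‖r₁‖ := by
    rw [frameMap_apply, Complex.ofReal_re, Complex.ofReal_im, zero_smul, add_zero, hpdef, smul_smul,
      mul_inv_cancel₀ n₁.ne', one_smul]
  have hr₂ : r₂ = frameMap p q (‖r₂‖ * Complex.exp (θ * Complex.I)) := by
    rw [frameMap_polar, hqdef, smul_inv_smul₀ hsin, add_sub_cancel, smul_inv_smul₀ n₂.ne']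
  obtain ⟨z, ζ, f, ht, hkep, hz0, hzt, hf, hpol, hfθ⟩ := exists_motion_of_anomaly hμ n₁ n₂
    (d.angles_subset hθ) hφ (meanCos_eq hθ hinner)
  refine ⟨_, ht, fun τ => frameMap p q (z τ), fun τ => frameMap p q (ζ τ), ?_, ?_, ?_,
    ⟨θ, hθ, p, q, f, hp, hq, hpq, hf, ?_, hfθ.symm⟩, rfl⟩
  · intro τ hτ
    obtain ⟨k0, k1, k2⟩ := hkep τ hτ
    refine ⟨?_, (frameMap p q).hasFDerivAt.comp_hasDerivWithinAt τ k1,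
      ((frameMap p q).hasFDerivAt.comp_hasDerivWithinAt τ k2).congr_deriv ?_⟩
    · rw [← norm_ne_zero_iff, norm_frameMap hp hq hpq]
      exact norm_ne_zero_iff.mpr k0
    · rw [map_smul, norm_frameMap hp hq hpq]
  · beta_reduce
    rw [hz0, ← hr₁]
  · beta_reduce
    rw [hzt, ← hr₂]
  · intro τ hτ
    beta_reduce
    conv_lhs => rw [hpol τ hτ]
    rw [frameMap_polar, norm_frameMap hp hq hpq]

/-! ### The time of flight as a function of the phase -/

section FlightTime

variable {μ σ ρ φ δ C : ℝ}

theorem le_chordParam (hδ : δ ≤ σ - 2 * |ρ|) (φ : ℝ) : δ ≤ chordParam σ ρ φ := by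
  have h1 : ρ * Real.cos φ ≤ |ρ| * 1 :=
    (le_abs_self _).trans (by rw [abs_mul]; gcongr; exact Real.abs_cos_le_one φ)
  rw [chordParam]
  linarith

theorem chordParam_le (hδ0 : 0 < δ) (hδ : δ ≤ σ - 2 * |ρ|) (hσ : σ ≤ C) (φ : ℝ) :
    chordParam σ ρ φ ≤ 2 * C := by
  have h1 : -(ρ * Real.cos φ) ≤ |ρ| * 1 :=
    (neg_le_abs _).trans (by rw [abs_mul]; gcongr; exact Real.abs_cos_le_one φ)
  rw [chordParam]
  linarith

/-- The derivative of the time of flight with respect to the phase. -/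
noncomputable def flightTimeDeriv (μ σ ρ φ : ℝ) : ℝ :=
  Real.sqrt (chordParam σ ρ φ / (2 * μ)) *
    (3 * ρ * Real.sin φ * ((φ - Real.sin φ * Real.cos φ) / Real.sin φ ^ 3) +
      2 * ρ ^ 2 * Real.sin φ / chordParam σ ρ φ +
      chordParam σ ρ φ * ((2 * Real.sin φ ^ 3 -
        3 * Real.cos φ * (φ - Real.sin φ * Real.cos φ)) / Real.sin φ ^ 4))

theorem hasDerivAt_chordParam (σ ρ φ : ℝ) :
    HasDerivAt (chordParam σ ρ) (2 * ρ * Real.sin φ) φ := by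
  refine (((Real.hasDerivAt_cos φ).const_mul (2 * ρ)).const_sub σ).congr_deriv ?_
  ring

theorem hasDerivAt_flightTime (hμ : 0 < μ) (hy : 0 < chordParam σ ρ φ)
    (hφ : φ ∈ Ioo 0 Real.pi) :
    HasDerivAt (flightTime μ σ ρ) (flightTimeDeriv μ σ ρ φ) φ := by
  have hs : 0 < Real.sin φ := Real.sin_pos_of_mem_Ioo hφ
  have h1 := ((hasDerivAt_chordParam σ ρ φ).div_const (2 * μ)).sqrt
    (div_pos hy (by positivity)).ne'
  have h2 := ((hasDerivAt_id φ).sub ((Real.hasDerivAt_sin φ).mul (Real.hasDerivAt_cos φ))).div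
    ((Real.hasDerivAt_sin φ).pow 3) (pow_pos hs 3).ne'
  refine (h1.mul (((hasDerivAt_chordParam σ ρ φ).mul h2).add_const (2 * ρ))).congr_deriv ?_
  simp only [flightTimeDeriv, id, Pi.mul_apply, Pi.sub_apply, Pi.pow_apply, Pi.div_apply]
  set S := Real.sqrt (chordParam σ ρ φ / (2 * μ)) with hS
  have hSp : 0 < S := Real.sqrt_pos.mpr (div_pos hy (by positivity))
  have hS2 : S ^ 2 = chordParam σ ρ φ / (2 * μ) := Real.sq_sqrt (div_pos hy (by positivity)).le
  have e : 2 * ρ * Real.sin φ / (2 * μ) / (2 * S) = S * (ρ * Real.sin φ / chordParam σ ρ φ) := by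
    field_simp
    rw [hS2]
    field_simp
  have hc : Real.cos φ ^ 2 = 1 - Real.sin φ ^ 2 := Real.cos_sq' φ
  rw [e]
  generalize chordParam σ ρ φ = y at hy ⊢
  field_simp
  push_cast
  ring_nf
  simp only [hc]
  ring

/-- The numerator vanishes to third order at `0`: it is at most `2φ³/3`, and `φ ≤ (π/2) sin φ ≤ 1.6
sin φ`. So the time of flight does not blow up at small phases. -/
theorem anomaly_sub_le_of_le_pi_div_two (h0 : 0 < φ) (h1 : φ ≤ Real.pi / 2) :
    φ - Real.sin φ * Real.cos φ ≤ 5 * Real.sin φ ^ 3 := by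
  have hs : Real.sin φ ≤ φ := Real.sin_le h0.le
  have hs0 : 0 ≤ Real.sin φ := Real.sin_nonneg_of_nonneg_of_le_pi h0.le (by linarith)
  have h2 := Real.sin_ge_sub_cube h0.le
  have h3 := Real.one_sub_sq_div_two_le_cos (x := φ)
  have h4 : φ - Real.sin φ * Real.cos φ ≤ 2 / 3 * φ ^ 3 := by
    have : Real.sin φ * (1 - Real.cos φ) ≤ φ * (φ ^ 2 / 2) :=
      mul_le_mul hs (by linarith) (by linarith [Real.cos_le_one φ]) h0.le
    nlinarith
  have h5 : φ ≤ Real.pi / 2 * Real.sin φ := by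
    have := Real.mul_le_sin h0.le h1
    have hpi := Real.pi_pos
    calc φ = Real.pi / 2 * (2 / Real.pi * φ) := by field_simp
      _ ≤ _ := by gcongr
  have h6 : φ ≤ 1.6 * Real.sin φ := by
    refine h5.trans ?_
    gcongr
    linarith [Real.pi_lt_d2]
  have h7 : φ ^ 3 ≤ (1.6 * Real.sin φ) ^ 3 := by gcongr
  have h8 : 0 ≤ Real.sin φ ^ 3 := by positivity
  nlinarith

theorem anomaly_sub_le (hφ : φ ∈ Ioo 0 Real.pi) : φ - Real.sin φ * Real.cos φ ≤ 5 := by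
  have h1 : -(Real.sin φ * Real.cos φ) ≤ 1 := by
    nlinarith [Real.sin_sq_add_cos_sq φ, sq_nonneg (Real.sin φ + Real.cos φ)]
  linarith [hφ.2, Real.pi_lt_four]

/-- The quotient bounded by `B` is the only factor that can be large, since `y ≤ 2C` and `2ρ ≤ C`.
-/
theorem flightTime_le (hμ : 0 < μ) (hδ0 : 0 < δ) (hδ : δ ≤ σ - 2 * |ρ|) (hσ : σ ≤ C) {B : ℝ}
    (hB : (φ - Real.sin φ * Real.cos φ) / Real.sin φ ^ 3 ≤ B) (hB0 : 0 ≤ B) :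
    flightTime μ σ ρ φ ≤ Real.sqrt (C / μ) * (2 * C * B + C) := by
  have h1 := chordParam_le hδ0 hδ hσ φ
  have h2 := le_chordParam hδ φ
  have hC : 0 ≤ C := by linarith
  have hρ : 2 * ρ ≤ C := by linarith [le_abs_self ρ]
  rw [flightTime]
  have h3 : chordParam σ ρ φ / (2 * μ) ≤ C / μ := by
    rw [div_le_div_iff₀ (by positivity) hμ]
    nlinarith
  have h4 : chordParam σ ρ φ * ((φ - Real.sin φ * Real.cos φ) / Real.sin φ ^ 3) ≤ 2 * C * B :=
    (mul_le_mul_of_nonneg_left hB (by linarith)).trans (mul_le_mul_of_nonneg_right h1 hB0)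
  refine (mul_le_mul_of_nonneg_left (add_le_add h4 hρ) (Real.sqrt_nonneg _)).trans ?_
  exact mul_le_mul_of_nonneg_right (Real.sqrt_le_sqrt h3) (by positivity)

/-- Read backward, a long flight has a small `sin φ`. The constant is `11 = 2 · 5 + 1`. -/
theorem flightTime_le_div (hμ : 0 < μ) (hδ0 : 0 < δ) (hδ : δ ≤ σ - 2 * |ρ|) (hσ : σ ≤ C)
    (hφ : φ ∈ Ioo 0 Real.pi) :
    flightTime μ σ ρ φ ≤ 11 * C * Real.sqrt (C / μ) / Real.sin φ ^ 3 := by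
  have hs : 0 < Real.sin φ := Real.sin_pos_of_mem_Ioo hφ
  have hC : 0 ≤ C := by linarith [abs_nonneg ρ]
  have h1 := flightTime_le hμ hδ0 hδ hσ (φ := φ) (B := 5 / Real.sin φ ^ 3)
    (by have := anomaly_sub_le hφ; gcongr) (by positivity)
  refine h1.trans ?_
  have h2 : C ≤ C / Real.sin φ ^ 3 := by
    rw [le_div_iff₀ (by positivity)]
    exact mul_le_of_le_one_right hC (pow_le_one₀ hs.le (Real.sin_le_one φ))
  calc Real.sqrt (C / μ) * (2 * C * (5 / Real.sin φ ^ 3) + C)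
      ≤ Real.sqrt (C / μ) * (2 * C * (5 / Real.sin φ ^ 3) + C / Real.sin φ ^ 3) := by gcongr
    _ = _ := by ring

/-- The time of flight is bounded as long as the phase stays away from `π`. -/
theorem flightTime_le_of_cos_ge (hμ : 0 < μ) (hδ0 : 0 < δ) (hδ : δ ≤ σ - 2 * |ρ|) (hσ : σ ≤ C)
    (hφ : φ ∈ Ioo 0 Real.pi) {κ : ℝ} (hκ0 : 0 < κ) (hκ1 : κ ≤ 1) (hc : -(1 - κ) ≤ Real.cos φ) :
    flightTime μ σ ρ φ ≤ Real.sqrt (C / μ) * (2 * C * (5 / κ ^ 2) + C) := by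
  have hs : 0 < Real.sin φ := Real.sin_pos_of_mem_Ioo hφ
  refine flightTime_le hμ hδ0 hδ hσ ?_ (by positivity)
  have hκ2 : κ ^ 2 ≤ 1 := pow_le_one₀ hκ0.le hκ1
  -- Up to `π/2` the quotient is at most `5`; beyond, the bound on the cosine gives `sin² φ ≥ κ`.
  rcases le_total φ (Real.pi / 2) with h | h
  · rw [div_le_iff₀ (by positivity)]
    refine (anomaly_sub_le_of_le_pi_div_two hφ.1 h).trans ?_
    have : 5 ≤ 5 / κ ^ 2 := by
      rw [le_div_iff₀ (by positivity)]
      linarith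
    gcongr
  · have hc0 : Real.cos φ ≤ 0 := Real.cos_nonpos_of_pi_div_two_le_of_le h (by linarith [hφ.2])
    have h1 : κ ≤ Real.sin φ ^ 2 := by
      nlinarith [Real.sin_sq_add_cos_sq φ]
    have h2 : κ ^ 2 ≤ Real.sin φ ^ 3 := by
      calc κ ^ 2 ≤ (Real.sin φ ^ 2) ^ 2 := by gcongr
        _ = Real.sin φ ^ 3 * Real.sin φ := by ring
        _ ≤ _ := mul_le_of_le_one_right (by positivity) (Real.sin_le_one φ)
    have := anomaly_sub_le hφ
    calc _ ≤ 5 / Real.sin φ ^ 3 := by gcongr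
      _ ≤ _ := by gcongr

/-- Close to the phase `π`, the time of flight increases at least at the rate of `sin⁻⁴`. -/
theorem le_flightTimeDeriv (hμ : 0 < μ) (hδ0 : 0 < δ) (hδ : δ ≤ σ - 2 * |ρ|) (hσ : σ ≤ C)
    (hφ : φ ∈ Ioo 0 Real.pi) (hc : Real.cos φ ≤ -(1 - δ / (2 * C))) :
    3 * δ / 2 * Real.sqrt (δ / (2 * μ)) / Real.sin φ ^ 4 ≤ flightTimeDeriv μ σ ρ φ := by
  have hs : 0 < Real.sin φ := Real.sin_pos_of_mem_Ioo hφ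
  have hC : 0 < C := by linarith [abs_nonneg ρ]
  have hκ : δ / (2 * C) ≤ 1 / 2 := by
    rw [div_le_div_iff₀ (by positivity) two_pos]
    linarith [abs_nonneg ρ]
  have hy := le_chordParam hδ φ
  have hy0 : 0 < chordParam σ ρ φ := hδ0.trans_le hy
  have hcs := Real.sin_sq_add_cos_sq φ
  have hφ2 : Real.pi / 2 ≤ φ := by
    by_contra h
    have := Real.cos_nonneg_of_mem_Icc (x := φ) ⟨by linarith [hφ.1, Real.pi_pos], by linarith⟩
    linarith
  have hN : 1 ≤ φ - Real.sin φ * Real.cos φ := by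
    have := Real.pi_gt_three
    nlinarith
  -- At `φ = π` the right side is `σ + 2ρ ≥ δ`; the hypothesis on the cosine costs at most `δ / 2`.
  have hbr : δ / 2 ≤ ρ * Real.sin φ ^ 2 - chordParam σ ρ φ * Real.cos φ := by
    have e : ρ * Real.sin φ ^ 2 - chordParam σ ρ φ * Real.cos φ =
        ρ * (1 + Real.cos φ ^ 2) - σ * Real.cos φ := by
      rw [chordParam]
      linear_combination ρ * hcs
    rw [e]
    have h1 : -(2 * |ρ|) ≤ ρ * (1 + Real.cos φ ^ 2) := by
      have h2 : |ρ * (1 + Real.cos φ ^ 2)| ≤ |ρ| * 2 := by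
        rw [abs_mul]
        gcongr
        rw [abs_of_nonneg (by positivity)]
        linarith [Real.cos_sq_le_one φ]
      linarith [neg_abs_le (ρ * (1 + Real.cos φ ^ 2))]
    have hσ0 : 0 < σ := by linarith [abs_nonneg ρ]
    have h3 : σ * (1 - δ / (2 * C)) ≤ σ * -Real.cos φ := by
      gcongr
      linarith
    have h4 : σ * (δ / (2 * C)) ≤ δ / 2 := by
      calc σ * (δ / (2 * C)) ≤ C * (δ / (2 * C)) := by gcongr
        _ = δ / 2 := by field_simp
    nlinarith
  -- Regrouped so that the `sin⁻⁴` term carries the estimate and the other terms are nonnegative.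
  have e : flightTimeDeriv μ σ ρ φ = Real.sqrt (chordParam σ ρ φ / (2 * μ)) *
      (3 * (φ - Real.sin φ * Real.cos φ) *
        (ρ * Real.sin φ ^ 2 - chordParam σ ρ φ * Real.cos φ) / Real.sin φ ^ 4 +
      (2 * ρ ^ 2 * Real.sin φ / chordParam σ ρ φ + 2 * chordParam σ ρ φ / Real.sin φ)) := by
    rw [flightTimeDeriv]
    field_simp
    ring
  rw [e]
  have h5 : 3 * δ / 2 / Real.sin φ ^ 4 ≤ 3 * (φ - Real.sin φ * Real.cos φ) *
        (ρ * Real.sin φ ^ 2 - chordParam σ ρ φ * Real.cos φ) / Real.sin φ ^ 4 := by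
    gcongr
    nlinarith
  have h6 : 0 ≤ 2 * ρ ^ 2 * Real.sin φ / chordParam σ ρ φ + 2 * chordParam σ ρ φ / Real.sin φ := by
    positivity
  calc 3 * δ / 2 * Real.sqrt (δ / (2 * μ)) / Real.sin φ ^ 4
      = Real.sqrt (δ / (2 * μ)) * (3 * δ / 2 / Real.sin φ ^ 4) := by ring
    _ ≤ _ := by
      refine mul_le_mul (Real.sqrt_le_sqrt (by gcongr)) (by linarith) (by positivity)
        (Real.sqrt_nonneg _)

/-- For long times of flight there is exactly one phase, it is close to `π`, and it depends
nondegenerately on the time of flight. -/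
theorem exists_unique_phase (hμ : 0 < μ) (hδ0 : 0 < δ) (C : ℝ) {s₀ : ℝ} (hs₀ : 0 < s₀) :
    ∃ t₁, ∀ σ ρ t, δ ≤ σ - 2 * |ρ| → σ ≤ C → t₁ < t →
      (∃ φ ∈ Ioo 0 Real.pi, flightTime μ σ ρ φ = t) ∧
      (∀ φ ∈ Ioo 0 Real.pi, ∀ φ' ∈ Ioo 0 Real.pi,
        flightTime μ σ ρ φ = t → flightTime μ σ ρ φ' = t → φ = φ') ∧
      ∀ φ ∈ Ioo 0 Real.pi, flightTime μ σ ρ φ = t → Real.sin φ < s₀ ∧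
        3 * δ / 2 * Real.sqrt (δ / (2 * μ)) / Real.sin φ ^ 4 ≤ flightTimeDeriv μ σ ρ φ := by
  set κ := δ / (2 * C) with hκ
  -- The first bound exceeds the time of flight of every phase up to `φ₀`, beyond which it is
  -- strictly increasing; the second forces `sin φ < s₀`.
  refine ⟨max (Real.sqrt (C / μ) * (2 * C * (5 / κ ^ 2) + C))
    (11 * C * Real.sqrt (C / μ) / s₀ ^ 3), fun σ ρ t hδ hσ ht => ?_⟩
  obtain ⟨ht1, ht2⟩ := max_lt_iff.mp ht
  have hC : 0 < C := by linarith [abs_nonneg ρ]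
  have hκ0 : 0 < κ := by positivity
  have hκ1 : κ ≤ 1 / 2 := by
    rw [hκ, div_le_div_iff₀ (by positivity) two_pos]
    linarith [abs_nonneg ρ]
  have hypos : ∀ φ, 0 < chordParam σ ρ φ := fun φ => hδ0.trans_le (le_chordParam hδ φ)
  set φ₀ := Real.arccos (-(1 - κ)) with hφ₀
  have hcos₀ : Real.cos φ₀ = -(1 - κ) := Real.cos_arccos (by linarith) (by linarith)
  have hφ₀0 : 0 < φ₀ := Real.arccos_pos.mpr (by linarith)
  have hφ₀π : φ₀ < Real.pi := by
    refine lt_of_le_of_ne (Real.arccos_le_pi _) fun h => ?_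
    rw [h, Real.cos_pi] at hcos₀
    linarith
  have hsub : Ico φ₀ Real.pi ⊆ Ioo 0 Real.pi := fun x hx => ⟨hφ₀0.trans_le hx.1, hx.2⟩
  have hcosle : ∀ φ ∈ Ico φ₀ Real.pi, Real.cos φ ≤ -(1 - κ) := fun φ hφ => by
    rw [← hcos₀]
    exact Real.cos_le_cos_of_nonneg_of_le_pi hφ₀0.le hφ.2.le hφ.1
  have hderiv : ∀ φ ∈ Ioo 0 Real.pi,
      HasDerivAt (flightTime μ σ ρ) (flightTimeDeriv μ σ ρ φ) φ := fun φ hφ =>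
    hasDerivAt_flightTime hμ (hypos φ) hφ
  have hcont : ContinuousOn (flightTime μ σ ρ) (Ico φ₀ Real.pi) := fun φ hφ =>
    (hderiv φ (hsub hφ)).continuousAt.continuousWithinAt
  have hmono : StrictMonoOn (flightTime μ σ ρ) (Ico φ₀ Real.pi) := by
    refine strictMonoOn_of_deriv_pos (convex_Ico _ _) hcont fun φ hφ => ?_
    have hφ' := interior_subset hφ
    rw [(hderiv φ (hsub hφ')).deriv]
    refine lt_of_lt_of_le ?_ (le_flightTimeDeriv hμ hδ0 hδ hσ (hsub hφ') (hcosle φ hφ'))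
    have := Real.sin_pos_of_mem_Ioo (hsub hφ')
    positivity
  have hmem : ∀ φ ∈ Ioo 0 Real.pi, flightTime μ σ ρ φ = t → φ ∈ Ico φ₀ Real.pi := by
    intro φ hφ h
    refine ⟨?_, hφ.2⟩
    by_contra hlt
    have h1 : -(1 - κ) ≤ Real.cos φ := by
      rw [← hcos₀]
      exact Real.cos_le_cos_of_nonneg_of_le_pi hφ.1.le hφ₀π.le (not_le.mp hlt).le
    have h2 := flightTime_le_of_cos_ge hμ hδ0 hδ hσ hφ hκ0 (by linarith) h1
    linarith
  refine ⟨?_, ?_, ?_⟩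
  · set Y := Real.sqrt (δ / (2 * μ)) with hY
    have hYp : 0 < Y := Real.sqrt_pos.mpr (by positivity)
    have ht0 : 0 < t := lt_of_le_of_lt (by positivity) ht1
    -- If `sin³ φ₁ ≤ m`, the main term is at least `δ / m = t / Y + C`; the `C` absorbs `2ρ ≥ -C`,
    -- and the factor `Y` leaves at least `t`.
    set m := δ / (t / Y + C) with hm
    have hmp : 0 < m := by positivity
    set φ₁ := max φ₀ (Real.pi - min 1 m) with hφ₁
    have hmin : 0 < min 1 m := lt_min one_pos hmp
    have hmem₁ : φ₁ ∈ Ico φ₀ Real.pi := ⟨le_max_left _ _, max_lt hφ₀π (by linarith)⟩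
    have hs := Real.sin_pos_of_mem_Ioo (hsub hmem₁)
    have hsm : Real.sin φ₁ ≤ m := by
      rw [← Real.sin_pi_sub]
      refine (Real.sin_le (by linarith [hmem₁.2])).trans ?_
      linarith [le_max_right φ₀ (Real.pi - min 1 m), min_le_right 1 m]
    have hs3 : Real.sin φ₁ ^ 3 ≤ m := by
      refine le_trans ?_ hsm
      calc Real.sin φ₁ ^ 3 = Real.sin φ₁ * Real.sin φ₁ ^ 2 := by ring
        _ ≤ Real.sin φ₁ * 1 := by gcongr; exact Real.sin_sq_le_one φ₁
        _ = _ := mul_one _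
    have hlarge : t ≤ flightTime μ σ ρ φ₁ := by
      have h1 : 1 ≤ φ₁ - Real.sin φ₁ * Real.cos φ₁ := by
        have hc := hcosle φ₁ hmem₁
        have h2 : Real.pi / 2 ≤ φ₁ := by
          by_contra h
          have := Real.cos_nonneg_of_mem_Icc (x := φ₁)
            ⟨by linarith [(hsub hmem₁).1, Real.pi_pos], by linarith⟩
          linarith
        have := Real.pi_gt_three
        nlinarith
      have h2 : t / Y + C ≤ δ / Real.sin φ₁ ^ 3 := by
        rw [le_div_iff₀ (by positivity)]
        calc (t / Y + C) * Real.sin φ₁ ^ 3 ≤ (t / Y + C) * m := by gcongr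
          _ = δ := by rw [hm]; field_simp
      have h3 : δ / Real.sin φ₁ ^ 3 ≤ chordParam σ ρ φ₁ *
          ((φ₁ - Real.sin φ₁ * Real.cos φ₁) / Real.sin φ₁ ^ 3) := by
        rw [← mul_div_assoc]
        gcongr
        nlinarith [le_chordParam hδ φ₁]
      have h4 : -C ≤ 2 * ρ := by linarith [neg_abs_le ρ]
      have h5 : 0 ≤ t / Y := by positivity
      calc t = Y * (t / Y) := by field_simp
        _ ≤ flightTime μ σ ρ φ₁ := by
          rw [flightTime]
          refine mul_le_mul (Real.sqrt_le_sqrt ?_) (by linarith) h5 (Real.sqrt_nonneg _)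
          have := le_chordParam hδ φ₁
          gcongr
    have hsmall : flightTime μ σ ρ φ₀ ≤ t :=
      (flightTime_le_of_cos_ge hμ hδ0 hδ hσ ⟨hφ₀0, hφ₀π⟩ hκ0 (by linarith) hcos₀.ge).trans ht1.le
    obtain ⟨φ, hφ, h⟩ := intermediate_value_Icc hmem₁.1
      (hcont.mono fun x hx => ⟨hx.1, hx.2.trans_lt hmem₁.2⟩) ⟨hsmall, hlarge⟩
    exact ⟨φ, hsub ⟨hφ.1, hφ.2.trans_lt hmem₁.2⟩, h⟩
  · intro φ hφ φ' hφ' h h'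
    exact hmono.injOn (hmem φ hφ h) (hmem φ' hφ' h') (h.trans h'.symm)
  · intro φ hφ h
    have hs := Real.sin_pos_of_mem_Ioo hφ
    refine ⟨?_, le_flightTimeDeriv hμ hδ0 hδ hσ hφ (hcosle φ (hmem φ hφ h))⟩
    by_contra hle
    have h1 := flightTime_le_div hμ hδ0 hδ hσ hφ
    have h2 : 11 * C * Real.sqrt (C / μ) / Real.sin φ ^ 3 ≤
        11 * C * Real.sqrt (C / μ) / s₀ ^ 3 := by
      gcongr
      exact not_lt.mp hle
    linarith

end FlightTime

/-! ### Bounds on the end-point data, vis-viva, and velocity rates in the phase -/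

section Geometry

variable {V : Type*} [NormedAddCommGroup V] [InnerProductSpace ℝ V]
  {d : TransferType} {r₁ r₂ : V} {μ φ δ C η a b : ℝ}

theorem TransferType.sign_sq (d : TransferType) : d.sign ^ 2 = 1 := by
  rcases d with _ | _ <;> norm_num [TransferType.sign]

theorem meanCos_sq (d : TransferType) (r₁ r₂ : V) :
    meanCos d r₁ r₂ ^ 2 = (‖r₁‖ * ‖r₂‖ + inner ℝ r₁ r₂) / 2 := by
  rw [meanCos, mul_pow, d.sign_sq, one_mul, Real.sq_sqrt]
  linarith [neg_le_of_abs_le (abs_real_inner_le_norm r₁ r₂)]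

/-- The sine of the angle between `r₁` and `r₂` bounds the transfer away from degeneracy. -/
theorem le_sub_two_mul_abs_meanCos (ha : 0 < a) (ha₁ : a ≤ ‖r₁‖) (ha₂ : a ≤ ‖r₂‖)
    (hb₁ : ‖r₁‖ ≤ b) (hb₂ : ‖r₂‖ ≤ b) (hη0 : 0 ≤ η)
    (hη : η ≤ Real.sin (InnerProductGeometry.angle r₁ r₂)) (d : TransferType) :
    a ^ 2 * η ^ 2 / (4 * b) ≤ ‖r₁‖ + ‖r₂‖ - 2 * |meanCos d r₁ r₂| := by
  have hb : 0 < b := by linarith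
  have h1 := meanCos_sq d r₁ r₂
  have h2 : inner ℝ r₁ r₂ = ‖r₁‖ * ‖r₂‖ * Real.cos (InnerProductGeometry.angle r₁ r₂) := by
    rw [mul_comm, InnerProductGeometry.cos_angle_mul_norm_mul_norm]
  set c := Real.cos (InnerProductGeometry.angle r₁ r₂)
  set s := Real.sin (InnerProductGeometry.angle r₁ r₂)
  have hcs : s ^ 2 + c ^ 2 = 1 := Real.sin_sq_add_cos_sq _
  have hc1 : c ≤ 1 := Real.cos_le_one _
  have hc0 : -1 ≤ c := Real.neg_one_le_cos _
  have hprod : a ^ 2 ≤ ‖r₁‖ * ‖r₂‖ := by nlinarith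
  have hsη : η ^ 2 ≤ s ^ 2 := by gcongr
  rw [← sq_abs, h2] at h1
  set ρ := |meanCos d r₁ r₂|
  have hρ0 : 0 ≤ ρ := abs_nonneg _
  -- By the law of cosines the right side is the squared chord, at least `2‖r₁‖‖r₂‖(1 - c) ≥
  -- ‖r₁‖‖r₂‖s²`. Division by `‖r₁‖ + ‖r₂‖ + 2ρ ≤ 4b` finishes the proof.
  have h3 : a ^ 2 * η ^ 2 ≤ (‖r₁‖ + ‖r₂‖) ^ 2 - 4 * ρ ^ 2 := by
    have h4 : a ^ 2 * η ^ 2 ≤ ‖r₁‖ * ‖r₂‖ * s ^ 2 := by gcongr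
    have h5 : ‖r₁‖ * ‖r₂‖ * s ^ 2 ≤ ‖r₁‖ * ‖r₂‖ * (2 * (1 - c)) := by
      gcongr
      nlinarith
    nlinarith [sq_nonneg (‖r₁‖ - ‖r₂‖)]
  have h6 : 0 ≤ a ^ 2 * η ^ 2 := by positivity
  have h7 : 2 * ρ ≤ ‖r₁‖ + ‖r₂‖ := by
    by_contra h
    nlinarith [norm_nonneg r₁, norm_nonneg r₂]
  rw [div_le_iff₀ (by positivity)]
  nlinarith

/-- A positive sine excludes opposite directions, where the transfer plane is undetermined,
`meanCos` vanishes and its square root is not differentiable. -/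
theorem norm_mul_add_inner_pos (h₁ : r₁ ≠ 0) (h₂ : r₂ ≠ 0)
    (hs : 0 < Real.sin (InnerProductGeometry.angle r₁ r₂)) :
    0 < ‖r₁‖ * ‖r₂‖ + inner ℝ r₁ r₂ := by
  have n₁ := norm_pos_iff.mpr h₁
  have n₂ := norm_pos_iff.mpr h₂
  rw [← InnerProductGeometry.cos_angle_mul_norm_mul_norm r₁ r₂]
  have hc : -1 < Real.cos (InnerProductGeometry.angle r₁ r₂) := by
    refine lt_of_le_of_ne (Real.neg_one_le_cos _) fun h => ?_
    have := Real.sin_sq_add_cos_sq (InnerProductGeometry.angle r₁ r₂)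
    rw [← h] at this
    nlinarith
  nlinarith [mul_pos n₁ n₂]

theorem meanCos_ne_zero (h : 0 < ‖r₁‖ * ‖r₂‖ + inner ℝ r₁ r₂) : meanCos d r₁ r₂ ≠ 0 := by
  have := meanCos_sq d r₁ r₂
  intro h0
  rw [h0] at this
  linarith

theorem norm_bisector_sq (hρ : meanCos d r₁ r₂ ≠ 0) :
    ‖bisector d r₁ r₂‖ ^ 2 = ‖r₁‖ * ‖r₂‖ := by
  have h1 := meanCos_sq d r₁ r₂
  rw [bisector, norm_smul, mul_pow, norm_add_sq_real, norm_smul, norm_smul, inner_smul_left,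
    inner_smul_right, Real.norm_eq_abs, sq_abs, norm_norm, norm_norm]
  simp only [conj_trivial]
  have h2 : inner ℝ r₁ r₂ = 2 * meanCos d r₁ r₂ ^ 2 - ‖r₁‖ * ‖r₂‖ := by linarith
  rw [h2]
  field_simp
  ring

theorem inner_bisector_left (hρ : meanCos d r₁ r₂ ≠ 0) :
    inner ℝ (bisector d r₁ r₂) r₁ = ‖r₁‖ * meanCos d r₁ r₂ := by
  have h1 := meanCos_sq d r₁ r₂
  rw [bisector, inner_smul_left, inner_add_left, inner_smul_left, inner_smul_left,
    real_inner_self_eq_norm_sq, real_inner_comm]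
  simp only [conj_trivial]
  field_simp
  linear_combination -2 * ‖r₁‖ * h1

theorem inner_bisector_right (hρ : meanCos d r₁ r₂ ≠ 0) :
    inner ℝ (bisector d r₁ r₂) r₂ = ‖r₂‖ * meanCos d r₁ r₂ := by
  have h1 := meanCos_sq d r₁ r₂
  rw [bisector, inner_smul_left, inner_add_left, inner_smul_left, inner_smul_left,
    real_inner_self_eq_norm_sq]
  simp only [conj_trivial]
  field_simp
  linear_combination -2 * ‖r₂‖ * h1

/-- The vis-viva equation at departure. -/
theorem norm_arcV₁_sq (hμ : 0 < μ) (h₁ : r₁ ≠ 0) (hρ : meanCos d r₁ r₂ ≠ 0)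
    (hy : 0 < chordParam (‖r₁‖ + ‖r₂‖) (meanCos d r₁ r₂) φ) :
    ‖arcV₁ μ d r₁ r₂ φ‖ ^ 2 = 2 * μ / ‖r₁‖ -
      2 * μ * Real.sin φ ^ 2 / chordParam (‖r₁‖ + ‖r₂‖) (meanCos d r₁ r₂) φ := by
  have n₁ := norm_pos_iff.mpr h₁
  rw [arcV₁, norm_smul, mul_pow, norm_sub_sq_real, norm_bisector_sq hρ, inner_smul_right,
    inner_bisector_left hρ, norm_smul, Real.norm_eq_abs, Real.norm_eq_abs, sq_abs, div_pow,
    Real.sq_sqrt (by positivity), mul_pow, sq_abs, Real.cos_sq']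
  field_simp
  rw [chordParam]
  ring

/-- The vis-viva equation at arrival. -/
theorem norm_arcV₂_sq (hμ : 0 < μ) (h₂ : r₂ ≠ 0) (hρ : meanCos d r₁ r₂ ≠ 0)
    (hy : 0 < chordParam (‖r₁‖ + ‖r₂‖) (meanCos d r₁ r₂) φ) :
    ‖arcV₂ μ d r₁ r₂ φ‖ ^ 2 = 2 * μ / ‖r₂‖ -
      2 * μ * Real.sin φ ^ 2 / chordParam (‖r₁‖ + ‖r₂‖) (meanCos d r₁ r₂) φ := by
  have n₂ := norm_pos_iff.mpr h₂
  rw [arcV₂, norm_smul, mul_pow, norm_sub_rev, norm_sub_sq_real, norm_bisector_sq hρ,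
    inner_smul_right, inner_bisector_right hρ, norm_smul, Real.norm_eq_abs, Real.norm_eq_abs,
    sq_abs, div_pow, Real.sq_sqrt (by positivity), mul_pow, sq_abs, Real.cos_sq']
  field_simp
  rw [chordParam]
  ring

theorem hasDerivAt_sqrt_div_chordParam {σ ρ : ℝ} (hμ : 0 < μ) (hy : 0 < chordParam σ ρ φ) :
    HasDerivAt (fun φ => Real.sqrt (2 * μ / chordParam σ ρ φ))
      (-(Real.sqrt (2 * μ / chordParam σ ρ φ) * (ρ * Real.sin φ / chordParam σ ρ φ))) φ := by
  have hq : 0 < 2 * μ / chordParam σ ρ φ := by positivity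
  refine (((hasDerivAt_const φ (2 * μ)).fun_div (hasDerivAt_chordParam σ ρ φ) hy.ne').sqrt
    hq.ne').congr_deriv ?_
  set S := Real.sqrt (2 * μ / chordParam σ ρ φ) with hS
  have hSp : 0 < S := Real.sqrt_pos.mpr hq
  have hS2 : S ^ 2 = 2 * μ / chordParam σ ρ φ := Real.sq_sqrt hq.le
  field_simp
  rw [hS2]
  field_simp
  ring

/-- The bound on the rate of change of the velocities with the phase. -/
noncomputable def arcRateBound (μ δ a b : ℝ) : ℝ :=
  Real.sqrt (2 * μ / δ) * (b / δ * (2 * b / a) + 1)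

/-- The common estimate for both velocities: the first summand comes from differentiating the square
root, the second from differentiating `cos φ`. -/
theorem norm_rate_le {σ ρ c r : ℝ} {x y : V} (hμ : 0 < μ) (hδ0 : 0 < δ)
    (hδ : δ ≤ chordParam σ ρ φ) (ha : 0 < a) (hb : 0 < b) (hρ : |ρ| ≤ b) (hr : a ≤ r)
    (hx : ‖x‖ ≤ 2 * b) (hy : ‖y‖ ≤ r) (hc : |c| ≤ 1) :
    ‖(-(Real.sqrt (2 * μ / chordParam σ ρ φ) * (ρ * Real.sin φ / chordParam σ ρ φ)) / r) • x +
      (Real.sqrt (2 * μ / chordParam σ ρ φ) / r) • (c • y)‖ ≤ arcRateBound μ δ a b := by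
  have hr0 : 0 < r := ha.trans_le hr
  set q := Real.sqrt (2 * μ / chordParam σ ρ φ) with hq
  have hq0 : 0 ≤ q := Real.sqrt_nonneg _
  have hqle : q ≤ Real.sqrt (2 * μ / δ) := Real.sqrt_le_sqrt (by gcongr)
  have hY : 0 < chordParam σ ρ φ := hδ0.trans_le hδ
  have h1 : |ρ * Real.sin φ / chordParam σ ρ φ| ≤ b / δ := by
    rw [abs_div, abs_of_pos hY, abs_mul]
    calc |ρ| * |Real.sin φ| / chordParam σ ρ φ ≤ b * 1 / δ := by
          gcongr
          exact Real.abs_sin_le_one φ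
      _ = b / δ := by rw [mul_one]
  have h2 : ‖(-(q * (ρ * Real.sin φ / chordParam σ ρ φ)) / r) • x‖ ≤ q * (b / δ * (2 * b / a)) := by
    rw [norm_smul, Real.norm_eq_abs, abs_div, abs_neg, abs_mul, abs_of_nonneg hq0, abs_of_pos hr0]
    calc q * |ρ * Real.sin φ / chordParam σ ρ φ| / r * ‖x‖ ≤ q * (b / δ) / a * (2 * b) := by
          gcongr
      _ = q * (b / δ * (2 * b / a)) := by ring
  have h3 : ‖(q / r) • (c • y)‖ ≤ q := by
    rw [norm_smul, norm_smul, Real.norm_eq_abs, Real.norm_eq_abs, abs_div, abs_of_nonneg hq0,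
      abs_of_pos hr0]
    calc q / r * (|c| * ‖y‖) ≤ q / r * (1 * r) := by gcongr
      _ = q := by field_simp
  calc _ ≤ q * (b / δ * (2 * b / a)) + q := (norm_add_le _ _).trans (add_le_add h2 h3)
    _ = q * (b / δ * (2 * b / a) + 1) := by ring
    _ ≤ arcRateBound μ δ a b := by
      rw [arcRateBound]
      gcongr

theorem norm_bisector_le (hρ : meanCos d r₁ r₂ ≠ 0) (hb₁ : ‖r₁‖ ≤ b) (hb₂ : ‖r₂‖ ≤ b) :
    ‖bisector d r₁ r₂‖ ≤ b := by
  have hb : 0 ≤ b := (norm_nonneg _).trans hb₁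
  rw [← sq_le_sq₀ (norm_nonneg _) hb, norm_bisector_sq hρ, sq]
  gcongr

theorem abs_meanCos_le (hb₁ : ‖r₁‖ ≤ b) (hb₂ : ‖r₂‖ ≤ b) : |meanCos d r₁ r₂| ≤ b := by
  have hb : 0 ≤ b := (norm_nonneg _).trans hb₁
  rw [← sq_le_sq₀ (abs_nonneg _) hb, sq_abs, meanCos_sq]
  have h1 : ‖r₁‖ * ‖r₂‖ ≤ b * b := by gcongr
  linarith [real_inner_le_norm r₁ r₂]

theorem exists_hasDerivAt_arcV₁ (hμ : 0 < μ) (hδ0 : 0 < δ)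
    (hδ : δ ≤ chordParam (‖r₁‖ + ‖r₂‖) (meanCos d r₁ r₂) φ) (hρ : meanCos d r₁ r₂ ≠ 0)
    (ha : 0 < a) (ha₁ : a ≤ ‖r₁‖) (hb₁ : ‖r₁‖ ≤ b) (hb₂ : ‖r₂‖ ≤ b) :
    ∃ D, HasDerivAt (arcV₁ μ d r₁ r₂) D φ ∧ ‖D‖ ≤ arcRateBound μ δ a b := by
  have hY := hδ0.trans_le hδ
  have h := ((hasDerivAt_sqrt_div_chordParam hμ hY).div_const ‖r₁‖).fun_smul
    (((Real.hasDerivAt_cos φ).smul_const r₁).const_sub (bisector d r₁ r₂))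
  refine ⟨_, h, ?_⟩
  rw [add_comm, ← neg_smul, neg_neg]
  refine norm_rate_le hμ hδ0 hδ ha (by linarith) (abs_meanCos_le hb₁ hb₂) ha₁ ?_ le_rfl
    (Real.abs_sin_le_one φ)
  refine (norm_sub_le _ _).trans ?_
  rw [norm_smul, Real.norm_eq_abs]
  have := mul_le_mul (Real.abs_cos_le_one φ) hb₁ (norm_nonneg _) zero_le_one
  linarith [norm_bisector_le hρ hb₁ hb₂]

theorem exists_hasDerivAt_arcV₂ (hμ : 0 < μ) (hδ0 : 0 < δ)
    (hδ : δ ≤ chordParam (‖r₁‖ + ‖r₂‖) (meanCos d r₁ r₂) φ) (hρ : meanCos d r₁ r₂ ≠ 0)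
    (ha : 0 < a) (ha₂ : a ≤ ‖r₂‖) (hb₁ : ‖r₁‖ ≤ b) (hb₂ : ‖r₂‖ ≤ b) :
    ∃ D, HasDerivAt (arcV₂ μ d r₁ r₂) D φ ∧ ‖D‖ ≤ arcRateBound μ δ a b := by
  have hY := hδ0.trans_le hδ
  have h := ((hasDerivAt_sqrt_div_chordParam hμ hY).div_const ‖r₂‖).fun_smul
    (((Real.hasDerivAt_cos φ).smul_const r₂).sub_const (bisector d r₁ r₂))
  refine ⟨_, h, ?_⟩
  rw [add_comm]
  refine norm_rate_le hμ hδ0 hδ ha (by linarith) (abs_meanCos_le hb₁ hb₂) ha₂ ?_ le_rfl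
    (by rw [abs_neg]; exact Real.abs_sin_le_one φ)
  refine (norm_sub_le _ _).trans ?_
  rw [norm_smul, Real.norm_eq_abs]
  have := mul_le_mul (Real.abs_cos_le_one φ) hb₂ (norm_nonneg _) zero_le_one
  linarith [norm_bisector_le hρ hb₁ hb₂]

end Geometry

/-! ### Differentiability of the phase in the end points and the time -/

section Smoothness

variable {d : TransferType} {μ φ t : ℝ} {r₁ r₂ : E3}

theorem contDiffAt_meanCos {p : (E3 × E3 × ℝ) × ℝ} (h₁ : p.1.1 ≠ 0) (h₂ : p.1.2.1 ≠ 0)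
    (hpos : 0 < ‖p.1.1‖ * ‖p.1.2.1‖ + inner ℝ p.1.1 p.1.2.1) :
    ContDiffAt ℝ 1 (fun p : (E3 × E3 × ℝ) × ℝ => meanCos d p.1.1 p.1.2.1) p := by
  have c1 : ContDiffAt ℝ 1 (fun p : (E3 × E3 × ℝ) × ℝ => p.1.1) p := by fun_prop
  have c2 : ContDiffAt ℝ 1 (fun p : (E3 × E3 × ℝ) × ℝ => p.1.2.1) p := by fun_prop
  exact contDiffAt_const.mul (((((c1.norm ℝ h₁).mul (c2.norm ℝ h₂)).add
    (c1.inner ℝ c2)).div_const 2).sqrt (by positivity))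

theorem contDiffAt_chordParam {p : (E3 × E3 × ℝ) × ℝ} (h₁ : p.1.1 ≠ 0) (h₂ : p.1.2.1 ≠ 0)
    (hpos : 0 < ‖p.1.1‖ * ‖p.1.2.1‖ + inner ℝ p.1.1 p.1.2.1) :
    ContDiffAt ℝ 1 (fun p : (E3 × E3 × ℝ) × ℝ =>
      chordParam (‖p.1.1‖ + ‖p.1.2.1‖) (meanCos d p.1.1 p.1.2.1) p.2) p := by
  have c1 : ContDiffAt ℝ 1 (fun p : (E3 × E3 × ℝ) × ℝ => p.1.1) p := by fun_prop
  have c2 : ContDiffAt ℝ 1 (fun p : (E3 × E3 × ℝ) × ℝ => p.1.2.1) p := by fun_prop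
  have c3 : ContDiffAt ℝ 1 (fun p : (E3 × E3 × ℝ) × ℝ => Real.cos p.2) p := by fun_prop
  exact ((c1.norm ℝ h₁).add (c2.norm ℝ h₂)).sub
    ((contDiffAt_const.mul (contDiffAt_meanCos h₁ h₂ hpos)).mul c3)

theorem contDiffAt_flightTime {p : (E3 × E3 × ℝ) × ℝ} (hμ : 0 < μ) (h₁ : p.1.1 ≠ 0)
    (h₂ : p.1.2.1 ≠ 0) (hpos : 0 < ‖p.1.1‖ * ‖p.1.2.1‖ + inner ℝ p.1.1 p.1.2.1)
    (hφ : p.2 ∈ Ioo 0 Real.pi)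
    (hy : 0 < chordParam (‖p.1.1‖ + ‖p.1.2.1‖) (meanCos d p.1.1 p.1.2.1) p.2) :
    ContDiffAt ℝ 1 (fun p : (E3 × E3 × ℝ) × ℝ =>
      flightTime μ (‖p.1.1‖ + ‖p.1.2.1‖) (meanCos d p.1.1 p.1.2.1) p.2) p := by
  have hs := Real.sin_pos_of_mem_Ioo hφ
  have cy := contDiffAt_chordParam (d := d) h₁ h₂ hpos
  have cn : ContDiffAt ℝ 1 (fun p : (E3 × E3 × ℝ) × ℝ =>
    p.2 - Real.sin p.2 * Real.cos p.2) p := by fun_prop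
  have cs : ContDiffAt ℝ 1 (fun p : (E3 × E3 × ℝ) × ℝ => Real.sin p.2 ^ 3) p := by fun_prop
  exact ((cy.div_const (2 * μ)).sqrt (by positivity)).mul
    ((cy.mul (cn.div cs (by positivity))).add
      (contDiffAt_const.mul (contDiffAt_meanCos h₁ h₂ hpos)))

theorem contDiffAt_bisector {p : (E3 × E3 × ℝ) × ℝ} (h₁ : p.1.1 ≠ 0) (h₂ : p.1.2.1 ≠ 0)
    (hpos : 0 < ‖p.1.1‖ * ‖p.1.2.1‖ + inner ℝ p.1.1 p.1.2.1) :
    ContDiffAt ℝ 1 (fun p : (E3 × E3 × ℝ) × ℝ => bisector d p.1.1 p.1.2.1) p := by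
  have c1 : ContDiffAt ℝ 1 (fun p : (E3 × E3 × ℝ) × ℝ => p.1.1) p := by fun_prop
  have c2 : ContDiffAt ℝ 1 (fun p : (E3 × E3 × ℝ) × ℝ => p.1.2.1) p := by fun_prop
  exact (contDiffAt_const.div (contDiffAt_const.mul (contDiffAt_meanCos h₁ h₂ hpos))
    (mul_ne_zero two_ne_zero (meanCos_ne_zero hpos))).smul
    (((c2.norm ℝ h₂).smul c1).add ((c1.norm ℝ h₁).smul c2))

theorem contDiffAt_arcV₁ {p : (E3 × E3 × ℝ) × ℝ} (hμ : 0 < μ) (h₁ : p.1.1 ≠ 0)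
    (h₂ : p.1.2.1 ≠ 0) (hpos : 0 < ‖p.1.1‖ * ‖p.1.2.1‖ + inner ℝ p.1.1 p.1.2.1)
    (hy : 0 < chordParam (‖p.1.1‖ + ‖p.1.2.1‖) (meanCos d p.1.1 p.1.2.1) p.2) :
    ContDiffAt ℝ 1 (fun p : (E3 × E3 × ℝ) × ℝ => arcV₁ μ d p.1.1 p.1.2.1 p.2) p := by
  have c1 : ContDiffAt ℝ 1 (fun p : (E3 × E3 × ℝ) × ℝ => p.1.1) p := by fun_prop
  have c3 : ContDiffAt ℝ 1 (fun p : (E3 × E3 × ℝ) × ℝ => Real.cos p.2) p := by fun_prop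
  exact (((contDiffAt_const.div (contDiffAt_chordParam h₁ h₂ hpos) hy.ne').sqrt
    (div_pos (mul_pos two_pos hμ) hy).ne').div (c1.norm ℝ h₁) (norm_ne_zero_iff.mpr h₁)).smul
    ((contDiffAt_bisector h₁ h₂ hpos).sub (c3.smul c1))

theorem contDiffAt_arcV₂ {p : (E3 × E3 × ℝ) × ℝ} (hμ : 0 < μ) (h₁ : p.1.1 ≠ 0)
    (h₂ : p.1.2.1 ≠ 0) (hpos : 0 < ‖p.1.1‖ * ‖p.1.2.1‖ + inner ℝ p.1.1 p.1.2.1)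
    (hy : 0 < chordParam (‖p.1.1‖ + ‖p.1.2.1‖) (meanCos d p.1.1 p.1.2.1) p.2) :
    ContDiffAt ℝ 1 (fun p : (E3 × E3 × ℝ) × ℝ => arcV₂ μ d p.1.1 p.1.2.1 p.2) p := by
  have c2 : ContDiffAt ℝ 1 (fun p : (E3 × E3 × ℝ) × ℝ => p.1.2.1) p := by fun_prop
  have c3 : ContDiffAt ℝ 1 (fun p : (E3 × E3 × ℝ) × ℝ => Real.cos p.2) p := by fun_prop
  exact (((contDiffAt_const.div (contDiffAt_chordParam h₁ h₂ hpos) hy.ne').sqrt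
    (div_pos (mul_pos two_pos hμ) hy).ne').div (c2.norm ℝ h₂) (norm_ne_zero_iff.mpr h₂)).smul
    ((c3.smul c2).sub (contDiffAt_bisector h₁ h₂ hpos))

/-- By the implicit function theorem, the phase is a differentiable function of the end points and
the time of flight. -/
theorem exists_phase_function (hμ : 0 < μ) (h₁ : r₁ ≠ 0) (h₂ : r₂ ≠ 0)
    (hpos : 0 < ‖r₁‖ * ‖r₂‖ + inner ℝ r₁ r₂) (hφ : φ ∈ Ioo 0 Real.pi)
    (hy : 0 < chordParam (‖r₁‖ + ‖r₂‖) (meanCos d r₁ r₂) φ)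
    (ht : flightTime μ (‖r₁‖ + ‖r₂‖) (meanCos d r₁ r₂) φ = t)
    (hD : flightTimeDeriv μ (‖r₁‖ + ‖r₂‖) (meanCos d r₁ r₂) φ ≠ 0) :
    ∃ ψ : E3 × E3 × ℝ → ℝ, DifferentiableAt ℝ ψ (r₁, r₂, t) ∧ ψ (r₁, r₂, t) = φ ∧
      ∀ᶠ x in 𝓝 (r₁, r₂, t), ψ x ∈ Ioo 0 Real.pi ∧
        flightTime μ (‖x.1‖ + ‖x.2.1‖) (meanCos d x.1 x.2.1) (ψ x) = x.2.2 := by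
  set F : (E3 × E3 × ℝ) × ℝ → ℝ := fun p =>
    flightTime μ (‖p.1.1‖ + ‖p.1.2.1‖) (meanCos d p.1.1 p.1.2.1) p.2 - p.1.2.2 with hF
  have hcd : ContDiffAt ℝ 1 F ((r₁, r₂, t), φ) :=
    (contDiffAt_flightTime (p := ((r₁, r₂, t), φ)) hμ h₁ h₂ hpos hφ hy).sub (by fun_prop)
  have hstrict := hcd.hasStrictFDerivAt (by simp)
  set F' := fderiv ℝ F ((r₁, r₂, t), φ) with hF'
  -- The partial derivative in the phase is nonzero, as the implicit function theorem requires.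
  have hpart : F' (0, 1) = flightTimeDeriv μ (‖r₁‖ + ‖r₂‖) (meanCos d r₁ r₂) φ := by
    have e1 : HasDerivAt (fun s : ℝ => (((r₁, r₂, t), s) : (E3 × E3 × ℝ) × ℝ)) (0, 1) φ :=
      (hasDerivAt_const φ (r₁, r₂, t)).prodMk (hasDerivAt_id φ)
    have e2 := hstrict.hasFDerivAt.comp_hasDerivAt φ e1
    have e3 := (hasDerivAt_flightTime hμ hy hφ).sub_const t
    exact e2.unique e3
  have hinv : (F' ∘L .inr ℝ (E3 × E3 × ℝ) ℝ).IsInvertible := by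
    refine ⟨ContinuousLinearEquiv.unitsEquivAut ℝ (Units.mk0 _ (hpart ▸ hD)), ?_⟩
    ext
    simp
  have hF0 : F ((r₁, r₂, t), φ) = 0 := by
    rw [hF]
    simp [ht]
  refine ⟨hstrict.implicitFunctionOfProdDomain hinv,
    (hstrict.hasStrictFDerivAt_implicitFunctionOfProdDomain hinv).hasFDerivAt.differentiableAt,
    (hstrict.eventually_apply_eq_iff_implicitFunctionOfProdDomain hinv).self_of_nhds.mp rfl, ?_⟩
  filter_upwards [hstrict.eventually_apply_implicitFunctionOfProdDomain hinv,
    (hstrict.tendsto_implicitFunctionOfProdDomain hinv).eventually (Ioo_mem_nhds hφ.1 hφ.2)]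
    with x hx1 hx2
  rw [hF0] at hx1
  exact ⟨hx2, sub_eq_zero.mp hx1⟩

end Smoothness

/-! ### Uniqueness and regularity of long Lambert arcs -/

/-- For long times of flight, the Lambert problem is solved by exactly one arc, given by a phase
close to `π`. -/
theorem exists_phase_of_le {μ a b η s₀ : ℝ} (hμ : 0 < μ) (d : TransferType) (ha : 0 < a)
    (hb : 0 < b) (hη : 0 < η) (hs₀ : 0 < s₀) :
    ∃ t₁, 0 < t₁ ∧ ∀ (r₁ r₂ : E3) (t : ℝ), a ≤ ‖r₁‖ → a ≤ ‖r₂‖ → ‖r₁‖ ≤ b → ‖r₂‖ ≤ b →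
      η ≤ Real.sin (InnerProductGeometry.angle r₁ r₂) → t₁ < t →
      ∃ φ ∈ Ioo 0 Real.pi, flightTime μ (‖r₁‖ + ‖r₂‖) (meanCos d r₁ r₂) φ = t ∧
        Real.sin φ < s₀ ∧
        3 * (a ^ 2 * η ^ 2 / (4 * b)) / 2 * Real.sqrt (a ^ 2 * η ^ 2 / (4 * b) / (2 * μ)) /
          Real.sin φ ^ 4 ≤ flightTimeDeriv μ (‖r₁‖ + ‖r₂‖) (meanCos d r₁ r₂) φ ∧
        (∀ φ' ∈ Ioo 0 Real.pi,
          flightTime μ (‖r₁‖ + ‖r₂‖) (meanCos d r₁ r₂) φ' = t → φ' = φ) ∧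
        ∀ w, IsLambertVelocities μ d r₁ r₂ t w ↔ w = (arcV₁ μ d r₁ r₂ φ, arcV₂ μ d r₁ r₂ φ) := by
  have hδ0 : 0 < a ^ 2 * η ^ 2 / (4 * b) := by positivity
  obtain ⟨t₁, ht₁⟩ := exists_unique_phase hμ hδ0 (2 * b) hs₀
  -- The summand `1` turns the lower bound on `t` into one on `t²`, which excludes nonnegative
  -- energy.
  refine ⟨max t₁ (1 + 4 * b ^ 3 / μ), lt_max_of_lt_right (by positivity),
    fun r₁ r₂ t ha₁ ha₂ hb₁ hb₂ hs ht => ?_⟩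
  obtain ⟨hta, htb⟩ := max_lt_iff.mp ht
  have hδ := le_sub_two_mul_abs_meanCos ha ha₁ ha₂ hb₁ hb₂ hη.le hs d
  obtain ⟨⟨φ, hφ, hφt⟩, huniq, hlast⟩ := ht₁ _ _ t hδ (by linarith) hta
  have hsq : 4 * b ^ 3 / μ < t ^ 2 := by
    have : 0 < 4 * b ^ 3 / μ := by positivity
    nlinarith
  have hne₁ : r₁ ≠ 0 := norm_pos_iff.mp (ha.trans_le ha₁)
  have hne₂ : r₂ ≠ 0 := norm_pos_iff.mp (ha.trans_le ha₂)
  have hform : ∀ w, IsLambertVelocities μ d r₁ r₂ t w →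
      w = (arcV₁ μ d r₁ r₂ φ, arcV₂ μ d r₁ r₂ φ) := by
    intro w hw
    obtain ⟨φ', hφ', h1, h2⟩ := hw.exists_anomaly hμ hb₁ hb₂ hsq
    rw [h2, huniq φ' hφ' φ hφ h1.symm hφt]
  refine ⟨φ, hφ, hφt, (hlast φ hφ hφt).1, (hlast φ hφ hφt).2,
    fun φ' hφ' h' => huniq φ' hφ' φ hφ h' hφt, fun w => ⟨hform w, ?_⟩⟩
  rintro rfl
  -- Some arc with time of flight `t` exists, and its velocities can only be those of the formula.
  obtain ⟨w, hw⟩ := exists_isLambertVelocities hμ d (hη.trans_le hs) hne₁ hne₂ hφ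
  rw [hφt] at hw
  rwa [← hform w hw]

theorem lambertVelocities_eq {μ t : ℝ} {d : TransferType} {r₁ r₂ : E3} {w₀ : E3 × E3}
    (h : ∀ w, IsLambertVelocities μ d r₁ r₂ t w ↔ w = w₀) :
    lambertVelocities μ d r₁ r₂ t = w₀ :=
  (h _).mp (Classical.epsilon_spec (p := fun w => IsLambertVelocities μ d r₁ r₂ t w)
    ⟨w₀, (h w₀).mpr rfl⟩)

/-- For long times of flight, the Lambert velocities are differentiable functions of the end points
and the time of flight, the latter dependence is weak, and the energy is close to zero. -/
theorem exists_lambert_regularity {μ a b η ε : ℝ} (hμ : 0 < μ) (d : TransferType) (ha : 0 < a)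
    (hb : 0 < b) (hη : 0 < η) (hε : 0 < ε) :
    ∃ t₁, 0 < t₁ ∧ ∀ (r₁ r₂ : E3) (t : ℝ), a ≤ ‖r₁‖ → a ≤ ‖r₂‖ → ‖r₁‖ ≤ b → ‖r₂‖ ≤ b →
      η ≤ Real.sin (InnerProductGeometry.angle r₁ r₂) → t₁ < t →
      (∃! w, IsLambertVelocities μ d r₁ r₂ t w) ∧
      DifferentiableAt ℝ (fun x : E3 × E3 × ℝ => lambertV₁ μ d x.1 x.2.1 x.2.2) (r₁, r₂, t) ∧
      DifferentiableAt ℝ (fun x : E3 × E3 × ℝ => lambertV₂ μ d x.1 x.2.1 x.2.2) (r₁, r₂, t) ∧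
      ‖deriv (lambertV₁ μ d r₁ r₂) t‖ < ε ∧ ‖deriv (lambertV₂ μ d r₁ r₂) t‖ < ε ∧
      2 * μ / ‖r₁‖ - ε < ‖lambertV₁ μ d r₁ r₂ t‖ ^ 2 ∧
      2 * μ / ‖r₂‖ - ε < ‖lambertV₂ μ d r₁ r₂ t‖ ^ 2 := by
  -- The constants belong to `a / 2`, `2b` and `η / 2`, so that the conclusions hold on a
  -- neighbourhood of the given data, as differentiation requires.
  set δ := (a / 2) ^ 2 * (η / 2) ^ 2 / (4 * (2 * b)) with hδdef
  have hδ0 : 0 < δ := by positivity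
  set c := 3 * δ / 2 * Real.sqrt (δ / (2 * μ)) with hc
  have hc0 : 0 < c := mul_pos (by positivity) (Real.sqrt_pos.mpr (by positivity))
  set K := arcRateBound μ δ (a / 2) (2 * b) with hK
  have hK0 : 0 < K := by
    rw [hK, arcRateBound]
    exact mul_pos (Real.sqrt_pos.mpr (by positivity)) (by positivity)
  -- The second entry makes the velocity rate `K sin⁴ φ / c` smaller than `ε`, the third the
  -- vis-viva defect `2μ sin² φ / δ`.
  set s₀ := min 1 (min (ε * c / K) (ε * δ / (2 * μ))) with hs₀
  have hs₀0 : 0 < s₀ := lt_min one_pos (lt_min (by positivity) (by positivity))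
  obtain ⟨t₁, ht₁0, ht₁⟩ := exists_phase_of_le hμ d (half_pos ha) (mul_pos two_pos hb)
    (half_pos hη) hs₀0
  refine ⟨t₁, ht₁0, fun r₁ r₂ t ha₁ ha₂ hb₁ hb₂ hs ht => ?_⟩
  obtain ⟨φ, hφ, hφt, hφs, hφD, -, hφw⟩ := ht₁ r₁ r₂ t (by linarith) (by linarith)
    (by linarith) (by linarith) (by linarith) ht
  have hne₁ : r₁ ≠ 0 := norm_pos_iff.mp (ha.trans_le ha₁)
  have hne₂ : r₂ ≠ 0 := norm_pos_iff.mp (ha.trans_le ha₂)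
  have hpos := norm_mul_add_inner_pos hne₁ hne₂ (hη.trans_le hs)
  have hρ : meanCos d r₁ r₂ ≠ 0 := meanCos_ne_zero hpos
  have hδ : δ ≤ chordParam (‖r₁‖ + ‖r₂‖) (meanCos d r₁ r₂) φ :=
    le_chordParam (le_sub_two_mul_abs_meanCos (half_pos ha) (by linarith) (by linarith)
      (by linarith) (by linarith) (half_pos hη).le (by linarith) d) φ
  have hy := hδ0.trans_le hδ
  have hsin := Real.sin_pos_of_mem_Ioo hφ
  have hDpos : 0 < flightTimeDeriv μ (‖r₁‖ + ‖r₂‖) (meanCos d r₁ r₂) φ :=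
    lt_of_lt_of_le (by positivity) hφD
  obtain ⟨ψ, hψd, hψφ, hψ⟩ := exists_phase_function hμ hne₁ hne₂ hpos hφ hy hφt hDpos.ne'
  -- the formula for the velocities persists near the given data
  have hev : ∀ᶠ x : E3 × E3 × ℝ in 𝓝 (r₁, r₂, t),
      lambertVelocities μ d x.1 x.2.1 x.2.2 =
        (arcV₁ μ d x.1 x.2.1 (ψ x), arcV₂ μ d x.1 x.2.1 (ψ x)) := by
    have n₁ : Tendsto (fun x : E3 × E3 × ℝ => ‖x.1‖) (𝓝 (r₁, r₂, t)) (𝓝 ‖r₁‖) :=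
      (continuous_fst.norm).tendsto (r₁, r₂, t)
    have n₂ : Tendsto (fun x : E3 × E3 × ℝ => ‖x.2.1‖) (𝓝 (r₁, r₂, t)) (𝓝 ‖r₂‖) :=
      (continuous_snd.fst.norm).tendsto (r₁, r₂, t)
    have n₃ : Tendsto (fun x : E3 × E3 × ℝ => x.2.2) (𝓝 (r₁, r₂, t)) (𝓝 t) :=
      (continuous_snd.snd).tendsto (r₁, r₂, t)
    have n₄ : Tendsto (fun x : E3 × E3 × ℝ => Real.sin (InnerProductGeometry.angle x.1 x.2.1))
        (𝓝 (r₁, r₂, t)) (𝓝 (Real.sin (InnerProductGeometry.angle r₁ r₂))) := by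
      have h1 : ContinuousAt (fun y : E3 × E3 => InnerProductGeometry.angle y.1 y.2) (r₁, r₂) :=
        InnerProductGeometry.continuousAt_angle hne₁ hne₂
      have h2 : ContinuousAt (fun x : E3 × E3 × ℝ => (x.1, x.2.1)) (r₁, r₂, t) := by fun_prop
      have h3 : ContinuousAt (fun x : E3 × E3 × ℝ => InnerProductGeometry.angle x.1 x.2.1)
          (r₁, r₂, t) :=
        ContinuousAt.comp (g := fun y : E3 × E3 => InnerProductGeometry.angle y.1 y.2)
          (f := fun x : E3 × E3 × ℝ => (x.1, x.2.1)) h1 h2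
      exact (Real.continuous_sin.tendsto _).comp h3
    filter_upwards [hψ, n₁.eventually_const_lt (show a / 2 < ‖r₁‖ by linarith),
      n₂.eventually_const_lt (show a / 2 < ‖r₂‖ by linarith),
      n₁.eventually_lt_const (show ‖r₁‖ < 2 * b by linarith),
      n₂.eventually_lt_const (show ‖r₂‖ < 2 * b by linarith),
      n₃.eventually_const_lt ht,
      n₄.eventually_const_lt (show η / 2 < _ by linarith)] with x hx x1 x2 x3 x4 x5 x6
    obtain ⟨φ', -, -, -, -, hu, hw⟩ := ht₁ x.1 x.2.1 x.2.2 x1.le x2.le x3.le x4.le x6.le x5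
    rw [lambertVelocities_eq hw, hu (ψ x) hx.1 hx.2]
  have hpair : HasFDerivAt (fun x : E3 × E3 × ℝ => (x, ψ x)) _ (r₁, r₂, t) :=
    (hasFDerivAt_id (r₁, r₂, t)).prodMk hψd.hasFDerivAt
  have hd₁ : DifferentiableAt ℝ (fun x : E3 × E3 × ℝ => lambertV₁ μ d x.1 x.2.1 x.2.2)
      (r₁, r₂, t) := by
    have h1 : DifferentiableAt ℝ
        (fun p : (E3 × E3 × ℝ) × ℝ => arcV₁ μ d p.1.1 p.1.2.1 p.2)
        ((r₁, r₂, t), ψ (r₁, r₂, t)) := by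
      rw [hψφ]
      exact (contDiffAt_arcV₁ (p := ((r₁, r₂, t), φ)) hμ hne₁ hne₂ hpos hy).differentiableAt
        one_ne_zero
    refine (h1.comp (r₁, r₂, t) hpair.differentiableAt).congr_of_eventuallyEq ?_
    filter_upwards [hev] with x hx
    rw [lambertV₁, hx]
    rfl
  have hd₂ : DifferentiableAt ℝ (fun x : E3 × E3 × ℝ => lambertV₂ μ d x.1 x.2.1 x.2.2)
      (r₁, r₂, t) := by
    have h1 : DifferentiableAt ℝ
        (fun p : (E3 × E3 × ℝ) × ℝ => arcV₂ μ d p.1.1 p.1.2.1 p.2)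
        ((r₁, r₂, t), ψ (r₁, r₂, t)) := by
      rw [hψφ]
      exact (contDiffAt_arcV₂ (p := ((r₁, r₂, t), φ)) hμ hne₁ hne₂ hpos hy).differentiableAt
        one_ne_zero
    refine (h1.comp (r₁, r₂, t) hpair.differentiableAt).congr_of_eventuallyEq ?_
    filter_upwards [hev] with x hx
    rw [lambertV₂, hx]
    rfl
  -- the derivative in time
  have hline : ContinuousAt (fun s : ℝ => (r₁, r₂, s)) t := by fun_prop
  have hψt : DifferentiableAt ℝ (fun s : ℝ => ψ (r₁, r₂, s)) t :=
    DifferentiableAt.comp (f := fun s : ℝ => (r₁, r₂, s)) t hψd (by fun_prop)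
  have hψ' : deriv (fun s : ℝ => ψ (r₁, r₂, s)) t =
      (flightTimeDeriv μ (‖r₁‖ + ‖r₂‖) (meanCos d r₁ r₂) φ)⁻¹ := by
    have h1 : HasDerivAt (flightTime μ (‖r₁‖ + ‖r₂‖) (meanCos d r₁ r₂))
        (flightTimeDeriv μ (‖r₁‖ + ‖r₂‖) (meanCos d r₁ r₂) φ) (ψ (r₁, r₂, t)) := by
      rw [hψφ]
      exact hasDerivAt_flightTime hμ hy hφ
    have h2 := HasDerivAt.comp t h1 hψt.hasDerivAt
    have h3 : (flightTime μ (‖r₁‖ + ‖r₂‖) (meanCos d r₁ r₂) ∘ fun s : ℝ => ψ (r₁, r₂, s))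
        =ᶠ[𝓝 t] id := by
      filter_upwards [hline.eventually hψ] with s hs
      exact hs.2
    exact eq_inv_of_mul_eq_one_right
      ((h2.congr_of_eventuallyEq h3.symm).unique (hasDerivAt_id t))
  -- The derivative in time is the bounded derivative in the phase divided by that of the time of
  -- flight, hence `O(sin⁴ φ)`.
  have hrate : ∀ {A : ℝ → E3} {D : E3}, HasDerivAt A D φ → ‖D‖ ≤ K →
      ‖deriv (fun s => A (ψ (r₁, r₂, s))) t‖ < ε := by
    intro A D hA hD
    have h1 : HasDerivAt A D (ψ (r₁, r₂, t)) := by rwa [hψφ]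
    have h2 := h1.scomp t hψt.hasDerivAt
    have h3 : deriv (fun s => A (ψ (r₁, r₂, s))) t = _ := h2.deriv
    rw [h3, hψ', norm_smul, norm_inv, Real.norm_eq_abs, abs_of_pos hDpos]
    have h4 : (flightTimeDeriv μ (‖r₁‖ + ‖r₂‖) (meanCos d r₁ r₂) φ)⁻¹ ≤ Real.sin φ ^ 4 / c := by
      rw [inv_le_comm₀ hDpos (by positivity), inv_div]
      exact hφD
    have h5 : Real.sin φ ^ 4 < ε * c / K := by
      have e1 : Real.sin φ ^ 4 ≤ Real.sin φ := by
        calc Real.sin φ ^ 4 ≤ Real.sin φ ^ 1 :=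
              pow_le_pow_of_le_one hsin.le (Real.sin_le_one φ) (by norm_num)
          _ = _ := pow_one _
      exact e1.trans_lt (hφs.trans_le ((min_le_right _ _).trans (min_le_left _ _)))
    calc _ ≤ Real.sin φ ^ 4 / c * K := by gcongr
      _ < (ε * c / K) / c * K := by gcongr
      _ = ε := by field_simp
  obtain ⟨D₁, hD₁, hD₁K⟩ := exists_hasDerivAt_arcV₁ (d := d) (a := a / 2) (b := 2 * b) hμ hδ0 hδ hρ
    (half_pos ha) (by linarith) (by linarith) (by linarith)
  obtain ⟨D₂, hD₂, hD₂K⟩ := exists_hasDerivAt_arcV₂ (d := d) (a := a / 2) (b := 2 * b) hμ hδ0 hδ hρ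
    (half_pos ha) (by linarith) (by linarith) (by linarith)
  have hval := lambertVelocities_eq hφw
  have hvis : 2 * μ * Real.sin φ ^ 2 / chordParam (‖r₁‖ + ‖r₂‖) (meanCos d r₁ r₂) φ < ε := by
    have e1 : Real.sin φ ^ 2 ≤ Real.sin φ := by
      calc Real.sin φ ^ 2 ≤ Real.sin φ ^ 1 :=
            pow_le_pow_of_le_one hsin.le (Real.sin_le_one φ) (by norm_num)
        _ = _ := pow_one _
    have e2 : Real.sin φ ^ 2 < ε * δ / (2 * μ) :=
      e1.trans_lt (hφs.trans_le ((min_le_right _ _).trans (min_le_right _ _)))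
    calc _ ≤ 2 * μ * Real.sin φ ^ 2 / δ := by gcongr
      _ < 2 * μ * (ε * δ / (2 * μ)) / δ := by gcongr
      _ = ε := by field_simp
  refine ⟨⟨_, (hφw _).mpr rfl, fun w hw => (hφw w).mp hw⟩, hd₁, hd₂, ?_, ?_, ?_, ?_⟩
  · have e : lambertV₁ μ d r₁ r₂ =ᶠ[𝓝 t] fun s => arcV₁ μ d r₁ r₂ (ψ (r₁, r₂, s)) := by
      filter_upwards [hline.eventually hev] with s hs
      rw [lambertV₁, hs]
    rw [e.deriv_eq]
    exact hrate hD₁ hD₁K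
  · have e : lambertV₂ μ d r₁ r₂ =ᶠ[𝓝 t] fun s => arcV₂ μ d r₁ r₂ (ψ (r₁, r₂, s)) := by
      filter_upwards [hline.eventually hev] with s hs
      rw [lambertV₂, hs]
    rw [e.deriv_eq]
    exact hrate hD₂ hD₂K
  · rw [lambertV₁, hval, norm_arcV₁_sq hμ hne₁ hρ hy]
    linarith
  · rw [lambertV₂, hval, norm_arcV₂_sq hμ hne₂ hρ hy]
    linarith

theorem abs_deriv_norm_le {V : Type*} [NormedAddCommGroup V] [InnerProductSpace ℝ V]
    {f : ℝ → V} {f' : V} {t : ℝ} (hf : HasDerivAt f f' t) (h0 : f t ≠ 0) :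
    ∃ D, HasDerivAt (fun s => ‖f s‖) D t ∧ |D| ≤ ‖f'‖ := by
  have h := hasDerivWithinAt_norm_of_ne_zero hf.hasDerivWithinAt (s := univ) h0
  refine ⟨_, hasDerivWithinAt_univ.mp h, ?_⟩
  have hn : 0 < ‖f t‖ := norm_pos_iff.mpr h0
  rw [abs_div, abs_of_pos hn, div_le_iff₀ hn, mul_comm]
  exact abs_real_inner_le_norm _ _

/-! ### Derivatives of the cost -/

section Cost

variable {μ : ℝ} {o₁ o₂ : OrbitalElements} {d : TransferType} {M₁ M₂ t : ℝ}

theorem differentiableAt_cost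
    (h₁ : DifferentiableAt ℝ (fun x : E3 × E3 × ℝ => lambertV₁ μ d x.1 x.2.1 x.2.2)
      (orbitPos o₁ M₁, orbitPos o₂ M₂, t))
    (h₂ : DifferentiableAt ℝ (fun x : E3 × E3 × ℝ => lambertV₂ μ d x.1 x.2.1 x.2.2)
      (orbitPos o₁ M₁, orbitPos o₂ M₂, t))
    (n₁ : lambertV₁ μ d (orbitPos o₁ M₁) (orbitPos o₂ M₂) t - orbitVel μ o₁ M₁ ≠ 0)
    (n₂ : orbitVel μ o₂ M₂ - lambertV₂ μ d (orbitPos o₁ M₁) (orbitPos o₂ M₂) t ≠ 0) :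
    DifferentiableAt ℝ (fun x : ℝ × ℝ × ℝ => cost μ o₁ o₂ d x.1 x.2.1 x.2.2) (M₁, M₂, t) := by
  have p1 : DifferentiableAt ℝ (fun x : ℝ × ℝ × ℝ => orbitPos o₁ x.1) (M₁, M₂, t) :=
    DifferentiableAt.comp (g := orbitPos o₁) (f := Prod.fst) _
      (differentiable_orbitPos o₁ M₁) differentiableAt_fst
  have p2 : DifferentiableAt ℝ (fun x : ℝ × ℝ × ℝ => orbitPos o₂ x.2.1) (M₁, M₂, t) :=
    DifferentiableAt.comp (g := orbitPos o₂) (f := fun x : ℝ × ℝ × ℝ => x.2.1) _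
      (differentiable_orbitPos o₂ M₂) differentiableAt_snd.fst
  have v1 : DifferentiableAt ℝ (fun x : ℝ × ℝ × ℝ => orbitVel μ o₁ x.1) (M₁, M₂, t) :=
    DifferentiableAt.comp (g := orbitVel μ o₁) (f := Prod.fst) _
      (differentiable_orbitVel μ o₁ M₁) differentiableAt_fst
  have v2 : DifferentiableAt ℝ (fun x : ℝ × ℝ × ℝ => orbitVel μ o₂ x.2.1) (M₁, M₂, t) :=
    DifferentiableAt.comp (g := orbitVel μ o₂) (f := fun x : ℝ × ℝ × ℝ => x.2.1) _
      (differentiable_orbitVel μ o₂ M₂) differentiableAt_snd.fst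
  have hP : DifferentiableAt ℝ
      (fun x : ℝ × ℝ × ℝ => (orbitPos o₁ x.1, orbitPos o₂ x.2.1, x.2.2)) (M₁, M₂, t) :=
    p1.prodMk (p2.prodMk differentiableAt_snd.snd)
  have l1 := DifferentiableAt.comp (f := fun x : ℝ × ℝ × ℝ =>
    (orbitPos o₁ x.1, orbitPos o₂ x.2.1, x.2.2)) (M₁, M₂, t) h₁ hP
  have l2 := DifferentiableAt.comp (f := fun x : ℝ × ℝ × ℝ =>
    (orbitPos o₁ x.1, orbitPos o₂ x.2.1, x.2.2)) (M₁, M₂, t) h₂ hP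
  exact ((l1.sub v1).norm ℝ n₁).add ((v2.sub l2).norm ℝ n₂)

/-- The chain rule for the temporal constraints. -/
theorem temporalConstraint_eq {M₁₀ M₂₀ T : ℝ} (h₁ : M₁ = meanAnomaly μ o₁ M₁₀ T)
    (h₂ : M₂ = meanAnomaly μ o₂ M₂₀ (T + t))
    (h : DifferentiableAt ℝ (fun x : ℝ × ℝ × ℝ => cost μ o₁ o₂ d x.1 x.2.1 x.2.2) (M₁, M₂, t)) :
    temporalConstraint μ o₁ o₂ d M₁₀ M₂₀ T t =
      (meanMotion μ o₁ * (angularConstraint μ o₁ o₂ d M₁ M₂ t).1 +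
          meanMotion μ o₂ * (angularConstraint μ o₁ o₂ d M₁ M₂ t).2,
        meanMotion μ o₂ * (angularConstraint μ o₁ o₂ d M₁ M₂ t).2 +
          explicitRate μ o₁ o₂ d M₁ M₂ t) := by
  obtain ⟨L, hL⟩ := h
  -- All five derivatives are taken along curves through `(M₁, M₂, t)`, so each is the total
  -- derivative `L` applied to a tangent vector.
  have hcurve : ∀ {x y z : ℝ → ℝ} {x' y' z' s : ℝ}, HasDerivAt x x' s → HasDerivAt y y' s →
      HasDerivAt z z' s → x s = M₁ → y s = M₂ → z s = t →
      deriv (fun s => cost μ o₁ o₂ d (x s) (y s) (z s)) s = L (x', y', z') := by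
    intro x y z x' y' z' s hx hy hz ex ey ez
    have hL' : HasFDerivAt (fun x : ℝ × ℝ × ℝ => cost μ o₁ o₂ d x.1 x.2.1 x.2.2) L
        (x s, y s, z s) := by rwa [ex, ey, ez]
    exact (HasFDerivAt.comp_hasDerivAt (f := fun s => (x s, y s, z s)) s hL'
      (hx.prodMk (hy.prodMk hz))).deriv
  have hanom : ∀ (o : OrbitalElements) (M₀ s : ℝ),
      HasDerivAt (meanAnomaly μ o M₀) (meanMotion μ o) s := fun o M₀ s =>
    (((hasDerivAt_id s).const_mul (meanMotion μ o)).add_const M₀).congr_deriv (mul_one _)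
  have a1 : deriv (fun x => cost μ o₁ o₂ d x M₂ t) M₁ = L (1, 0, 0) :=
    hcurve (hasDerivAt_id M₁) (hasDerivAt_const M₁ M₂) (hasDerivAt_const M₁ t) rfl rfl rfl
  have a2 : deriv (fun x => cost μ o₁ o₂ d M₁ x t) M₂ = L (0, 1, 0) :=
    hcurve (hasDerivAt_const M₂ M₁) (hasDerivAt_id M₂) (hasDerivAt_const M₂ t) rfl rfl rfl
  have a3 : deriv (fun x => cost μ o₁ o₂ d M₁ M₂ x) t = L (0, 0, 1) :=
    hcurve (hasDerivAt_const t M₁) (hasDerivAt_const t M₂) (hasDerivAt_id t) rfl rfl rfl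
  have t1 : deriv (fun s => temporalCost μ o₁ o₂ d M₁₀ M₂₀ s t) T =
      L (meanMotion μ o₁, meanMotion μ o₂, 0) :=
    hcurve (hanom o₁ M₁₀ T) (HasDerivAt.comp_add_const T t (hanom o₂ M₂₀ (T + t)))
      (hasDerivAt_const T t) h₁.symm h₂.symm rfl
  have t2 : deriv (fun s => temporalCost μ o₁ o₂ d M₁₀ M₂₀ T s) t =
      L (0, meanMotion μ o₂, 1) :=
    hcurve (hasDerivAt_const t _) (HasDerivAt.comp_const_add T t (hanom o₂ M₂₀ (T + t)))
      (hasDerivAt_id t) h₁.symm h₂.symm rfl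
  have hlin : ∀ x y z : ℝ, L (x, y, z) = x * L (1, 0, 0) + y * L (0, 1, 0) + z * L (0, 0, 1) := by
    intro x y z
    rw [← smul_eq_mul, ← smul_eq_mul, ← smul_eq_mul, ← map_smul, ← map_smul, ← map_smul,
      ← map_add, ← map_add]
    simp
  rw [temporalConstraint, angularConstraint, explicitRate, t1, t2, a1, a2, a3,
    hlin (meanMotion μ o₁), hlin 0 (meanMotion μ o₂)]
  simp

theorem abs_explicitRate_le
    (h₁ : DifferentiableAt ℝ (lambertV₁ μ d (orbitPos o₁ M₁) (orbitPos o₂ M₂)) t)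
    (h₂ : DifferentiableAt ℝ (lambertV₂ μ d (orbitPos o₁ M₁) (orbitPos o₂ M₂)) t)
    (n₁ : lambertV₁ μ d (orbitPos o₁ M₁) (orbitPos o₂ M₂) t - orbitVel μ o₁ M₁ ≠ 0)
    (n₂ : orbitVel μ o₂ M₂ - lambertV₂ μ d (orbitPos o₁ M₁) (orbitPos o₂ M₂) t ≠ 0) :
    |explicitRate μ o₁ o₂ d M₁ M₂ t| ≤
      ‖deriv (lambertV₁ μ d (orbitPos o₁ M₁) (orbitPos o₂ M₂)) t‖ +
        ‖deriv (lambertV₂ μ d (orbitPos o₁ M₁) (orbitPos o₂ M₂)) t‖ := by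
  obtain ⟨D₁, hD₁, b₁⟩ := abs_deriv_norm_le (h₁.hasDerivAt.sub_const (orbitVel μ o₁ M₁)) n₁
  obtain ⟨D₂, hD₂, b₂⟩ := abs_deriv_norm_le (h₂.hasDerivAt.const_sub (orbitVel μ o₂ M₂)) n₂
  have h : explicitRate μ o₁ o₂ d M₁ M₂ t = D₁ + D₂ := (hD₁.add hD₂).deriv
  rw [h]
  rw [norm_neg] at b₂
  exact (abs_add_le _ _).trans (add_le_add b₁ b₂)

end Cost

end TwoImpulse

/-! ### Conclusion -/

open TwoImpulse in
theorem proposition1 (μ : ℝ) (hμ : 0 < μ) (o₁ o₂ : OrbitalElements) (d : TransferType)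
    (η : ℝ) (hη : 0 < η) (ε : ℝ) (hε : 0 < ε) :
    ∃ t₀ : ℝ, 0 < t₀ ∧ ∀ M₁₀ M₂₀ T t M₁ M₂ : ℝ, t₀ ≤ t →
      M₁ = meanAnomaly μ o₁ M₁₀ T → M₂ = meanAnomaly μ o₂ M₂₀ (T + t) →
      η ≤ Real.sin (InnerProductGeometry.angle (orbitPos o₁ M₁) (orbitPos o₂ M₂)) →
      -- the Lambert arc is well defined, and all derivatives below exist
      (∃! w : E3 × E3, IsLambertVelocities μ d (orbitPos o₁ M₁) (orbitPos o₂ M₂) t w) ∧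
      DifferentiableAt ℝ (lambertV₁ μ d (orbitPos o₁ M₁) (orbitPos o₂ M₂)) t ∧
      DifferentiableAt ℝ (lambertV₂ μ d (orbitPos o₁ M₁) (orbitPos o₂ M₂)) t ∧
      DifferentiableAt ℝ (fun x : ℝ × ℝ × ℝ => cost μ o₁ o₂ d x.1 x.2.1 x.2.2) (M₁, M₂, t) ∧
      -- the explicit sensitivities to the time of flight vanish in the limit
      ‖deriv (lambertV₁ μ d (orbitPos o₁ M₁) (orbitPos o₂ M₂)) t‖ < ε ∧
      ‖deriv (lambertV₂ μ d (orbitPos o₁ M₁) (orbitPos o₂ M₂)) t‖ < ε ∧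
      |explicitRate μ o₁ o₂ d M₁ M₂ t| < ε ∧
      -- the temporal constraints by the chain rule
      temporalConstraint μ o₁ o₂ d M₁₀ M₂₀ T t =
        (meanMotion μ o₁ * (angularConstraint μ o₁ o₂ d M₁ M₂ t).1 +
            meanMotion μ o₂ * (angularConstraint μ o₁ o₂ d M₁ M₂ t).2,
          meanMotion μ o₂ * (angularConstraint μ o₁ o₂ d M₁ M₂ t).2 +
            explicitRate μ o₁ o₂ d M₁ M₂ t) ∧
      -- after a fixed invertible linear change, they approach the angular constraints
      |((temporalConstraint μ o₁ o₂ d M₁₀ M₂₀ T t).1 -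
            (temporalConstraint μ o₁ o₂ d M₁₀ M₂₀ T t).2) / meanMotion μ o₁ -
          (angularConstraint μ o₁ o₂ d M₁ M₂ t).1| < ε ∧
      |(temporalConstraint μ o₁ o₂ d M₁₀ M₂₀ T t).2 / meanMotion μ o₂ -
          (angularConstraint μ o₁ o₂ d M₁ M₂ t).2| < ε ∧
      -- so either stationarity condition implies the other one up to `ε`
      (temporalConstraint μ o₁ o₂ d M₁₀ M₂₀ T t = 0 →
        ‖angularConstraint μ o₁ o₂ d M₁ M₂ t‖ < ε) ∧
      (angularConstraint μ o₁ o₂ d M₁ M₂ t = 0 →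
        ‖temporalConstraint μ o₁ o₂ d M₁₀ M₂₀ T t‖ < ε) := by
  have p₁ := periapsis_pos o₁
  have p₂ := periapsis_pos o₂
  have a₁ := o₁.a_pos
  have a₂ := o₂.a_pos
  have m₁ := meanMotion_pos hμ o₁
  have m₂ := meanMotion_pos hμ o₂
  -- The sum of the two velocity rates is below `2κ`, and must stay below `ε` also after division by
  -- a mean motion. The bounds `κ ≤ μ / a` separate the arc from the ellipses.
  obtain ⟨κ, hκ0, hκε, hκ₁, hκ₂, hκa₁, hκa₂⟩ : ∃ κ : ℝ, 0 < κ ∧ 2 * κ ≤ ε ∧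
      2 * κ ≤ meanMotion μ o₁ * ε ∧ 2 * κ ≤ meanMotion μ o₂ * ε ∧ κ ≤ μ / o₁.a ∧ κ ≤ μ / o₂.a := by
    have h1 : 0 < meanMotion μ o₁ * ε := mul_pos m₁ hε
    have h2 : 0 < meanMotion μ o₂ * ε := mul_pos m₂ hε
    have h3 : 0 < μ / o₁.a := div_pos hμ a₁
    have h4 : 0 < μ / o₂.a := div_pos hμ a₂
    refine ⟨min (min (ε / 2) (min (meanMotion μ o₁ * ε / 2) (meanMotion μ o₂ * ε / 2)))
      (min (μ / o₁.a) (μ / o₂.a)), by positivity, ?_, ?_, ?_,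
      (min_le_right _ _).trans (min_le_left _ _), (min_le_right _ _).trans (min_le_right _ _)⟩
    · linarith [(min_le_left (min (ε / 2) (min (meanMotion μ o₁ * ε / 2) (meanMotion μ o₂ * ε / 2)))
        (min (μ / o₁.a) (μ / o₂.a))).trans (min_le_left _ _)]
    · linarith [(min_le_left (min (ε / 2) (min (meanMotion μ o₁ * ε / 2) (meanMotion μ o₂ * ε / 2)))
        (min (μ / o₁.a) (μ / o₂.a))).trans ((min_le_right _ _).trans (min_le_left _ _))]
    · linarith [(min_le_left (min (ε / 2) (min (meanMotion μ o₁ * ε / 2) (meanMotion μ o₂ * ε / 2)))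
        (min (μ / o₁.a) (μ / o₂.a))).trans ((min_le_right _ _).trans (min_le_right _ _))]
  obtain ⟨t₁, ht₁, hreg⟩ := exists_lambert_regularity hμ d (lt_min p₁ p₂)
    (show 0 < 2 * o₁.a + 2 * o₂.a by positivity) hη hκ0
  refine ⟨t₁ + 1, by linarith, fun M₁₀ M₂₀ T t M₁ M₂ ht hM₁ hM₂ hs => ?_⟩
  obtain ⟨hex, hd₁, hd₂, hb₁, hb₂, hv₁, hv₂⟩ := hreg (orbitPos o₁ M₁) (orbitPos o₂ M₂) t
    ((min_le_left _ _).trans (periapsis_le_norm_orbitPos o₁ M₁))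
    ((min_le_right _ _).trans (periapsis_le_norm_orbitPos o₂ M₂))
    (by linarith [norm_orbitPos_le o₁ M₁]) (by linarith [norm_orbitPos_le o₂ M₂]) hs (by linarith)
  -- Vis-viva on the ellipse gives squared speed `2μ/‖r₁‖ - μ/a`, while on the arc it exceeds
  -- `2μ/‖r₁‖ - κ`. So the impulse is nonzero and its norm differentiable.
  have hn₁ : lambertV₁ μ d (orbitPos o₁ M₁) (orbitPos o₂ M₂) t - orbitVel μ o₁ M₁ ≠ 0 := by
    intro h
    rw [sub_eq_zero.mp h, norm_orbitVel_sq hμ] at hv₁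
    linarith
  have hn₂ : orbitVel μ o₂ M₂ - lambertV₂ μ d (orbitPos o₁ M₁) (orbitPos o₂ M₂) t ≠ 0 := by
    intro h
    rw [← sub_eq_zero.mp h, norm_orbitVel_sq hμ] at hv₂
    linarith
  have hd₁t : DifferentiableAt ℝ (lambertV₁ μ d (orbitPos o₁ M₁) (orbitPos o₂ M₂)) t :=
    DifferentiableAt.comp (f := fun s : ℝ => (orbitPos o₁ M₁, orbitPos o₂ M₂, s)) t hd₁
      (by fun_prop)
  have hd₂t : DifferentiableAt ℝ (lambertV₂ μ d (orbitPos o₁ M₁) (orbitPos o₂ M₂)) t :=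
    DifferentiableAt.comp (f := fun s : ℝ => (orbitPos o₁ M₁, orbitPos o₂ M₂, s)) t hd₂
      (by fun_prop)
  have hJ := differentiableAt_cost hd₁ hd₂ hn₁ hn₂
  have hrate : |explicitRate μ o₁ o₂ d M₁ M₂ t| < 2 * κ := by
    linarith [abs_explicitRate_le hd₁t hd₂t hn₁ hn₂]
  have hchain := temporalConstraint_eq hM₁ hM₂ hJ
  refine ⟨hex, hd₁t, hd₂t, hJ, by linarith, by linarith, by linarith, hchain, ?_⟩
  rw [hchain]
  generalize angularConstraint μ o₁ o₂ d M₁ M₂ t = A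
  generalize explicitRate μ o₁ o₂ d M₁ M₂ t = D at hrate
  obtain ⟨x, y⟩ := A
  generalize meanMotion μ o₁ = n₁ at *
  generalize meanMotion μ o₂ = n₂ at *
  have e₁ : |D / n₁| < ε := by
    rw [abs_div, abs_of_pos m₁, div_lt_iff₀ m₁]
    linarith
  have e₂ : |D / n₂| < ε := by
    rw [abs_div, abs_of_pos m₂, div_lt_iff₀ m₂]
    linarith
  -- With `D` for `δJ/δt`, the linear change leaves exactly the errors `-D / n₁` and `D / n₂`, and
  -- the triangular system can be solved in either direction.
  refine ⟨?_, ?_, fun h => ?_, fun h => ?_⟩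
  · have : (n₁ * x + n₂ * y - (n₂ * y + D)) / n₁ - x = -(D / n₁) := by
      field_simp
      ring
    rw [this, abs_neg]
    exact e₁
  · have : (n₂ * y + D) / n₂ - y = D / n₂ := by
      field_simp
      ring
    rw [this]
    exact e₂
  · obtain ⟨h1, h2⟩ := Prod.mk.inj h
    have hy : y = -(D / n₂) := by
      field_simp
      linarith
    have hx : x = D / n₁ := by
      field_simp
      linarith
    rw [Prod.norm_def]
    refine max_lt ?_ ?_
    · rw [hx]
      exact e₁
    · rw [hy, norm_neg]
      exact e₂
  · obtain ⟨h1, h2⟩ := Prod.mk.inj h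
    rw [h1, h2, Prod.norm_def]
    refine max_lt ?_ ?_
    · simpa using hε
    · simp only [mul_zero, zero_add, Real.norm_eq_abs]
      linarith
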